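/- Setting. Let $(I,d_I)$ be a compact metric space with a finite nonzero Borel measure $m$; write $|A|=m(A)$. Let $I_0,I_1\subset I$ be disjoint open sets with $m(I\setminus(I_0\cup I_1))=0$ and let $F\colon I_0\cup I_1\to I$ be a measurable map such that: (i) there is $\lambda>1$ with $d_I(F(x),F(y))\ge\lambda\, d_I(x,y)$ for all $x,y\in I_i$, $i=0,1$; (ii) there is a H\"older function $g\colon I\to\mathbb{R}$ with $g>1$ everywhere and $\int_{I_i} (u\circ F)\, g\,dm=\int_I u\,dm$ for every $m$-integrable $u$ and $i=0,1$; (iii) $m(I\setminus F(I_i))=0$ for $i=0,1$. Let $\mathcal{P}^0=\{I\}$, $\mathcal{P}^1=\{I_0,I_1\}$ and let $\mathcal{P}^k$ be the partition (up to null sets) into the sets $\{x\colon F^jx\in I_{i_j},\ 0\le j<k\}$; put $\mathcal{P}=\bigcup_k\mathcal{P}^k$. Each $P=\{x\colon F^jx\in I_{i_j},\ 0\le j<k\}\in\mathcal{P}^k$ has two children $Q^P_1,Q^P_2\in\mathcal{P}^{k+1}$, obtained by adding the condition $F^kx\in I_0$, respectively $F^kx\in I_1$. Let $\phi_P=1_{Q_1^P}/|Q_1^P|-1_{Q_2^P}/|Q_2^P|$.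 A \emph{distribution} is a formal series $v=c_0 1_I+\sum_{P\in\mathcal{P}}c_P\phi_P$ with real (respectively complex) coefficients. For $t\in\mathbb{R}$, $\mathcal{B}^t_{1,1}$ is the space of the distributions $v=d_0 1_I+\sum_P d_P|P|^t\phi_P$ with $|v|_{\mathcal{B}^t_{1,1}}=|d_0|+\sum_P|d_P|<\infty$, and $\mathcal{B}^t_{\infty,\infty}$ is the space of the series $c_01_I+\sum_P c_P|P|^{t+1}\phi_P$ with $\sup_P|c_P|<\infty$; an integrable function is identified with its expansion in the orthogonal system $\{1_I\}\cup\{\phi_P\}$. For a distribution $v=c_0 1_I+\sum_P c_P\phi_P$ and a function $\theta$, let $\langle v,\theta\rangle=c_0\int\theta\,dm+\sum_P c_P\int\phi_P\theta\,dm$, and let $v\circ F^k=c_01_I+\sum_P c_P\,(\phi_P\circ F^k)$, where each $\phi_P\circ F^k$ is expanded in the system $\{1_I\}\cup\{\phi_P\}$ and the coefficients are summed. Theorem (Distributional solutions for the Liv\v{s}ic equation I). Let $0<s<\gamma$ and suppose $\log g\in\mathcal{B}^\gamma_{\infty,\infty}$. Then $F$ has a unique invariant probability $\mu\ll m$; let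 $\rho=d\mu/dm$. The pairing $v\mapsto\langle v,\rho\rangle$ is well defined (the series converges) and bounded on $\mathcal{B}^{-s}_{1,1}$, and for every $v\in\mathcal{B}^{-s}_{1,1}$ and $k\ge 0$ the composition $v\circ F^k$ is well defined (the series of its coefficients converge) and belongs to $\mathcal{B}^{-s}_{1,1}$. Let $V_0=\{v\in\mathcal{B}^{-s}_{1,1}\colon\langle v,\rho\rangle=0\}$. For every $\phi\in V_0$ there is a distribution $\psi\in\mathcal{B}^{-s}_{1,1}$, unique up to the addition of a multiple of $1_I$, that solves $$\phi=\psi\circ F-\psi .$$ Up to the addition of a constant, $\psi$ is equal to $$\psi_\phi=-\sum_{k=0}^\infty\phi\circ F^k ,$$ where the series converges in $\mathcal{B}^{-s}_{1,1}$. Moreover $\psi_\phi\in V_0$, and $\phi\in V_0\mapsto\psi_\phi\in V_0$ is a bounded linear transformation. -/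

import Mathlib

open MeasureTheory Filter Topology
open scoped NNReal

namespace Livsic

noncomputable section

/-- `F : J 0 ∪ J 1 → X` is an onto Markovian expanding map with two branches, on a compact metric
space `X` with a reference measure `m`, with Hölder Jacobian `g > 1`.  Here `F` is extended to a
measurable map on `X`; its values on the `m`-null set `(J 0 ∪ J 1)ᶜ` play no role. -/
structure IsMarkovExpanding {X : Type*} [MetricSpace X] [MeasurableSpace X]
    (m : Measure X) (J : Fin 2 → Set X) (F : X → X) (g : X → ℝ) : Prop where
  isOpen : ∀ i, IsOpen (J i)
  disjoint : Disjoint (J 0) (J 1)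
  ae_cover : m (J 0 ∪ J 1)ᶜ = 0
  measurable : Measurable F
  expanding : ∃ c : ℝ, 1 < c ∧ ∀ i, ∀ x ∈ J i, ∀ y ∈ J i, c * dist x y ≤ dist (F x) (F y)
  holder : ∃ C α : ℝ≥0, 0 < α ∧ HolderWith C α g
  one_lt : ∀ x, 1 < g x
  jacobian : ∀ i, ∀ u : X → ℝ, Integrable u m →
    ∫ x in J i, u (F x) * g x ∂m = ∫ x, u x ∂m
  onto : ∀ i, m (F '' J i)ᶜ = 0

/-- `μ` is an `F`-invariant probability measure, absolutely continuous with respect to `m`. -/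
structure IsACIP {X : Type*} [MeasurableSpace X] (m : Measure X) (F : X → X) (μ : Measure X) :
    Prop where
  prob : IsProbabilityMeasure μ
  ac : μ ≪ m
  invariant : MeasurePreserving F μ μ

/-- The density `ρ = dμ/dm`. -/
def density {X : Type*} [MeasurableSpace X] (m μ : Measure X) (x : X) : ℝ :=
  (μ.rnDeriv m x).toReal

/-- The element `{x | x ∈ J i₀, F x ∈ J i₁, …, F^(k-1) x ∈ J i_(k-1)}` of the Markov partition
`𝒫^k` with itinerary `w = [i₀, …, i_(k-1)]`. The children of `cyl J F w` are
`cyl J F (w ++ [0])` and `cyl J F (w ++ [1])`, and `F` maps `cyl J F (i :: w)` to `cyl J F w`. -/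
def cyl {X : Type*} (J : Fin 2 → Set X) (F : X → X) : List (Fin 2) → Set X
  | [] => Set.univ
  | i :: w => J i ∩ F ⁻¹' cyl J F w

/-- The unbalanced Haar system: `1_I` (index `none`) and
`φ_P = 1_{Q₁} / |Q₁| - 1_{Q₂} / |Q₂|`, with `Q₁, Q₂` the children of `P = cyl J F w`
(index `some w`). -/
def haar {X : Type*} [MeasurableSpace X] (m : Measure X) (J : Fin 2 → Set X) (F : X → X) :
    Option (List (Fin 2)) → X → ℝ
  | none => fun _ => 1
  | some w => fun x =>
      (cyl J F (w ++ [0])).indicator 1 x / m.real (cyl J F (w ++ [0])) -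
        (cyl J F (w ++ [1])).indicator 1 x / m.real (cyl J F (w ++ [1]))

/-- A distribution, that is, a formal series `v none • 1_I + ∑_w v (some w) • φ_{cyl w}`. -/
abbrev Distribution (𝕜 : Type*) : Type _ := Option (List (Fin 2)) → 𝕜

/-- The distribution `1_I`. -/
def one (𝕜 : Type*) [RCLike 𝕜] : Distribution 𝕜 := Pi.single none 1

/-- The size attached to an index of the Haar system: `|P|` for `φ_P`, and `1` for `1_I`. -/
def weight {X : Type*} [MeasurableSpace X] (m : Measure X) (J : Fin 2 → Set X) (F : X → X) :
    Option (List (Fin 2)) → ℝ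
  | none => 1
  | some w => m.real (cyl J F w)

/-- The coefficients of an integrable function with respect to the (orthogonal) Haar system. -/
def haarCoeff {X : Type*} [MeasurableSpace X] (m : Measure X) (J : Fin 2 → Set X) (F : X → X)
    (f : X → ℝ) : Distribution ℝ :=
  fun b => (∫ x, f x * haar m J F b x ∂m) / ∫ x, haar m J F b x ^ 2 ∂m

/-- Membership in the Besov space `B^s_{∞,∞}`: writing the coefficient of `φ_P` as
`c_P |P|^(s+1)`, one has `sup_P |c_P| < ∞`. -/
def MemBesovInf {X : Type*} [MeasurableSpace X] (m : Measure X) (J : Fin 2 → Set X) (F : X → X)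
    (s : ℝ) (v : Distribution ℝ) : Prop :=
  ∃ C : ℝ, ∀ w : List (Fin 2), ‖v (some w)‖ * m.real (cyl J F w) ^ (-(s + 1)) ≤ C

/-- The norm of `B^s_{1,1}`: writing `v = d₀ 1_I + ∑_P d_P |P|^s φ_P`, it is
`|d₀| + ∑_P |d_P|`. -/
def besovNorm {𝕜 : Type*} [RCLike 𝕜] {X : Type*} [MeasurableSpace X] (m : Measure X)
    (J : Fin 2 → Set X) (F : X → X) (s : ℝ) (v : Distribution 𝕜) : ℝ :=
  ∑' a, ‖v a‖ * weight m J F a ^ (-s)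

theorem weight_nonneg {X : Type*} [MeasurableSpace X] (m : Measure X) (J : Fin 2 → Set X)
    (F : X → X) (a : Option (List (Fin 2))) : 0 ≤ weight m J F a := by
  cases a with
  | none => exact zero_le_one
  | some w => exact measureReal_nonneg

/-- The Besov space `B^s_{1,1}`: the formal series of finite norm. -/
def besov (𝕜 : Type*) [RCLike 𝕜] {X : Type*} [MeasurableSpace X] (m : Measure X)
    (J : Fin 2 → Set X) (F : X → X) (s : ℝ) : Submodule 𝕜 (Distribution 𝕜) where
  carrier := {v | Summable fun a => ‖v a‖ * weight m J F a ^ (-s)}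
  zero_mem' := by simp
  add_mem' := by
    intro v w hv hw
    refine Summable.of_nonneg_of_le
      (fun a => mul_nonneg (norm_nonneg _) (Real.rpow_nonneg (weight_nonneg m J F a) _))
      (fun a => ?_) (hv.add hw)
    rw [← add_mul]
    exact mul_le_mul_of_nonneg_right (norm_add_le _ _)
      (Real.rpow_nonneg (weight_nonneg m J F a) _)
  smul_mem' := by
    intro c v hv
    have h := Summable.mul_left ‖c‖ hv
    simpa [norm_mul, mul_assoc] using h

/-- The terms of the series `⟨v, θ⟩ = v₀ ∫ θ dm + ∑_P v_P ∫ φ_P θ dm`. -/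
def pairingTerm {𝕜 : Type*} [RCLike 𝕜] {X : Type*} [MeasurableSpace X] (m : Measure X)
    (J : Fin 2 → Set X) (F : X → X) (v : Distribution 𝕜) (θ : X → ℝ)
    (a : Option (List (Fin 2))) : 𝕜 :=
  v a * ((∫ x, haar m J F a x * θ x ∂m : ℝ) : 𝕜)

/-- The subspace of all `v ∈ B^s_{1,1}` with `⟨v, θ⟩ = 0`. -/
def annihilator (𝕜 : Type*) [RCLike 𝕜] {X : Type*} [MeasurableSpace X] (m : Measure X)
    (J : Fin 2 → Set X) (F : X → X) (s : ℝ) (θ : X → ℝ) : Submodule 𝕜 (Distribution 𝕜) where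
  carrier := {v | v ∈ besov 𝕜 m J F s ∧ HasSum (pairingTerm m J F v θ) 0}
  zero_mem' := by
    refine ⟨Submodule.zero_mem _, ?_⟩
    have h : pairingTerm m J F (0 : Distribution 𝕜) θ = fun _ => 0 := by
      funext a; simp [pairingTerm]
    rw [h]; exact hasSum_zero
  add_mem' := by
    rintro v w ⟨hv, hv'⟩ ⟨hw, hw'⟩
    refine ⟨Submodule.add_mem _ hv hw, ?_⟩
    have h : pairingTerm m J F (v + w) θ =
        fun a => pairingTerm m J F v θ a + pairingTerm m J F w θ a := by
      funext a; simp [pairingTerm, add_mul]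
    rw [h]; simpa using hv'.add hw'
  smul_mem' := by
    rintro c v ⟨hv, hv'⟩
    refine ⟨Submodule.smul_mem _ c hv, ?_⟩
    have h : pairingTerm m J F (c • v) θ = fun a => c * pairingTerm m J F v θ a := by
      funext a; simp [pairingTerm, mul_assoc]
    rw [h]; simpa using hv'.mul_left c

/-- The contribution of the term `v_a h_a` of the series `v = ∑_a v_a h_a` to the coefficient with
index `b` of the composition `v ∘ G = ∑_a v_a (h_a ∘ G)`, with `(h_a)` the Haar system. -/
def compTerm {𝕜 : Type*} [RCLike 𝕜] {X : Type*} [MeasurableSpace X] (m : Measure X)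
    (J : Fin 2 → Set X) (F : X → X) (G : X → X) (v : Distribution 𝕜)
    (b a : Option (List (Fin 2))) : 𝕜 :=
  v a * ((haarCoeff m J F (fun x => haar m J F a (G x)) b : ℝ) : 𝕜)

/-- The composition `v ∘ G` of a distribution `v` with a map `G : X → X`, obtained by composing the
series of `v` with `G` term by term. -/
def comp {𝕜 : Type*} [RCLike 𝕜] {X : Type*} [MeasurableSpace X] (m : Measure X)
    (J : Fin 2 → Set X) (F : X → X) (G : X → X) (v : Distribution 𝕜) : Distribution 𝕜 :=
  fun b => ∑' a, compTerm m J F G v b a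

end

end Livsic

/-!
Every quantity in the statement depends only on the measures `p w = m (cyl w)` of the cylinders:
`push` describes on masses of cylinders the push-forward by `F`, and the matrix of the composition
with `F^n` in the Haar system is `kernel p n`. The theorem is therefore proved for weights on words.

*Gibbs weights.* The Haar coefficients of `log g` being `O(|P|^(γ+1))`, summing them over the
descendants of a cylinder `P` shows that `log g` oscillates by `O(|P|^γ)` on `P`; this requires the
children of a cylinder to have measure comparable to its own, which follows from the Hölder
continuity of `g` and the expansion. Hence the distortion of all inverse branches of all iterates on
`P` is `O(|P|^γ)` (`IsMarkovExpanding.exists_isGibbs`, `IsGibbs.distortion_append`).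

*Loss of memory.* Probability measures whose log-densities oscillate by at most `A |P|^γ` on each
cylinder `P` form a class (`IsNormal`) which, for a suitable `A`, is preserved by `push` even after
a fixed proportion of the reference measure is removed. Two members of the class thus share a
further proportion of their mass at each step (`exists_push_pow_sub_eq`), which gives an invariant
member of the class and exponential convergence to it. The invariant mass function is realized by a
density, the uniform limit of its densities on cylinders of given length, and approximating an
integrable density by combinations of indicators of cylinders shows that no other absolutely
continuous probability is invariant (`IsMarkovExpanding.exists_isACIP`,
`IsMarkovExpanding.isACIP_unique`).

*Decay in `B^{-s}_{1,1}`.* This is a weighted `ℓ¹` space, so it is enough to estimate the images of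
single Haar functions `φ_P` (`exists_centered_le`). The coefficient of `φ_P ∘ F^n` on a cylinder `Q`
of length less than `n` is small since `F^n` equidistributes the two halves of `φ_Q`. If `Q` has
length at least `n`, the coefficient vanishes unless `F^n Q` contains `P`. For `F^n Q = P` the sum
of `|Q|^(s+1) / |P|` over the inverse branches is `O(q^n |P|^s)` by the expansion. For larger
`F^n Q` the coefficient is a difference of distortions, hence `O(|P|^γ)`, and `γ > s`. Altogether
the norm of `φ_P ∘ F^n - ∫ φ_P dμ` is at most `C (n + 1) q^n |P|^s` with `q < 1`.

*The equation.* The series `- ∑ φ ∘ F^k` therefore converges in operator norm on the kernel of the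
invariant functional and telescopes to a solution; a difference of two solutions is invariant, hence
equal to its own projection onto the constants (`IsMixing.kernelApply_solve_sub`,
`IsMixing.eq_smul_of_kernelApply_eq`).
-/

namespace Livsic

theorem _root_.HasSum.of_eq {ι α : Type*} [AddCommMonoid α] [TopologicalSpace α] {f g : ι → α}
    {a b : α} (h : HasSum f a) (hfg : ∀ i, g i = f i) (hab : b = a) : HasSum g b := by
  rw [hab, funext hfg]; exact h

/-! ### Masses of cylinders -/

/-- The push-forward by `F`, on the level of masses of cylinders: since `F⁻¹ (cyl w)` is, up to a
null set, the disjoint union of `cyl (0 :: w)` and `cyl (1 :: w)`, a measure giving mass `ν w` to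
`cyl w` has a push-forward giving it mass `push ν w`. -/
def push : (List (Fin 2) → ℝ) →ₗ[ℝ] (List (Fin 2) → ℝ) where
  toFun ν := fun w => ν (0 :: w) + ν (1 :: w)
  map_add' ν ν' := by funext w; simp only [Pi.add_apply]; ring
  map_smul' c ν := by funext w; simp only [Pi.smul_apply, smul_eq_mul, RingHom.id_apply]; ring

theorem push_apply (ν : List (Fin 2) → ℝ) (w : List (Fin 2)) :
    push ν w = ν (0 :: w) + ν (1 :: w) := rfl

theorem push_pow_succ (n : ℕ) (ν : List (Fin 2) → ℝ) :
    (push ^ (n + 1)) ν = (push ^ n) (push ν) := by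
  rw [pow_succ]; rfl

theorem push_pow_succ' (n : ℕ) (ν : List (Fin 2) → ℝ) :
    (push ^ (n + 1)) ν = push ((push ^ n) ν) := by
  rw [pow_succ']; rfl

theorem push_pow_eq_self {μ : List (Fin 2) → ℝ} (h : push μ = μ) (n : ℕ) :
    (push ^ n) μ = μ := by
  induction n with
  | zero => simp
  | succ n ih => rw [push_pow_succ, h, ih]

/-- `ν` is the mass function of a finitely additive measure on cylinders. -/
def IsAdditive (ν : List (Fin 2) → ℝ) : Prop := ∀ w, ν (w ++ [0]) + ν (w ++ [1]) = ν w

theorem IsAdditive.push {ν : List (Fin 2) → ℝ} (h : IsAdditive ν) : IsAdditive (push ν) := by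
  intro w
  have h0 := h (0 :: w)
  have h1 := h (1 :: w)
  simp only [push_apply, List.cons_append] at *
  linarith

theorem IsAdditive.push_pow {ν : List (Fin 2) → ℝ} (h : IsAdditive ν) (n : ℕ) :
    IsAdditive ((Livsic.push ^ n) ν) := by
  induction n with
  | zero => simpa using h
  | succ n ih => rw [push_pow_succ']; exact ih.push

theorem IsAdditive.push_pow_nil {ν : List (Fin 2) → ℝ} (h : IsAdditive ν) (n : ℕ) :
    (Livsic.push ^ n) ν [] = ν [] := by
  induction n with
  | zero => simp
  | succ n ih => rw [push_pow_succ', push_apply, ← ih]; exact h.push_pow n []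

/-- The words of length `n`. -/
def words : ℕ → Finset (List (Fin 2))
  | 0 => {[]}
  | n + 1 => (words n).image (List.cons 0) ∪ (words n).image (List.cons 1)

theorem mem_words {n : ℕ} {w : List (Fin 2)} : w ∈ words n ↔ w.length = n := by
  induction n generalizing w with
  | zero => simp [words]
  | succ n ih =>
    cases w with
    | nil => simp [words]
    | cons i w =>
      have hi : i = 0 ∨ i = 1 := by omega
      rcases hi with rfl | rfl <;> simp [words, ih]

theorem sum_words_succ (n : ℕ) (f : List (Fin 2) → ℝ) :
    ∑ w ∈ words (n + 1), f w = ∑ w ∈ words n, push f w := by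
  rw [words, Finset.sum_union, Finset.sum_image, Finset.sum_image, ← Finset.sum_add_distrib]
  · rfl
  · intro a _ b _ h; simpa using h
  · intro a _ b _ h; simpa using h
  · rw [Finset.disjoint_left]
    intro a ha hb
    simp only [Finset.mem_image] at ha hb
    obtain ⟨x, _, rfl⟩ := ha
    obtain ⟨y, _, h⟩ := hb
    simp at h

theorem sum_words (n : ℕ) (f : List (Fin 2) → ℝ) :
    ∑ w ∈ words n, f w = (push ^ n) f [] := by
  induction n generalizing f with
  | zero => simp [words]
  | succ n ih => rw [sum_words_succ, ih, push_pow_succ]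

theorem push_pow_apply (n : ℕ) (f : List (Fin 2) → ℝ) (w : List (Fin 2)) :
    (push ^ n) f w = ∑ v ∈ words n, f (v ++ w) := by
  induction n generalizing f with
  | zero => simp [words]
  | succ n ih => rw [push_pow_succ, ih, sum_words_succ]; rfl

/-- A nonnegative series over all words may be summed length by length. -/
theorem summable_of_sum_words_le {f : List (Fin 2) → ℝ} (hf : ∀ w, 0 ≤ f w) {c : ℝ}
    (h : ∀ K, ∑ k ∈ Finset.range K, ∑ w ∈ words k, f w ≤ c) : Summable f ∧ ∑' w, f w ≤ c := by
  have key : ∀ S : Finset (List (Fin 2)), ∑ w ∈ S, f w ≤ c := by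
    intro S
    have hS : S ⊆ (Finset.range (S.sup List.length + 1)).biUnion words := by
      intro w hw
      rw [Finset.mem_biUnion]
      exact ⟨w.length, Finset.mem_range.2 (Nat.lt_succ_of_le (Finset.le_sup hw)), mem_words.2 rfl⟩
    refine (Finset.sum_le_sum_of_subset_of_nonneg hS fun w _ _ => hf w).trans ?_
    rw [Finset.sum_biUnion]
    · exact h _
    · intro a _ b _ hab
      rw [Function.onFun, Finset.disjoint_left]
      intro w ha hb
      exact hab ((mem_words.1 ha).symm.trans (mem_words.1 hb))
  exact ⟨summable_of_sum_le hf key, Real.tsum_le_of_sum_le hf key⟩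

/-! ### The Haar system on masses of cylinders -/

/-- The part of the mass function `p` lying below the cylinder of `u`, as seen by cylinders at least
as deep as that of `u`; shallower cylinders get mass `0`. -/
def trunc (p : List (Fin 2) → ℝ) (u : List (Fin 2)) : List (Fin 2) → ℝ :=
  fun w => if u <+: w then p w else 0

theorem push_trunc_cons (p : List (Fin 2) → ℝ) (i : Fin 2) (u : List (Fin 2)) :
    push (trunc p (i :: u)) = trunc (fun w => p (i :: w)) u := by
  funext w
  have hi : i = 0 ∨ i = 1 := by omega
  rcases hi with rfl | rfl <;> simp [push_apply, trunc, List.cons_prefix_cons]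

theorem push_pow_trunc (p : List (Fin 2) → ℝ) (v u : List (Fin 2)) :
    (push ^ v.length) (trunc p (v ++ u)) = trunc (fun w => p (v ++ w)) u := by
  induction v generalizing p with
  | nil => simp
  | cons i v ih =>
    rw [List.length_cons, push_pow_succ, List.cons_append, push_trunc_cons, ih]
    rfl

/-- The integral of an element of the Haar system against a measure with mass function `ν`. -/
noncomputable def haarPair (p : List (Fin 2) → ℝ) :
    Option (List (Fin 2)) → (List (Fin 2) → ℝ) →ₗ[ℝ] ℝ
  | none => LinearMap.proj []
  | some w => (p (w ++ [0]))⁻¹ • LinearMap.proj (w ++ [0]) -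
      (p (w ++ [1]))⁻¹ • LinearMap.proj (w ++ [1])

/-- The mass function of an element of the Haar system. Truncation is harmless here: a cylinder
containing `cyl u` gets mass `0` from `φ_{cyl u}` because the two halves cancel. -/
noncomputable def haarMass (p : List (Fin 2) → ℝ) : Option (List (Fin 2)) → List (Fin 2) → ℝ
  | none => p
  | some u => (p (u ++ [0]))⁻¹ • trunc p (u ++ [0]) - (p (u ++ [1]))⁻¹ • trunc p (u ++ [1])

/-- The integral of the square of an element of the Haar system. -/
noncomputable def haarSq (p : List (Fin 2) → ℝ) : Option (List (Fin 2)) → ℝ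
  | none => p []
  | some w => (p (w ++ [0]))⁻¹ + (p (w ++ [1]))⁻¹

/-- The Haar coefficient of index `b` of the composition of the Haar function of index `a` with
`F^n`. -/
noncomputable def kernel (p : List (Fin 2) → ℝ) (n : ℕ) (b a : Option (List (Fin 2))) : ℝ :=
  haarPair p a ((push ^ n) (haarMass p b)) / haarSq p b

theorem haarPair_none (p ν : List (Fin 2) → ℝ) : haarPair p none ν = ν [] := rfl

theorem haarPair_some (p ν : List (Fin 2) → ℝ) (w : List (Fin 2)) :
    haarPair p (some w) ν = (p (w ++ [0]))⁻¹ * ν (w ++ [0]) - (p (w ++ [1]))⁻¹ * ν (w ++ [1]) :=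
  rfl

theorem haarMass_some (p : List (Fin 2) → ℝ) (u w : List (Fin 2)) :
    haarMass p (some u) w =
      (p (u ++ [0]))⁻¹ * (if u ++ [0] <+: w then p w else 0) -
        (p (u ++ [1]))⁻¹ * (if u ++ [1] <+: w then p w else 0) := rfl

theorem haarSq_pos {p : List (Fin 2) → ℝ} (hp : ∀ w, 0 < p w) (b : Option (List (Fin 2))) :
    0 < haarSq p b := by
  cases b with
  | none => exact hp _
  | some w => exact add_pos (inv_pos.2 (hp _)) (inv_pos.2 (hp _))

theorem append_singleton_prefix_append_singleton {u w : List (Fin 2)} {i j : Fin 2} :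
    u ++ [i] <+: w ++ [j] ↔ u ++ [i] <+: w ∨ (u = w ∧ i = j) := by
  rw [List.prefix_concat_iff, or_comm]
  simp

theorem not_append_singleton_prefix (w : List (Fin 2)) (i : Fin 2) : ¬ w ++ [i] <+: w := by
  intro h; simpa using h.length_le

theorem haarMass_some_nil (p : List (Fin 2) → ℝ) (u : List (Fin 2)) :
    haarMass p (some u) [] = 0 := by
  simp [haarMass_some]

theorem haarMass_append_of_ne {p : List (Fin 2) → ℝ} (hp : ∀ w, 0 < p w)
    {b : Option (List (Fin 2))} {w : List (Fin 2)} (hb : b ≠ some w) (j : Fin 2) :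
    haarMass p b (w ++ [j]) = haarMass p b w * (p (w ++ [j]) / p w) := by
  have hw := (hp w).ne'
  cases b with
  | none => simp only [haarMass]; field_simp
  | some u =>
    have hu : u ≠ w := fun h => hb (by rw [h])
    simp only [haarMass_some, append_singleton_prefix_append_singleton, hu, false_and, or_false]
    split_ifs <;> field_simp <;> ring

theorem haarMass_self {p : List (Fin 2) → ℝ} (w : List (Fin 2)) :
    haarMass p (some w) w = 0 := by
  simp [haarMass_some, not_append_singleton_prefix]

theorem haarMass_self_zero {p : List (Fin 2) → ℝ} (hp : ∀ w, 0 < p w) (w : List (Fin 2)) :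
    haarMass p (some w) (w ++ [0]) = 1 := by
  simp [haarMass_some, (hp _).ne']

theorem haarMass_self_one {p : List (Fin 2) → ℝ} (hp : ∀ w, 0 < p w) (w : List (Fin 2)) :
    haarMass p (some w) (w ++ [1]) = -1 := by
  simp [haarMass_some, (hp _).ne']

theorem isAdditive_haarMass {p : List (Fin 2) → ℝ} (hp : ∀ w, 0 < p w) (hadd : IsAdditive p)
    (b : Option (List (Fin 2))) : IsAdditive (haarMass p b) := by
  intro w
  by_cases hb : b = some w
  · subst hb
    rw [haarMass_self_zero hp, haarMass_self_one hp, haarMass_self]; norm_num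
  · rw [haarMass_append_of_ne hp hb, haarMass_append_of_ne hp hb, ← mul_add, ← add_div, hadd w,
      div_self (hp w).ne', mul_one]

/-- An additive mass function is recovered from its Haar coefficients; on each cylinder the series
is a finite sum. -/
theorem hasSum_haarMass {p : List (Fin 2) → ℝ} (hp : ∀ w, 0 < p w) (hadd : IsAdditive p)
    {ν : List (Fin 2) → ℝ} (hν : IsAdditive ν) (w : List (Fin 2)) :
    HasSum (fun b => haarPair p b ν / haarSq p b * haarMass p b w) (ν w) := by
  induction w using List.reverseRecOn with
  | nil =>
    refine (hasSum_single (none : Option (List (Fin 2))) ?_).of_eq (fun _ => rfl) ?_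
    · intro b hb
      cases b with
      | none => exact absurd rfl hb
      | some u => simp [haarMass_some_nil]
    · simp only [haarPair_none, haarSq, haarMass]
      field_simp [(hp []).ne']
  | append_singleton w j ih =>
    have h1 := ih.mul_right (p (w ++ [j]) / p w)
    have h2 := hasSum_ite_eq (some w : Option (List (Fin 2)))
      (haarPair p (some w) ν / haarSq p (some w) * haarMass p (some w) (w ++ [j]))
    refine (h1.add h2).of_eq (fun b => ?_) ?_
    · by_cases hb : b = some w
      · subst hb; simp [haarMass_self]
      · simp only [hb, if_false, add_zero, haarMass_append_of_ne hp hb, mul_assoc]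
    · have e0 := (hp (w ++ [0])).ne'
      have e1 := (hp (w ++ [1])).ne'
      have e2 := hadd w
      have e3 : p (w ++ [0]) + p (w ++ [1]) ≠ 0 := (add_pos (hp _) (hp _)).ne'
      have e4 := hν w
      have e5 : (p (w ++ [0]))⁻¹ + (p (w ++ [1]))⁻¹ =
        (p (w ++ [0]) + p (w ++ [1])) / (p (w ++ [0]) * p (w ++ [1])) := by field_simp; ring
      have hj : j = 0 ∨ j = 1 := by omega
      rcases hj with rfl | rfl
      · rw [haarMass_self_zero hp, haarPair_some, haarSq, ← e2, ← e4, e5]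
        field_simp; ring
      · rw [haarMass_self_one hp, haarPair_some, haarSq, ← e2, ← e4, e5]
        field_simp; ring

/-- The integral of a Haar function composed with `F^k` against an additive mass function, computed
from the Haar expansion of the latter. -/
theorem hasSum_haarPair_push_pow {p : List (Fin 2) → ℝ} (hp : ∀ w, 0 < p w) (hadd : IsAdditive p)
    {ν : List (Fin 2) → ℝ} (hν : IsAdditive ν) (k : ℕ) (a : Option (List (Fin 2))) :
    HasSum (fun b => haarPair p b ν / haarSq p b * haarPair p a ((push ^ k) (haarMass p b)))
      (haarPair p a ((push ^ k) ν)) := by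
  have key : ∀ w, HasSum (fun b => haarPair p b ν / haarSq p b * (push ^ k) (haarMass p b) w)
      ((push ^ k) ν w) := by
    intro w
    rw [push_pow_apply]
    have := hasSum_sum (s := words k) fun v _ => hasSum_haarMass hp hadd hν (v ++ w)
    refine this.of_eq (fun b => ?_) rfl
    rw [push_pow_apply, Finset.mul_sum]
  cases a with
  | none => exact key []
  | some w =>
    simp only [haarPair_some p _ w]
    refine (((key (w ++ [0])).mul_left (p (w ++ [0]))⁻¹).sub
      ((key (w ++ [1])).mul_left (p (w ++ [1]))⁻¹)).of_eq (fun b => ?_) rfl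
    ring

/-- Composition with `F^(k+1)` is composition with `F^k` followed by composition with `F`. -/
theorem hasSum_kernel_mul {p : List (Fin 2) → ℝ} (hp : ∀ w, 0 < p w) (hadd : IsAdditive p)
    (k : ℕ) (c a : Option (List (Fin 2))) :
    HasSum (fun b => kernel p 1 c b * kernel p k b a) (kernel p (k + 1) c a) := by
  have key := hasSum_haarPair_push_pow hp hadd (isAdditive_haarMass hp hadd c).push k a
  rw [← push_pow_succ] at key
  refine (key.div_const (haarSq p c)).of_eq (fun b => ?_) rfl
  simp only [kernel, pow_one]
  ring

/-- The functional given by a `push`-invariant mass function is invariant under composition. -/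
theorem hasSum_kernel_mul_haarPair {p μ : List (Fin 2) → ℝ} (hp : ∀ w, 0 < p w)
    (hadd : IsAdditive p) (hμ : IsAdditive μ) (hinv : push μ = μ) (k : ℕ)
    (a : Option (List (Fin 2))) :
    HasSum (fun b => kernel p k b a * haarPair p b μ) (haarPair p a μ) := by
  refine (hasSum_haarPair_push_pow hp hadd hμ k a).of_eq (fun b => ?_) ?_
  · rw [kernel]; ring
  · rw [push_pow_eq_self hinv]

/-- Orthogonality of the Haar system. -/
theorem kernel_zero {p : List (Fin 2) → ℝ} (hp : ∀ w, 0 < p w) (b a : Option (List (Fin 2))) :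
    kernel p 0 b a = if b = a then 1 else 0 := by
  rw [kernel, pow_zero, Module.End.one_apply]
  cases a with
  | none =>
    rw [haarPair_none]
    cases b with
    | none => simp [haarMass, haarSq, (hp []).ne']
    | some u => simp [haarMass_some_nil]
  | some w =>
    rw [haarPair_some]
    split_ifs with hb
    · rw [hb, haarMass_self_zero hp, haarMass_self_one hp,
        div_eq_one_iff_eq (haarSq_pos hp (some w)).ne', haarSq]
      ring
    · rw [haarMass_append_of_ne hp hb, haarMass_append_of_ne hp hb]
      field_simp [(hp (w ++ [0])).ne', (hp (w ++ [1])).ne', (hp w).ne']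
      ring

/-! ### Gibbs weights and regular mass functions -/

/-- If the distortion of one branch of `F` on `cyl w` is controlled by `t w`, and `t` decreases
geometrically along preimages, then the distortion of all inverse branches of all iterates is
controlled by a multiple of `t w`. -/
theorem distortion_iterate {p t : List (Fin 2) → ℝ} (hp : ∀ w, 0 < p w) {r : ℝ} (hr : 0 ≤ r)
    (hr1 : r < 1) (ht : ∀ w, 0 ≤ t w) (htr : ∀ i w, t (i :: w) ≤ r * t w)
    (h : ∀ i w u v, p (i :: (w ++ u)) * p (w ++ v) ≤
      Real.exp (t w) * (p (i :: (w ++ v)) * p (w ++ u))) (x w u v : List (Fin 2)) :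
    p (x ++ (w ++ u)) * p (w ++ v) ≤
      Real.exp (t w / (1 - r)) * (p (x ++ (w ++ v)) * p (w ++ u)) := by
  have htx : ∀ x : List (Fin 2), t (x ++ w) ≤ r ^ x.length * t w := by
    intro x
    induction x with
    | nil => simp
    | cons i x ih =>
      refine (htr i _).trans ?_
      rw [List.length_cons, pow_succ', mul_assoc]
      exact mul_le_mul_of_nonneg_left ih hr
  have key : p (x ++ (w ++ u)) * p (w ++ v) ≤
      Real.exp (t w * ∑ j ∈ Finset.range x.length, r ^ j) * (p (x ++ (w ++ v)) * p (w ++ u)) := by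
    induction x with
    | nil => simp [mul_comm]
    | cons i x ih =>
      have h1 := h i (x ++ w) u v
      simp only [List.append_assoc] at h1
      have hpos : 0 < p (x ++ (w ++ u)) * p (x ++ (w ++ v)) := mul_pos (hp _) (hp _)
      have h2 := mul_le_mul h1 ih (mul_pos (hp _) (hp _)).le
        (mul_nonneg (Real.exp_pos _).le (mul_pos (hp _) (hp _)).le)
      have h3 : p (i :: (x ++ (w ++ u))) * p (w ++ v) ≤ (Real.exp (t (x ++ w)) *
          Real.exp (t w * ∑ j ∈ Finset.range x.length, r ^ j)) *
            (p (i :: (x ++ (w ++ v))) * p (w ++ u)) := by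
        refine le_of_mul_le_mul_right ?_ hpos
        linarith
      refine h3.trans (mul_le_mul_of_nonneg_right ?_ (mul_pos (hp _) (hp _)).le)
      rw [← Real.exp_add, List.length_cons, Finset.sum_range_succ]
      refine Real.exp_le_exp.2 ?_
      have := htx x
      linarith
  refine key.trans (mul_le_mul_of_nonneg_right (Real.exp_le_exp.2 ?_)
    (mul_pos (hp _) (hp _)).le)
  rw [div_eq_mul_inv]
  refine mul_le_mul_of_nonneg_left ?_ (ht w)
  rw [← tsum_geometric_of_lt_one hr hr1]
  exact (summable_geometric_of_lt_one hr hr1).sum_le_tsum _ fun j _ => pow_nonneg hr j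

/-- Positive additive weights of cylinders, contracted by the inverse branches of `F`, whose
distortion is controlled by the power `γ` of the weight. -/
structure IsGibbs (p : List (Fin 2) → ℝ) (θ B γ : ℝ) : Prop where
  pos : ∀ w, 0 < p w
  add : IsAdditive p
  theta_pos : 0 < θ
  theta_lt : θ < 1
  B_nonneg : 0 ≤ B
  gamma_pos : 0 < γ
  contr : ∀ i w, p (i :: w) ≤ θ * p w
  distortion : ∀ i w u v, p (i :: (w ++ u)) * p (w ++ v) ≤
    Real.exp (B * p w ^ γ) * (p (i :: (w ++ v)) * p (w ++ u))

/-- The mass functions of probability measures whose density with respect to the weights `p` has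
logarithmic oscillation at most `A * p w ^ γ` on the cylinder of `w`. -/
structure IsNormal (p : List (Fin 2) → ℝ) (γ A : ℝ) (ν : List (Fin 2) → ℝ) : Prop where
  nonneg : ∀ w, 0 ≤ ν w
  add : IsAdditive ν
  total : ν [] = 1
  regular : ∀ w u v, ν (w ++ u) * p (w ++ v) ≤ Real.exp (A * p w ^ γ) * (ν (w ++ v) * p (w ++ u))

section

variable {p : List (Fin 2) → ℝ} {θ B γ : ℝ}

namespace IsGibbs

theorem append_le (h : IsGibbs p θ B γ) (v w : List (Fin 2)) :
    p (v ++ w) ≤ θ ^ v.length * p w := by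
  induction v with
  | nil => simp
  | cons i v ih =>
    refine (h.contr i _).trans ?_
    rw [List.length_cons, pow_succ', mul_assoc]
    exact mul_le_mul_of_nonneg_left ih h.theta_pos.le

theorem append_le_left (h : IsGibbs p θ B γ) (w u : List (Fin 2)) : p (w ++ u) ≤ p w := by
  induction u using List.reverseRecOn with
  | nil => simp
  | append_singleton u j ih =>
    refine le_trans ?_ ih
    have h1 := h.add (w ++ u)
    have h2 := h.pos (w ++ u ++ [0])
    have h3 := h.pos (w ++ u ++ [1])
    rw [← List.append_assoc]
    have hj : j = 0 ∨ j = 1 := by omega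
    rcases hj with rfl | rfl <;> linarith

theorem le_nil (h : IsGibbs p θ B γ) (w : List (Fin 2)) : p w ≤ p [] := h.append_le_left [] w

theorem rpow_theta_pos (h : IsGibbs p θ B γ) (s : ℝ) : 0 < θ ^ s :=
  Real.rpow_pos_of_pos h.theta_pos s

theorem rpow_theta_lt (h : IsGibbs p θ B γ) {s : ℝ} (hs : 0 < s) : θ ^ s < 1 :=
  Real.rpow_lt_one h.theta_pos.le h.theta_lt hs

theorem rpow_append_le (h : IsGibbs p θ B γ) {s : ℝ} (hs : 0 < s) (v w : List (Fin 2)) :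
    p (v ++ w) ^ s ≤ (θ ^ s) ^ v.length * p w ^ s := by
  have h1 := Real.rpow_le_rpow (h.pos _).le (h.append_le v w) hs.le
  rwa [Real.mul_rpow (pow_nonneg h.theta_pos.le _) (h.pos _).le, ← Real.rpow_natCast,
    ← Real.rpow_mul h.theta_pos.le, mul_comm (v.length : ℝ), Real.rpow_mul h.theta_pos.le,
    Real.rpow_natCast] at h1

theorem rpow_le_nil (h : IsGibbs p θ B γ) {s : ℝ} (hs : 0 ≤ s) (w : List (Fin 2)) :
    p w ^ s ≤ p [] ^ s :=
  Real.rpow_le_rpow (h.pos _).le (h.le_nil w) hs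

theorem rpow_gamma_le (h : IsGibbs p θ B γ) {s : ℝ} (hsγ : s < γ) (w : List (Fin 2)) :
    p w ^ γ ≤ p [] ^ (γ - s) * p w ^ s := by
  have h1 : p w ^ γ = p w ^ (γ - s) * p w ^ s := by
    rw [← Real.rpow_add (h.pos w)]; ring_nf
  rw [h1]
  exact mul_le_mul_of_nonneg_right (h.rpow_le_nil (sub_nonneg.2 hsγ.le) w)
    (Real.rpow_nonneg (h.pos w).le _)

/-- Bounded distortion for all inverse branches of all iterates. -/
theorem distortion_append (h : IsGibbs p θ B γ) (x w u v : List (Fin 2)) :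
    p (x ++ (w ++ u)) * p (w ++ v) ≤
      Real.exp (B / (1 - θ ^ γ) * p w ^ γ) * (p (x ++ (w ++ v)) * p (w ++ u)) := by
  have h1 := distortion_iterate h.pos (h.rpow_theta_pos γ).le (h.rpow_theta_lt h.gamma_pos)
    (t := fun w => B * p w ^ γ)
    (fun w => mul_nonneg h.B_nonneg (Real.rpow_nonneg (h.pos w).le _)) (fun i w => ?_)
    h.distortion x w u v
  · rwa [mul_div_right_comm] at h1
  · have := h.rpow_append_le h.gamma_pos [i] w
    simp only [List.singleton_append, List.length_singleton, pow_one] at this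
    have := mul_le_mul_of_nonneg_left this h.B_nonneg
    linarith

end IsGibbs

/-- Two children of a cylinder have comparable weights. -/
theorem exists_child_ge {p : List (Fin 2) → ℝ} (hp : ∀ w, 0 < p w) {D : ℝ}
    (h : ∀ x u v, p (x ++ u) * p v ≤ D * (p (x ++ v) * p u)) :
    ∃ κ : ℝ, 0 < κ ∧ ∀ w j, κ * p w ≤ p (w ++ [j]) := by
  have hD : 0 < D := by
    have h1 := h [] [] []
    have h2 := mul_pos (hp []) (hp [])
    simp only [List.append_nil] at h1
    by_contra hD
    nlinarith
  have key : ∀ j : Fin 2, 0 < p [j] / (D * p []) ∧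
      ∀ w, p [j] / (D * p []) * p w ≤ p (w ++ [j]) := by
    intro j
    refine ⟨div_pos (hp _) (mul_pos hD (hp _)), fun w => ?_⟩
    have h1 := h w [] [j]
    rw [div_mul_eq_mul_div, div_le_iff₀ (mul_pos hD (hp _))]
    simp only [List.append_nil] at h1
    linarith
  refine ⟨min (p [0] / (D * p [])) (p [1] / (D * p [])), lt_min (key 0).1 (key 1).1, fun w j => ?_⟩
  have hj : j = 0 ∨ j = 1 := by omega
  rcases hj with rfl | rfl
  · exact (mul_le_mul_of_nonneg_right (min_le_left _ _) (hp w).le).trans ((key 0).2 w)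
  · exact (mul_le_mul_of_nonneg_right (min_le_right _ _) (hp w).le).trans ((key 1).2 w)

theorem IsGibbs.exists_child_ge (h : IsGibbs p θ B γ) :
    ∃ κ : ℝ, 0 < κ ∧ ∀ w j, κ * p w ≤ p (w ++ [j]) :=
  Livsic.exists_child_ge h.pos fun x u v => by simpa using h.distortion_append x [] u v

theorem IsNormal.le {A : ℝ} {ν : List (Fin 2) → ℝ} (h : IsGibbs p θ B γ) (hν : IsNormal p γ A ν)
    (w : List (Fin 2)) : ν w ≤ Real.exp (A * p [] ^ γ) / p [] * p w := by
  have := hν.regular [] w []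
  simp only [List.nil_append, hν.total, one_mul] at this
  rwa [div_mul_eq_mul_div, le_div_iff₀ (h.pos [])]

theorem IsNormal.ge {A : ℝ} {ν : List (Fin 2) → ℝ} (hν : IsNormal p γ A ν)
    (w : List (Fin 2)) : p w ≤ Real.exp (A * p [] ^ γ) * (ν w * p []) := by
  have := hν.regular [] [] w
  simpa only [List.nil_append, hν.total, one_mul] using this

/-- The push-forward contracts the oscillation of the log-density, up to the distortion of one step
of `F`. -/
theorem IsNormal.push {A : ℝ} {ν : List (Fin 2) → ℝ} (h : IsGibbs p θ B γ) (hA : 0 ≤ A)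
    (hν : IsNormal p γ A ν) : IsNormal p γ (θ ^ γ * A + B) (push ν) where
  nonneg w := add_nonneg (hν.nonneg _) (hν.nonneg _)
  add := hν.add.push
  total := by rw [← hν.total]; exact hν.add []
  regular w u v := by
    have key : ∀ i : Fin 2, ν (i :: (w ++ u)) * p (w ++ v) ≤
        Real.exp ((θ ^ γ * A + B) * p w ^ γ) * (ν (i :: (w ++ v)) * p (w ++ u)) := by
      intro i
      have h1 := hν.regular (i :: w) u v
      have h2 := h.distortion i w u v
      simp only [List.cons_append] at h1
      have h3 : p (i :: w) ^ γ ≤ θ ^ γ * p w ^ γ := by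
        simpa using h.rpow_append_le h.gamma_pos [i] w
      have h4 : ν (i :: (w ++ u)) * p (i :: (w ++ v)) ≤
          Real.exp (θ ^ γ * A * p w ^ γ) * (ν (i :: (w ++ v)) * p (i :: (w ++ u))) := by
        refine h1.trans (mul_le_mul_of_nonneg_right (Real.exp_le_exp.2 ?_)
          (mul_nonneg (hν.nonneg _) (h.pos _).le))
        have := mul_le_mul_of_nonneg_left h3 hA
        linarith
      refine le_of_mul_le_mul_right ?_ (h.pos (i :: (w ++ v)))
      have h5 := mul_le_mul_of_nonneg_right h4 (h.pos (w ++ v)).le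
      have h6 := mul_le_mul_of_nonneg_left h2
        (mul_nonneg (Real.exp_pos (θ ^ γ * A * p w ^ γ)).le (hν.nonneg (i :: (w ++ v))))
      rw [add_mul, Real.exp_add]
      linarith
    have h0 := key 0
    have h1 := key 1
    simp only [push_apply]
    linarith

/-- The constant of the cone that is mapped into itself by `push` even after a small multiple of the
reference measure is removed. -/
noncomputable def coneConst (θ B γ : ℝ) : ℝ := (θ ^ γ + B) / (1 - θ ^ γ)

theorem coneConst_pos (h : IsGibbs p θ B γ) : 0 < coneConst θ B γ :=
  div_pos (add_pos_of_pos_of_nonneg (h.rpow_theta_pos γ) h.B_nonneg)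
    (sub_pos.2 (h.rpow_theta_lt h.gamma_pos))

theorem coneConst_eq (h : IsGibbs p θ B γ) :
    θ ^ γ * (coneConst θ B γ + 1) + B = coneConst θ B γ := by
  have : 1 - θ ^ γ ≠ 0 := (sub_pos.2 (h.rpow_theta_lt h.gamma_pos)).ne'
  rw [coneConst]
  field_simp
  ring

theorem IsNormal.mono {A A' : ℝ} (hAA : A ≤ A') {ν : List (Fin 2) → ℝ} (h : IsGibbs p θ B γ)
    (hν : IsNormal p γ A ν) : IsNormal p γ A' ν where
  nonneg := hν.nonneg
  add := hν.add
  total := hν.total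
  regular w u v := (hν.regular w u v).trans (mul_le_mul_of_nonneg_right
    (Real.exp_le_exp.2 (mul_le_mul_of_nonneg_right hAA (Real.rpow_nonneg (h.pos w).le _)))
    (mul_nonneg (hν.nonneg _) (h.pos _).le))

theorem IsNormal.push_self {ν : List (Fin 2) → ℝ} (h : IsGibbs p θ B γ)
    (hν : IsNormal p γ (coneConst θ B γ) ν) : IsNormal p γ (coneConst θ B γ) (Livsic.push ν) := by
  refine IsNormal.mono ?_ h (hν.push h (coneConst_pos h).le)
  have h1 := coneConst_eq h
  have h2 := h.rpow_theta_pos γ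
  linarith

theorem IsNormal.push_pow {ν : List (Fin 2) → ℝ} (h : IsGibbs p θ B γ)
    (hν : IsNormal p γ (coneConst θ B γ) ν) (n : ℕ) :
    IsNormal p γ (coneConst θ B γ) ((Livsic.push ^ n) ν) := by
  induction n with
  | zero => simpa using hν
  | succ n ih => rw [push_pow_succ']; exact ih.push_self h

/-- The image under `F^|x|` of the normalized restriction of the reference measure to `cyl x`. -/
theorem isNormal_branch (h : IsGibbs p θ B γ) (x : List (Fin 2)) :
    IsNormal p γ (coneConst θ B γ) (fun w => p (x ++ w) / p x) := by
  refine IsNormal.mono (A := B / (1 - θ ^ γ)) ?_ h ⟨fun w => ?_, fun w => ?_, ?_, fun w u v => ?_⟩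
  · have h1 := sub_pos.2 (h.rpow_theta_lt h.gamma_pos)
    rw [coneConst]
    gcongr
    linarith [h.rpow_theta_pos γ]
  · exact (div_pos (h.pos _) (h.pos _)).le
  · have := h.add (x ++ w)
    simp only [List.append_assoc] at this
    rw [← this, add_div]
  · simp [(h.pos x).ne']
  · have := h.distortion_append x w u v
    refine le_trans (le_of_eq ?_) ((div_le_div_of_nonneg_right this (h.pos x).le).trans
      (le_of_eq ?_)) <;> ring

/-- The proportion of the reference measure that can be removed from a regular measure. -/
noncomputable def gap (p : List (Fin 2) → ℝ) (θ B γ : ℝ) : ℝ :=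
  Real.exp (-((coneConst θ B γ + 1) * p [] ^ γ) - coneConst θ B γ * p [] ^ γ) /
    (coneConst θ B γ + 1)

theorem gap_pos (h : IsGibbs p θ B γ) : 0 < gap p θ B γ :=
  div_pos (Real.exp_pos _) (by linarith [coneConst_pos h])

theorem gap_lt_one (h : IsGibbs p θ B γ) : gap p θ B γ < 1 := by
  have h1 := coneConst_pos h
  have h2 := Real.rpow_nonneg (h.pos []).le γ
  rw [gap, div_lt_one (by linarith)]
  refine lt_of_le_of_lt (Real.exp_le_one_iff.2 ?_) (by linarith)
  nlinarith [mul_nonneg h1.le h2]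

/-- After a small proportion of the reference measure is removed, a regular probability measure is
still regular, with a slightly larger constant. -/
theorem isNormal_remove (h : IsGibbs p θ B γ) {ν : List (Fin 2) → ℝ}
    (hν : IsNormal p γ (coneConst θ B γ) ν) :
    IsNormal p γ (coneConst θ B γ + 1)
      ((1 - gap p θ B γ)⁻¹ • (ν - (gap p θ B γ / p []) • p)) := by
  set A := coneConst θ B γ with hA
  set ε := gap p θ B γ with hε
  have hA0 : 0 < A := coneConst_pos h
  have hε0 : 0 < ε := gap_pos h
  have hε1 : 0 < 1 - ε := sub_pos.2 (gap_lt_one h)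
  have hP := h.pos []
  set t₀ := p [] ^ γ with ht0
  have ht00 : 0 ≤ t₀ := Real.rpow_nonneg hP.le _
  have hεeq : ε * (A + 1) * Real.exp ((A + 1) * t₀) = Real.exp (-(A * t₀)) := by
    rw [hε, gap, ← hA, ← ht0, div_mul_cancel₀ _ (by linarith), ← Real.exp_add]
    ring_nf
  -- `ν` dominates the multiple of the reference measure with the constant of the cone
  have hlow : ∀ w, Real.exp (-(A * t₀)) * (p w / p []) ≤ ν w := by
    intro w
    have := hν.ge w
    rw [Real.exp_neg, ← div_eq_inv_mul, div_div, div_le_iff₀ (mul_pos hP (Real.exp_pos _))]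
    linarith
  -- the elementary inequality behind the choice of `ε`
  have helem : ∀ t, 0 ≤ t → t ≤ t₀ →
      (Real.exp ((A + 1) * t) - 1) * ε ≤
        (Real.exp ((A + 1) * t) - Real.exp (A * t)) * Real.exp (-(A * t₀)) := by
    intro t ht htt
    have e1 : Real.exp ((A + 1) * t) - 1 ≤ (A + 1) * t * Real.exp ((A + 1) * t₀) := by
      have h1 := Real.add_one_le_exp (-((A + 1) * t))
      have h2 : Real.exp ((A + 1) * t) * Real.exp (-((A + 1) * t)) = 1 := by
        rw [← Real.exp_add]; simp
      have h3 : Real.exp ((A + 1) * t) ≤ Real.exp ((A + 1) * t₀) :=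
        Real.exp_le_exp.2 (by gcongr)
      have h4 := mul_le_mul_of_nonneg_left h1 (Real.exp_pos ((A + 1) * t)).le
      have h5 := mul_le_mul_of_nonneg_left h3 (by positivity : 0 ≤ (A + 1) * t)
      nlinarith
    have e2 : t ≤ Real.exp ((A + 1) * t) - Real.exp (A * t) := by
      have h1 : Real.exp ((A + 1) * t) = Real.exp (A * t) * Real.exp t := by
        rw [← Real.exp_add]; ring_nf
      have h2 := Real.add_one_le_exp t
      have h3 := Real.one_le_exp (by positivity : 0 ≤ A * t)
      rw [h1]
      nlinarith
    calc (Real.exp ((A + 1) * t) - 1) * ε ≤ (A + 1) * t * Real.exp ((A + 1) * t₀) * ε :=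
          mul_le_mul_of_nonneg_right e1 hε0.le
      _ = t * Real.exp (-(A * t₀)) := by rw [← hεeq]; ring
      _ ≤ _ := mul_le_mul_of_nonneg_right e2 (Real.exp_pos _).le
  have hεle : ε ≤ Real.exp (-(A * t₀)) := by
    rw [← hεeq]
    have := Real.one_le_exp (by positivity : 0 ≤ (A + 1) * t₀)
    have h2 : 1 ≤ (A + 1) * Real.exp ((A + 1) * t₀) := by nlinarith
    nlinarith
  constructor
  · intro w
    refine mul_nonneg (inv_nonneg.2 hε1.le) (sub_nonneg.2 (le_trans ?_ (hlow w)))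
    change ε / p [] * p w ≤ _
    have h1 : 0 < p w / p [] := div_pos (h.pos w) hP
    calc ε / p [] * p w = ε * (p w / p []) := by ring
      _ ≤ _ := mul_le_mul_of_nonneg_right hεle h1.le
  · intro w
    have h1 := hν.add w
    have h2 := h.add w
    simp only [Pi.smul_apply, Pi.sub_apply, smul_eq_mul]
    rw [← h1, ← h2]; ring
  · simp only [Pi.smul_apply, Pi.sub_apply, smul_eq_mul, hν.total]
    rw [div_mul_cancel₀ _ hP.ne', inv_mul_cancel₀ hε1.ne']
  · intro w u v
    simp only [Pi.smul_apply, Pi.sub_apply, smul_eq_mul]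
    have h1 := hν.regular w u v
    have h2 := helem (p w ^ γ) (Real.rpow_nonneg (h.pos w).le _) (h.rpow_le_nil h.gamma_pos.le w)
    have h3 := hlow (w ++ v)
    have hu := h.pos (w ++ u)
    have hv := h.pos (w ++ v)
    have hexp : 0 ≤ Real.exp ((A + 1) * p w ^ γ) - Real.exp (A * p w ^ γ) :=
      sub_nonneg.2 (Real.exp_le_exp.2 (by nlinarith [Real.rpow_nonneg (h.pos w).le γ]))
    have h4 := mul_le_mul_of_nonneg_right h2 (div_pos hv hP).le
    have h5 := mul_le_mul_of_nonneg_left h3 hexp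
    have h6 : (Real.exp ((A + 1) * p w ^ γ) - 1) * (ε / p [] * p (w ++ v)) ≤
        (Real.exp ((A + 1) * p w ^ γ) - Real.exp (A * p w ^ γ)) * ν (w ++ v) := by
      refine le_trans (le_of_eq ?_) (h4.trans (le_trans (le_of_eq ?_) h5)) <;> ring
    have h7 := mul_le_mul_of_nonneg_right h6 hu.le
    have h8 : (ν (w ++ u) - ε / p [] * p (w ++ u)) * p (w ++ v) ≤
        Real.exp ((A + 1) * p w ^ γ) * ((ν (w ++ v) - ε / p [] * p (w ++ v)) * p (w ++ u)) := by
      linarith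
    have h9 := mul_le_mul_of_nonneg_left h8 (inv_nonneg.2 hε1.le)
    linarith

/-- Exponential loss of memory: two regular probability measures share, after each application of
`push`, a further proportion `gap` of their remaining mass. -/
theorem exists_push_pow_sub_eq (h : IsGibbs p θ B γ) (n : ℕ) {ν ν' : List (Fin 2) → ℝ}
    (hν : IsNormal p γ (coneConst θ B γ) ν) (hν' : IsNormal p γ (coneConst θ B γ) ν') :
    ∃ η η', IsNormal p γ (coneConst θ B γ) η ∧ IsNormal p γ (coneConst θ B γ) η' ∧
      (push ^ n) ν - (push ^ n) ν' = (1 - gap p θ B γ) ^ n • (η - η') := by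
  induction n with
  | zero => exact ⟨ν, ν', hν, hν', by simp⟩
  | succ n ih =>
    obtain ⟨η, η', hη, hη', he⟩ := ih
    have hε1 : 1 - gap p θ B γ ≠ 0 := (sub_pos.2 (gap_lt_one h)).ne'
    have hA := coneConst_pos h
    have a1 := (isNormal_remove h hη).push h (by linarith)
    have a2 := (isNormal_remove h hη').push h (by linarith)
    rw [coneConst_eq h] at a1 a2
    refine ⟨_, _, a1, a2, ?_⟩
    rw [push_pow_succ', push_pow_succ', ← map_sub, he, ← map_sub, ← smul_sub,
      sub_sub_sub_cancel_right, map_smul, map_smul, smul_smul, pow_succ, mul_assoc,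
      mul_inv_cancel₀ hε1, mul_one]

/-- The Haar coefficients of a regular probability measure decay like the power `γ` of the size of
the cylinder. -/
theorem exists_abs_haarPair_le (h : IsGibbs p θ B γ) (A : ℝ) (hA : 0 ≤ A) :
    ∃ C : ℝ, 0 ≤ C ∧ ∀ ν, (∀ w, 0 ≤ ν w) →
      (∀ w u v, ν (w ++ u) * p (w ++ v) ≤ Real.exp (A * p w ^ γ) * (ν (w ++ v) * p (w ++ u))) →
      ∀ w, |haarPair p (some w) ν| ≤ C * (ν w / p w) * p w ^ γ := by
  have hP := h.pos []
  refine ⟨A * Real.exp (2 * A * p [] ^ γ), by positivity, fun ν hν0 hν w => ?_⟩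
  have hw := h.pos w
  have ht : 0 ≤ p w ^ γ := Real.rpow_nonneg hw.le _
  have htt : p w ^ γ ≤ p [] ^ γ := h.rpow_le_nil h.gamma_pos.le w
  have e1 : Real.exp (A * p w ^ γ) - 1 ≤ A * p w ^ γ * Real.exp (A * p w ^ γ) := by
    have h1 := Real.add_one_le_exp (-(A * p w ^ γ))
    have h2 : Real.exp (A * p w ^ γ) * Real.exp (-(A * p w ^ γ)) = 1 := by
      rw [← Real.exp_add]; simp
    have h4 := mul_le_mul_of_nonneg_left h1 (Real.exp_pos (A * p w ^ γ)).le
    nlinarith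
  have e2 : Real.exp (A * p w ^ γ) * Real.exp (A * p w ^ γ) ≤ Real.exp (2 * A * p [] ^ γ) := by
    rw [← Real.exp_add]
    refine Real.exp_le_exp.2 ?_
    nlinarith [mul_le_mul_of_nonneg_left htt hA]
  -- the density on each child is comparable with the density on the other child
  have d : ∀ i j : Fin 2, (p (w ++ [i]))⁻¹ * ν (w ++ [i]) ≤
      Real.exp (A * p w ^ γ) * ((p (w ++ [j]))⁻¹ * ν (w ++ [j])) := by
    intro i j
    have h1 := hν w [i] [j]
    have hi := h.pos (w ++ [i])
    have hj := h.pos (w ++ [j])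
    rw [inv_mul_eq_div, inv_mul_eq_div, mul_div_assoc', div_le_div_iff₀ hi hj]
    linarith
  have d0 : ∀ j : Fin 2, (p (w ++ [j]))⁻¹ * ν (w ++ [j]) ≤
      Real.exp (A * p w ^ γ) * (ν w / p w) := by
    intro j
    have h1 := hν w [j] []
    have hj := h.pos (w ++ [j])
    rw [inv_mul_eq_div, mul_div_assoc', div_le_div_iff₀ hj hw]
    simp only [List.append_nil] at h1
    linarith
  have hd : 0 ≤ ν w / p w := div_nonneg (hν0 w) hw.le
  have key : ∀ i j : Fin 2, (p (w ++ [i]))⁻¹ * ν (w ++ [i]) - (p (w ++ [j]))⁻¹ * ν (w ++ [j]) ≤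
      A * Real.exp (2 * A * p [] ^ γ) * (ν w / p w) * p w ^ γ := by
    intro i j
    have h0 : 0 ≤ (p (w ++ [j]))⁻¹ * ν (w ++ [j]) :=
      mul_nonneg (inv_nonneg.2 (h.pos _).le) (hν0 _)
    calc _ ≤ (Real.exp (A * p w ^ γ) - 1) * ((p (w ++ [j]))⁻¹ * ν (w ++ [j])) := by
          linarith [d i j]
      _ ≤ (A * p w ^ γ * Real.exp (A * p w ^ γ)) * (Real.exp (A * p w ^ γ) * (ν w / p w)) :=
          mul_le_mul e1 (d0 j) h0 (by positivity)
      _ = (A * (ν w / p w) * p w ^ γ) * (Real.exp (A * p w ^ γ) * Real.exp (A * p w ^ γ)) := by ring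
      _ ≤ (A * (ν w / p w) * p w ^ γ) * Real.exp (2 * A * p [] ^ γ) :=
          mul_le_mul_of_nonneg_left e2 (by positivity)
      _ = _ := by ring
  rw [haarPair_some, abs_le]
  exact ⟨by linarith [key 1 0], key 0 1⟩

/-- A `push`-invariant regular probability mass function. -/
theorem exists_isNormal_push_eq (h : IsGibbs p θ B γ) :
    ∃ μ, IsNormal p γ (coneConst θ B γ) μ ∧ push μ = μ := by
  set ν : List (Fin 2) → ℝ := fun w => p ([] ++ w) / p [] with hν
  have hN : IsNormal p γ (coneConst θ B γ) ν := isNormal_branch h []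
  set q := 1 - gap p θ B γ with hq
  have hq0 : 0 ≤ q := sub_nonneg.2 (gap_lt_one h).le
  have hq1 : q < 1 := by linarith [gap_pos h]
  have hcau : ∀ w, CauchySeq fun n => (push ^ n) ν w := by
    intro w
    set M := Real.exp (coneConst θ B γ * p [] ^ γ) / p [] * p w
    refine cauchySeq_of_le_geometric q M hq1 fun n => ?_
    obtain ⟨η, η', hη, hη', he⟩ := exists_push_pow_sub_eq h n hN (hN.push_self h)
    have he' := congrFun he w
    simp only [Pi.sub_apply, Pi.smul_apply, smul_eq_mul, ← push_pow_succ] at he'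
    rw [Real.dist_eq, he', abs_mul, abs_of_nonneg (pow_nonneg hq0 n), mul_comm]
    refine mul_le_mul_of_nonneg_right ?_ (pow_nonneg hq0 n)
    have := hη.le h w
    have := hη'.le h w
    have := hη.nonneg w
    have := hη'.nonneg w
    exact abs_le.2 ⟨by linarith, by linarith⟩
  choose μ hμ using fun w => cauchySeq_tendsto_of_complete (hcau w)
  have hNn := fun n => hN.push_pow h n
  refine ⟨μ, ⟨fun w => ?_, fun w => ?_, ?_, fun w u v => ?_⟩, ?_⟩
  · exact ge_of_tendsto' (hμ w) fun n => (hNn n).nonneg w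
  · exact tendsto_nhds_unique ((hμ _).add (hμ _))
      ((hμ w).congr fun n => ((hNn n).add w).symm)
  · exact tendsto_nhds_unique (hμ []) (by simp only [(hNn _).total]; exact tendsto_const_nhds)
  · exact le_of_tendsto_of_tendsto' ((hμ _).mul_const _) (((hμ _).mul_const _).const_mul _)
      fun n => (hNn n).regular w u v
  · funext w
    refine tendsto_nhds_unique ((hμ _).add (hμ _)) (((tendsto_add_atTop_iff_nat 1).2 (hμ w)).congr
      fun n => ?_)
    rw [push_pow_succ']; rfl

end

/-! ### Decay of the coefficients of iterated compositions -/

/-- The factor `|P|^s`, respectively `1`, attached to an index of the Haar system. -/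
noncomputable def wt (p : List (Fin 2) → ℝ) (s : ℝ) : Option (List (Fin 2)) → ℝ
  | none => 1
  | some w => p w ^ s

/-- The coefficients of `h ∘ F^n - ∫ h dμ`, for `h` the Haar function of index `a` and `μ` the
measure with mass function `μ`. -/
noncomputable def centered (p μ : List (Fin 2) → ℝ) (n : ℕ) (b a : Option (List (Fin 2))) : ℝ :=
  kernel p n b a - if b = none then haarPair p a μ else 0

section

variable {p μ : List (Fin 2) → ℝ} {θ B γ s : ℝ}

theorem wt_pos (hp : ∀ w, 0 < p w) (b : Option (List (Fin 2))) : 0 < wt p s b := by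
  cases b with
  | none => exact one_pos
  | some w => exact Real.rpow_pos_of_pos (hp w) s

theorem kernel_none_right (hp : ∀ w, 0 < p w) (hadd : IsAdditive p) (n : ℕ)
    (b : Option (List (Fin 2))) : kernel p n b none = if b = none then 1 else 0 := by
  rw [kernel, haarPair_none, (isAdditive_haarMass hp hadd b).push_pow_nil]
  cases b with
  | none => simp [haarMass, haarSq, (hp []).ne']
  | some u => simp [haarMass_some_nil]

theorem inv_haarSq_le (h : IsGibbs p θ B γ) (u : List (Fin 2)) : (haarSq p (some u))⁻¹ ≤ p u := by
  refine le_trans ?_ (h.append_le_left u [0])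
  have h0 := h.pos (u ++ [0])
  have h1 := h.pos (u ++ [1])
  rw [inv_le_comm₀ (haarSq_pos h.pos _) h0, haarSq]
  linarith [inv_pos.2 h1]

theorem push_pow_haarMass_of_lt (p : List (Fin 2) → ℝ) (u : List (Fin 2)) :
    (push ^ (u.length + 1)) (haarMass p (some u)) =
      (fun w => p (u ++ [0] ++ w) / p (u ++ [0])) - fun w => p (u ++ [1] ++ w) / p (u ++ [1]) := by
  have key : ∀ j : Fin 2, (push ^ (u.length + 1)) (trunc p (u ++ [j])) =
      fun w => p (u ++ [j] ++ w) := by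
    intro j
    have := push_pow_trunc p (u ++ [j]) []
    rw [List.length_append, List.length_singleton, List.append_nil] at this
    rw [this]
    funext w
    simp [trunc]
  rw [haarMass, map_sub, map_smul, map_smul, key, key]
  funext w
  simp only [Pi.sub_apply, Pi.smul_apply, smul_eq_mul]
  ring

theorem push_pow_haarMass_append (p : List (Fin 2) → ℝ) (v u : List (Fin 2)) :
    (push ^ v.length) (haarMass p (some (v ++ u))) =
      (p (v ++ (u ++ [0])))⁻¹ • trunc (fun w => p (v ++ w)) (u ++ [0]) -
        (p (v ++ (u ++ [1])))⁻¹ • trunc (fun w => p (v ++ w)) (u ++ [1]) := by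
  rw [haarMass, map_sub, map_smul, map_smul, List.append_assoc, List.append_assoc, push_pow_trunc,
    push_pow_trunc]

theorem haarPair_trunc (p p' : List (Fin 2) → ℝ) (u w : List (Fin 2)) (j : Fin 2) :
    haarPair p (some w) (trunc p' (u ++ [j])) =
      if u ++ [j] <+: w then haarPair p (some w) p' else
        if u = w then (if j = 0 then 1 else -1) * ((p (w ++ [j]))⁻¹ * p' (w ++ [j])) else 0 := by
  rw [haarPair_some, haarPair_some]
  simp only [trunc, append_singleton_prefix_append_singleton]
  by_cases h1 : u ++ [j] <+: w
  · simp [h1]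
  · by_cases h2 : u = w
    · subst h2
      have hj : j = 0 ∨ j = 1 := by omega
      rcases hj with rfl | rfl <;> simp [not_append_singleton_prefix]
    · simp [h1, h2]

/-- The coefficients on cylinders of length less than the number of iterations: both halves of such
a cylinder are mapped to regular probability measures, whose difference decays exponentially. -/
theorem exists_kernel_short_le (h : IsGibbs p θ B γ) :
    ∃ C : ℝ, 0 ≤ C ∧ ∀ (u w : List (Fin 2)) (n : ℕ),
      |kernel p (u.length + 1 + n) (some u) (some w)| ≤
        C * (1 - gap p θ B γ) ^ n * p w ^ γ * p u := by
  obtain ⟨C, hC, hbound⟩ := exists_abs_haarPair_le h _ (coneConst_pos h).le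
  set M := Real.exp (coneConst θ B γ * p [] ^ γ) / p [] with hM
  have hM0 : 0 ≤ M := div_nonneg (Real.exp_pos _).le (h.pos []).le
  have hq0 : 0 ≤ 1 - gap p θ B γ := sub_nonneg.2 (gap_lt_one h).le
  refine ⟨2 * (C * M), by positivity, fun u w n => ?_⟩
  obtain ⟨η, η', hη, hη', he⟩ := exists_push_pow_sub_eq h n (isNormal_branch h (u ++ [0]))
    (isNormal_branch h (u ++ [1]))
  have hb : ∀ η, IsNormal p γ (coneConst θ B γ) η →
      |haarPair p (some w) η| ≤ C * M * p w ^ γ := by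
    intro η hη
    refine (hbound η hη.nonneg hη.regular w).trans ?_
    refine mul_le_mul_of_nonneg_right ?_ (Real.rpow_nonneg (h.pos w).le _)
    exact mul_le_mul_of_nonneg_left ((div_le_iff₀ (h.pos w)).2 (hη.le h w)) hC
  rw [kernel, add_comm, pow_add, Module.End.mul_apply, push_pow_haarMass_of_lt, map_sub, he,
    map_smul, map_sub, smul_eq_mul, div_eq_mul_inv, abs_mul, abs_mul,
    abs_of_nonneg (pow_nonneg hq0 n),
    abs_of_pos (inv_pos.2 (haarSq_pos h.pos _))]
  have h1 : |haarPair p (some w) η - haarPair p (some w) η'| ≤ 2 * (C * M) * p w ^ γ :=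
    (abs_sub _ _).trans (by linarith [hb η hη, hb η' hη'])
  calc _ ≤ (1 - gap p θ B γ) ^ n * (2 * (C * M) * p w ^ γ) * p u :=
        mul_le_mul (mul_le_mul_of_nonneg_left h1 (pow_nonneg hq0 n)) (inv_haarSq_le h u)
          (inv_pos.2 (haarSq_pos h.pos _)).le
          (mul_nonneg (pow_nonneg hq0 n) ((abs_nonneg _).trans h1))
    _ = _ := by ring

/-- The coefficient of `1` converges exponentially fast to the integral against the invariant
measure. -/
theorem exists_centered_none_le (h : IsGibbs p θ B γ) (hμ : IsNormal p γ (coneConst θ B γ) μ)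
    (hinv : push μ = μ) :
    ∃ C : ℝ, 0 ≤ C ∧ ∀ (w : List (Fin 2)) (n : ℕ),
      |centered p μ n none (some w)| ≤ C * (1 - gap p θ B γ) ^ n * p w ^ γ := by
  obtain ⟨C, hC, hbound⟩ := exists_abs_haarPair_le h _ (coneConst_pos h).le
  set M := Real.exp (coneConst θ B γ * p [] ^ γ) / p [] with hM
  have hM0 : 0 ≤ M := div_nonneg (Real.exp_pos _).le (h.pos []).le
  have hq0 : 0 ≤ 1 - gap p θ B γ := sub_nonneg.2 (gap_lt_one h).le
  refine ⟨2 * (C * M), by positivity, fun w n => ?_⟩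
  obtain ⟨η, η', hη, hη', he⟩ := exists_push_pow_sub_eq h n (isNormal_branch h []) hμ
  have hb : ∀ η, IsNormal p γ (coneConst θ B γ) η →
      |haarPair p (some w) η| ≤ C * M * p w ^ γ := by
    intro η hη
    refine (hbound η hη.nonneg hη.regular w).trans ?_
    refine mul_le_mul_of_nonneg_right ?_ (Real.rpow_nonneg (h.pos w).le _)
    exact mul_le_mul_of_nonneg_left ((div_le_iff₀ (h.pos w)).2 (hη.le h w)) hC
  have hk : centered p μ n none (some w) =
      (1 - gap p θ B γ) ^ n * (haarPair p (some w) η - haarPair p (some w) η') := by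
    have e1 : (fun w => p ([] ++ w) / p []) = (p [])⁻¹ • p := by
      funext w; simp [div_eq_inv_mul]
    rw [e1, push_pow_eq_self hinv, map_smul] at he
    have e2 := congrArg (haarPair p (some w)) he
    rw [map_sub, map_smul, map_smul, map_sub, smul_eq_mul, smul_eq_mul] at e2
    rw [centered, kernel, if_pos rfl, haarSq, haarMass, ← e2, div_eq_inv_mul]
  rw [hk, abs_mul, abs_of_nonneg (pow_nonneg hq0 n)]
  have h1 : |haarPair p (some w) η - haarPair p (some w) η'| ≤ 2 * (C * M) * p w ^ γ :=
    (abs_sub _ _).trans (by linarith [hb η hη, hb η' hη'])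
  calc _ ≤ (1 - gap p θ B γ) ^ n * (2 * (C * M) * p w ^ γ) :=
        mul_le_mul_of_nonneg_left h1 (pow_nonneg hq0 n)
    _ = _ := by ring

/-- The coefficients on cylinders of length at least the number `n` of iterations, here
`n = v.length`. A Haar function composed with `F^n` has nonzero coefficients on them only
along the preimages of its support and of the ancestors of its support. The former are small
because of the expansion, the latter because the distortion is small. -/
theorem exists_kernel_long_le (h : IsGibbs p θ B γ) (hs : 0 < s) (hsγ : s < γ) :
    ∃ C : ℝ, 0 ≤ C ∧ ∀ (v u w : List (Fin 2)),
      |kernel p v.length (some (v ++ u)) (some w)| * p (v ++ u) ^ s ≤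
        C * (θ ^ s) ^ v.length * p w ^ s * (p (v ++ w) / p w) *
          ((if u = w then 1 else 0) + if u <+: w then (θ ^ s) ^ u.length else 0) := by
  obtain ⟨C, hC, hbound⟩ := exists_abs_haarPair_le h (B / (1 - θ ^ γ))
    (div_nonneg h.B_nonneg (sub_pos.2 (h.rpow_theta_lt h.gamma_pos)).le)
  obtain ⟨κ, hκ, hchild⟩ := h.exists_child_ge
  have hσ := (h.rpow_theta_pos s).le
  have hPγ := Real.rpow_nonneg (h.pos []).le (γ - s)
  have hPs := Real.rpow_nonneg (h.pos []).le s
  refine ⟨2 / κ + C * p [] ^ (γ - s) * p [] ^ s, by positivity, fun v u w => ?_⟩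
  have hsq := haarSq_pos h.pos (some (v ++ u))
  have hvw := h.pos (v ++ w)
  have hw := h.pos w
  have hws := Real.rpow_nonneg hw.le s
  have hvu := Real.rpow_nonneg (h.pos (v ++ u)).le s
  have hp0 := h.pos (v ++ (u ++ [0]))
  have hp1 := h.pos (v ++ (u ++ [1]))
  have hsqe : haarSq p (some (v ++ u)) = (p (v ++ (u ++ [0])))⁻¹ + (p (v ++ (u ++ [1])))⁻¹ := by
    rw [haarSq, List.append_assoc, List.append_assoc]
  have hker : kernel p v.length (some (v ++ u)) (some w) =
      ((p (v ++ (u ++ [0])))⁻¹ * haarPair p (some w) (trunc (fun w => p (v ++ w)) (u ++ [0])) -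
        (p (v ++ (u ++ [1])))⁻¹ * haarPair p (some w) (trunc (fun w => p (v ++ w)) (u ++ [1]))) /
        haarSq p (some (v ++ u)) := by
    rw [kernel, push_pow_haarMass_append, map_sub, map_smul, map_smul, smul_eq_mul, smul_eq_mul]
  by_cases huw : u = w
  · subst huw
    have e1 : kernel p v.length (some (v ++ u)) (some u) =
        haarSq p (some u) / haarSq p (some (v ++ u)) := by
      rw [hker, haarPair_trunc, haarPair_trunc, if_neg (not_append_singleton_prefix u 0),
        if_neg (not_append_singleton_prefix u 1), if_pos rfl, if_pos rfl, if_pos rfl,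
        if_neg one_ne_zero]
      congr 1
      rw [haarSq]
      field_simp
      ring
    have e2 : haarSq p (some u) ≤ 2 / κ / p u := by
      have k0 := hchild u 0
      have k1 := hchild u 1
      have a0 := inv_anti₀ (mul_pos hκ hw) k0
      have a1 := inv_anti₀ (mul_pos hκ hw) k1
      rw [haarSq]
      refine (add_le_add a0 a1).trans (le_of_eq ?_)
      field_simp
      ring
    have e3 := inv_haarSq_le h (v ++ u)
    have e4 := h.rpow_append_le hs v u
    rw [e1, abs_of_pos (div_pos (haarSq_pos h.pos _) hsq), if_pos rfl, if_pos List.prefix_rfl]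
    calc _ ≤ 2 / κ / p u * p (v ++ u) * ((θ ^ s) ^ v.length * p u ^ s) := by
          rw [div_eq_mul_inv]
          exact mul_le_mul (mul_le_mul e2 e3 (inv_pos.2 hsq).le (by positivity)) e4 hvu
            (by positivity)
      _ = 2 / κ * ((θ ^ s) ^ v.length * p u ^ s * (p (v ++ u) / p u) * (1 + 0)) := by ring
      _ ≤ (2 / κ + C * p [] ^ (γ - s) * p [] ^ s) * ((θ ^ s) ^ v.length * p u ^ s *
          (p (v ++ u) / p u) * (1 + (θ ^ s) ^ u.length)) := by
          gcongr
          · exact le_add_of_nonneg_right (by positivity)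
          · positivity
      _ = _ := by ring
  · have hD := hbound (fun x => p (v ++ x)) (fun x => (h.pos _).le)
      (fun x y z => h.distortion_append v x y z) w
    by_cases hpre : u <+: w
    · have e1 : |kernel p v.length (some (v ++ u)) (some w)| ≤
          C * (p (v ++ w) / p w) * p w ^ γ := by
        have ht : ∀ j : Fin 2, |haarPair p (some w) (trunc (fun w => p (v ++ w)) (u ++ [j]))| ≤
            C * (p (v ++ w) / p w) * p w ^ γ := by
          intro j
          rw [haarPair_trunc, if_neg huw]
          split_ifs
          · exact hD
          · rw [abs_zero]; exact (abs_nonneg _).trans hD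
        rw [hker, abs_div, abs_of_pos hsq, div_le_iff₀ hsq, hsqe]
        refine (abs_sub _ _).trans ?_
        rw [abs_mul, abs_mul, abs_of_pos (inv_pos.2 hp0), abs_of_pos (inv_pos.2 hp1)]
        have b0 := mul_le_mul_of_nonneg_left (ht 0) (inv_pos.2 hp0).le
        have b1 := mul_le_mul_of_nonneg_left (ht 1) (inv_pos.2 hp1).le
        linarith
      have e2 : p (v ++ u) ^ s ≤ (θ ^ s) ^ v.length * ((θ ^ s) ^ u.length * p [] ^ s) := by
        refine (h.rpow_append_le hs v u).trans (mul_le_mul_of_nonneg_left ?_ (pow_nonneg hσ _))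
        simpa using h.rpow_append_le hs u []
      have e3 := h.rpow_gamma_le hsγ w
      rw [if_neg huw, if_pos hpre]
      calc _ ≤ C * (p (v ++ w) / p w) * (p [] ^ (γ - s) * p w ^ s) *
            ((θ ^ s) ^ v.length * ((θ ^ s) ^ u.length * p [] ^ s)) := by
            refine mul_le_mul (e1.trans ?_) e2 hvu (by positivity)
            exact mul_le_mul_of_nonneg_left e3 (by positivity)
        _ = (C * p [] ^ (γ - s) * p [] ^ s) * ((θ ^ s) ^ v.length * p w ^ s * (p (v ++ w) / p w) *
            (0 + (θ ^ s) ^ u.length)) := by ring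
        _ ≤ (2 / κ + C * p [] ^ (γ - s) * p [] ^ s) * ((θ ^ s) ^ v.length * p w ^ s *
            (p (v ++ w) / p w) * (0 + (θ ^ s) ^ u.length)) := by
            gcongr
            exact le_add_of_nonneg_left (by positivity)
        _ = _ := by ring
    · have hz : ∀ j : Fin 2, haarPair p (some w) (trunc (fun w => p (v ++ w)) (u ++ [j])) = 0 := by
        intro j
        rw [haarPair_trunc, if_neg huw, if_neg]
        exact fun h' => hpre ((List.prefix_append u [j]).trans h')
      rw [hker, hz, hz, if_neg huw, if_neg hpre]
      simp

theorem exists_push_pow_le (h : IsGibbs p θ B γ) :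
    ∃ M : ℝ, 0 ≤ M ∧ ∀ n w, (push ^ n) p w ≤ M * p w := by
  refine ⟨p [] * (Real.exp (coneConst θ B γ * p [] ^ γ) / p []),
    mul_nonneg (h.pos []).le (div_nonneg (Real.exp_pos _).le (h.pos []).le), fun n w => ?_⟩
  have h1 := ((isNormal_branch h []).push_pow h n).le h w
  have e1 : (fun w => p ([] ++ w) / p []) = (p [])⁻¹ • p := by
    funext w; simp [div_eq_inv_mul]
  rw [e1, map_smul, Pi.smul_apply, smul_eq_mul, inv_mul_le_iff₀ (h.pos [])] at h1
  linarith

theorem sum_words_long_le {σ : ℝ} (hσ : 0 ≤ σ) (hσ1 : σ < 1) (w : List (Fin 2)) (K : ℕ) :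
    ∑ l ∈ Finset.range K, ∑ u ∈ words l,
      ((if u = w then 1 else 0) + if u <+: w then σ ^ u.length else 0) ≤ 1 + (1 - σ)⁻¹ := by
  have h1 : ∀ l, ∑ u ∈ words l,
      ((if u = w then (1 : ℝ) else 0) + if u <+: w then σ ^ u.length else 0) ≤
      (if l = w.length then 1 else 0) + σ ^ l := by
    intro l
    rw [Finset.sum_add_distrib]
    refine add_le_add ?_ ?_
    · rw [Finset.sum_ite_eq' (words l) w fun _ => (1 : ℝ)]
      simp only [mem_words, eq_comm]
      exact le_rfl
    · calc _ ≤ ∑ u ∈ words l, if u = w.take l then σ ^ l else 0 := by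
            refine Finset.sum_le_sum fun u hu => ?_
            have hl := mem_words.1 hu
            simp only [List.prefix_iff_eq_take, hl, le_refl]
        _ ≤ _ := by
            rw [Finset.sum_ite_eq']
            split_ifs
            · exact le_rfl
            · exact pow_nonneg hσ l
  refine (Finset.sum_le_sum fun l _ => h1 l).trans ?_
  rw [Finset.sum_add_distrib]
  refine add_le_add ?_ ?_
  · rw [Finset.sum_ite_eq' (Finset.range K) w.length fun _ => (1 : ℝ)]
    split_ifs <;> norm_num
  · rw [← tsum_geometric_of_lt_one hσ hσ1]
    exact (summable_geometric_of_lt_one hσ hσ1).sum_le_tsum _ fun j _ => pow_nonneg hσ j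

/-- The main estimate: modulo constants, composition with `F^n` decays exponentially on each element
of the Haar system, uniformly with respect to its norm. -/
theorem exists_centered_le (h : IsGibbs p θ B γ) (hs : 0 < s) (hsγ : s < γ)
    (hμ : IsNormal p γ (coneConst θ B γ) μ) (hinv : push μ = μ) :
    ∃ C q : ℝ, 0 ≤ C ∧ 0 < q ∧ q < 1 ∧ ∀ n a,
      Summable (fun b => |centered p μ n b a| * wt p s b) ∧
        ∑' b, |centered p μ n b a| * wt p s b ≤ C * (n + 1) * q ^ n * wt p s a := by
  obtain ⟨C₁, hC₁, h₁⟩ := exists_kernel_short_le h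
  obtain ⟨C₂, hC₂, h₂⟩ := exists_centered_none_le h hμ hinv
  obtain ⟨C₃, hC₃, h₃⟩ := exists_kernel_long_le h hs hsγ
  obtain ⟨M, hM, hpush⟩ := exists_push_pow_le h
  set σ := θ ^ s with hσdef
  have hσ : 0 < σ := h.rpow_theta_pos s
  have hσ1 : σ < 1 := h.rpow_theta_lt hs
  set τ := 1 - gap p θ B γ with hτdef
  have hτ : 0 ≤ τ := sub_nonneg.2 (gap_lt_one h).le
  have hτ1 : τ < 1 := by linarith [gap_pos h]
  set q := max σ τ with hq
  have hq0 : 0 < q := lt_max_of_lt_left hσ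
  have hP := h.pos []
  set R := p [] ^ (γ - s) with hR
  have hR0 : 0 ≤ R := Real.rpow_nonneg hP.le _
  have hPs := Real.rpow_nonneg hP.le s
  set D₁ := C₁ * R * p [] ^ s * p [] / q with hD₁
  set D₂ := C₃ * M * (1 + (1 - σ)⁻¹) with hD₂
  have hD₁0 : 0 ≤ D₁ := by positivity
  have hD₂0 : 0 ≤ D₂ := by
    have : 0 < 1 - σ := by linarith
    positivity
  refine ⟨C₂ * R + D₁ + D₂, q, by positivity, hq0, max_lt hσ1 hτ1, fun n a => ?_⟩
  have hC : 0 ≤ (C₂ * R + D₁ + D₂) * (n + 1) * q ^ n := by positivity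
  cases a with
  | none =>
    have hz : (fun b => |centered p μ n b none| * wt p s b) = fun _ => 0 := by
      funext b
      rw [centered, kernel_none_right h.pos h.add, haarPair_none, hμ.total]
      simp
    rw [hz, tsum_zero]
    exact ⟨summable_zero, mul_nonneg hC (wt_pos h.pos _).le⟩
  | some w =>
    have hw := h.pos w
    have hws := Real.rpow_nonneg hw.le s
    have hwγ : p w ^ γ ≤ R * p w ^ s := h.rpow_gamma_le hsγ w
    have hnone : |centered p μ n none (some w)| * wt p s none ≤ C₂ * R * q ^ n * p w ^ s := by
      rw [wt, mul_one]
      refine (h₂ w n).trans ?_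
      have : τ ^ n ≤ q ^ n := pow_le_pow_left₀ hτ (le_max_right _ _) n
      calc C₂ * τ ^ n * p w ^ γ ≤ C₂ * q ^ n * (R * p w ^ s) := by gcongr
        _ = _ := by ring
    -- words shorter than `n` and words `v ++ u` with `v` of length `n` are summed separately
    set f : List (Fin 2) → ℝ := fun u => |kernel p n (some u) (some w)| * p u ^ s with hf
    have hf0 : ∀ u, 0 ≤ f u := fun u => mul_nonneg (abs_nonneg _) (Real.rpow_nonneg (h.pos u).le _)
    have hshort : ∀ k < n, ∑ u ∈ words k, f u ≤ D₁ * q ^ n * p w ^ s := by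
      intro k hk
      obtain ⟨j, rfl⟩ : ∃ j, n = k + 1 + j := ⟨n - k - 1, by omega⟩
      have hfu : ∀ u ∈ words k, f u ≤ C₁ * τ ^ j * (R * p w ^ s) * (σ ^ k * p [] ^ s) * p u := by
        intro u hu
        have hu' := mem_words.1 hu
        have e1 := h₁ u w j
        have e2 : p u ^ s ≤ σ ^ u.length * p [] ^ s := by simpa using h.rpow_append_le hs u []
        rw [hu'] at e1 e2
        have hpu := h.pos u
        calc f u ≤ (C₁ * τ ^ j * p w ^ γ * p u) * (σ ^ k * p [] ^ s) :=
              mul_le_mul e1 e2 (Real.rpow_nonneg hpu.le _) ((abs_nonneg _).trans e1)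
          _ ≤ (C₁ * τ ^ j * (R * p w ^ s) * p u) * (σ ^ k * p [] ^ s) := by gcongr
          _ = _ := by ring
      refine (Finset.sum_le_sum hfu).trans ?_
      rw [← Finset.mul_sum, sum_words, h.add.push_pow_nil]
      have e3 : τ ^ j * σ ^ k ≤ q ^ (k + 1 + j) / q := by
        rw [le_div_iff₀ hq0]
        calc τ ^ j * σ ^ k * q ≤ q ^ j * q ^ k * q := by
              gcongr
              · exact le_max_right _ _
              · exact le_max_left _ _
          _ = _ := by ring
      calc _ = (C₁ * R * p w ^ s * p [] ^ s * p []) * (τ ^ j * σ ^ k) := by ring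
        _ ≤ (C₁ * R * p w ^ s * p [] ^ s * p []) * (q ^ (k + 1 + j) / q) :=
            mul_le_mul_of_nonneg_left e3 (by positivity)
        _ = _ := by rw [hD₁]; ring
    have hlong : ∀ l, ∑ u ∈ words (n + l), f u ≤ C₃ * M * σ ^ n * p w ^ s * ∑ u ∈ words l,
        ((if u = w then 1 else 0) + if u <+: w then σ ^ u.length else 0) := by
      intro l
      rw [sum_words, add_comm, pow_add, Module.End.mul_apply, ← sum_words, Finset.mul_sum]
      refine Finset.sum_le_sum fun u _ => ?_
      rw [push_pow_apply]
      set β : ℝ := (if u = w then 1 else 0) + if u <+: w then σ ^ u.length else 0 with hβ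
      have hβ0 : 0 ≤ β := by
        refine add_nonneg ?_ ?_
        · split_ifs <;> norm_num
        · split_ifs
          · positivity
          · exact le_rfl
      have e1 : ∀ v ∈ words n, f (v ++ u) ≤ C₃ * σ ^ n * p w ^ s * β / p w * p (v ++ w) := by
        intro v hv
        have hv' := mem_words.1 hv
        have := h₃ v u w
        rw [hv'] at this
        refine this.trans (le_of_eq ?_)
        rw [← hβ]; ring
      refine (Finset.sum_le_sum e1).trans ?_
      rw [← Finset.mul_sum, ← push_pow_apply n p w]
      calc _ ≤ C₃ * σ ^ n * p w ^ s * β / p w * (M * p w) := by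
            gcongr
            exact hpush n w
        _ = _ := by field_simp
    have hsum := summable_of_sum_words_le hf0 (c := (n * D₁ + D₂) * q ^ n * p w ^ s) fun K => by
      calc ∑ k ∈ Finset.range K, ∑ u ∈ words k, f u
          ≤ ∑ k ∈ Finset.range (n + K), ∑ u ∈ words k, f u :=
            Finset.sum_le_sum_of_subset_of_nonneg (Finset.range_mono (Nat.le_add_left K n))
              fun k _ _ => Finset.sum_nonneg fun u _ => hf0 u
        _ = ∑ k ∈ Finset.range n, ∑ u ∈ words k, f u +
            ∑ l ∈ Finset.range K, ∑ u ∈ words (n + l), f u := Finset.sum_range_add _ n K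
        _ ≤ ∑ k ∈ Finset.range n, D₁ * q ^ n * p w ^ s +
            ∑ l ∈ Finset.range K, C₃ * M * σ ^ n * p w ^ s * ∑ u ∈ words l,
              ((if u = w then 1 else 0) + if u <+: w then σ ^ u.length else 0) :=
            add_le_add (Finset.sum_le_sum fun k hk => hshort k (Finset.mem_range.1 hk))
              (Finset.sum_le_sum fun l _ => hlong l)
        _ ≤ n * (D₁ * q ^ n * p w ^ s) + C₃ * M * q ^ n * p w ^ s * (1 + (1 - σ)⁻¹) := by
            rw [Finset.sum_const, Finset.card_range, nsmul_eq_mul, ← Finset.mul_sum]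
            gcongr
            · exact le_max_left _ _
            · exact sum_words_long_le hσ.le hσ1 w K
        _ = _ := by rw [hD₂]; ring
    have hsome : ∀ u, |centered p μ n (some u) (some w)| * wt p s (some u) = f u := by
      intro u; simp [centered, wt, hf]
    have hfin : HasSum (fun b => |centered p μ n b (some w)| * wt p s b)
        (|centered p μ n none (some w)| * wt p s none + ∑' u, f u) := by
      have a1 := hasSum_ite_eq (none : Option (List (Fin 2)))
        (|centered p μ n none (some w)| * wt p s none)
      have a2 : HasSum (fun b : Option (List (Fin 2)) => b.elim 0 f) (∑' u, f u) := by
        refine ((Option.some_injective _).hasSum_iff ?_).1 hsum.1.hasSum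
        intro b hb
        cases b with
        | none => rfl
        | some u => exact absurd ⟨u, rfl⟩ hb
      refine (a1.add a2).of_eq (fun b => ?_) rfl
      cases b with
      | none => simp
      | some u => simp [hsome]
    refine ⟨hfin.summable, ?_⟩
    rw [hfin.tsum_eq]
    refine (add_le_add hnone hsum.2).trans ?_
    have hqn : 0 ≤ q ^ n * p w ^ s := by positivity
    change _ ≤ (C₂ * R + D₁ + D₂) * (n + 1) * q ^ n * p w ^ s
    have hn : (0 : ℝ) ≤ n := Nat.cast_nonneg n
    have : C₂ * R + (n * D₁ + D₂) ≤ (C₂ * R + D₁ + D₂) * (n + 1) := by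
      have := mul_nonneg (mul_nonneg hC₂ hR0) hn
      have := mul_nonneg hD₂0 hn
      nlinarith
    have := mul_le_mul_of_nonneg_right this hqn
    linarith

end

/-! ### Matrices acting on weighted `ℓ¹` spaces -/

section

variable {ι κ : Type*} {𝕜 : Type*} [RCLike 𝕜] {W : ι → ℝ}

/-- An absolutely convergent series of elements `f a` of a weighted `ℓ¹` space may be summed
coordinate by coordinate. -/
theorem summable_weighted_tsum (hW : ∀ b, 0 < W b) {f : κ → ι → 𝕜} {c : κ → ℝ} (hc : Summable c)
    (hf : ∀ a, Summable (fun b => ‖f a b‖ * W b)) (hfc : ∀ a, ∑' b, ‖f a b‖ * W b ≤ c a) :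
    Summable (fun x : κ × ι => ‖f x.1 x.2‖ * W x.2) ∧ (∀ b, Summable fun a => f a b) ∧
      Summable (fun b => ‖∑' a, f a b‖ * W b) ∧ ∑' b, ‖∑' a, f a b‖ * W b ≤ ∑' a, c a := by
  have h0 : ∀ a b, 0 ≤ ‖f a b‖ * W b := fun a b => mul_nonneg (norm_nonneg _) (hW b).le
  have hS : Summable (fun a => ∑' b, ‖f a b‖ * W b) :=
    Summable.of_nonneg_of_le (fun a => tsum_nonneg (h0 a)) hfc hc
  have hG : Summable (fun x : κ × ι => ‖f x.1 x.2‖ * W x.2) :=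
    (summable_prod_of_nonneg fun x => h0 x.1 x.2).2 ⟨hf, hS⟩
  have hG' : Summable (fun x : ι × κ => ‖f x.2 x.1‖ * W x.1) := hG.prod_symm
  have hrow : ∀ b, Summable fun a => ‖f a b‖ := fun b =>
    (summable_mul_right_iff (hW b).ne').1 (hG'.prod_factor b)
  have hle : ∀ b, ‖∑' a, f a b‖ * W b ≤ ∑' a, ‖f a b‖ * W b := by
    intro b
    rw [tsum_mul_right]
    exact mul_le_mul_of_nonneg_right (norm_tsum_le_tsum_norm (hrow b)) (hW b).le
  have hR : Summable fun b => ∑' a, ‖f a b‖ * W b := hG'.prod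
  have hL := Summable.of_nonneg_of_le
    (fun b => mul_nonneg (norm_nonneg _) (hW b).le) hle hR
  refine ⟨hG, fun b => (hrow b).of_norm, hL, (hL.tsum_le_tsum hle hR).trans ?_⟩
  rw [Summable.tsum_comm hG]
  exact hS.tsum_le_tsum hfc hc

/-- The matrix `K` defines an operator of norm at most `c` on the `ℓ¹` space with weight `W`. -/
def IsBoundedKernel (W : ι → ℝ) (K : ι → ι → ℝ) (c : ℝ) : Prop :=
  ∀ a, Summable (fun b => |K b a| * W b) ∧ ∑' b, |K b a| * W b ≤ c * W a

/-- The action of a matrix on a family of coefficients. -/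
noncomputable def kernelApply (K : ι → ι → ℝ) (v : ι → 𝕜) : ι → 𝕜 :=
  fun b => ∑' a, v a * ((K b a : ℝ) : 𝕜)

theorem IsBoundedKernel.abs_le {K : ι → ι → ℝ} {c : ℝ} (hW : ∀ b, 0 < W b)
    (hK : IsBoundedKernel W K c) (b a : ι) : |K b a| ≤ c * W a / W b := by
  rw [le_div_iff₀ (hW b)]
  exact ((hK a).1.le_tsum b fun b _ => mul_nonneg (abs_nonneg _) (hW b).le).trans (hK a).2

theorem IsBoundedKernel.apply {K : ι → ι → ℝ} {c : ℝ} (hW : ∀ b, 0 < W b)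
    (hK : IsBoundedKernel W K c) {v : ι → 𝕜} (hv : Summable fun a => ‖v a‖ * W a) :
    Summable (fun x : ι × ι => ‖v x.1 * ((K x.2 x.1 : ℝ) : 𝕜)‖ * W x.2) ∧
    (∀ b, Summable fun a => v a * ((K b a : ℝ) : 𝕜)) ∧
      Summable (fun b => ‖kernelApply K v b‖ * W b) ∧
        ∑' b, ‖kernelApply K v b‖ * W b ≤ c * ∑' a, ‖v a‖ * W a := by
  have he : ∀ a b, ‖v a * ((K b a : ℝ) : 𝕜)‖ * W b = ‖v a‖ * (|K b a| * W b) := by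
    intro a b; rw [norm_mul, RCLike.norm_ofReal, mul_assoc]
  have := summable_weighted_tsum hW (f := fun a b => v a * ((K b a : ℝ) : 𝕜))
    (hv.mul_left c) (fun a => ?_) (fun a => ?_)
  · rw [tsum_mul_left] at this
    exact this
  · simp only [he]
    exact (hK a).1.mul_left _
  · simp only [he]
    rw [tsum_mul_left]
    have := mul_le_mul_of_nonneg_left (hK a).2 (norm_nonneg (v a))
    linarith

theorem IsBoundedKernel.kernelApply_add {K : ι → ι → ℝ} {c : ℝ} (hW : ∀ b, 0 < W b)
    (hK : IsBoundedKernel W K c) {v w : ι → 𝕜} (hv : Summable fun a => ‖v a‖ * W a)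
    (hw : Summable fun a => ‖w a‖ * W a) :
    kernelApply K (v + w) = kernelApply K v + kernelApply K w := by
  funext b
  simp only [kernelApply, Pi.add_apply, add_mul]
  exact ((hK.apply hW hv).2.1 b).tsum_add ((hK.apply hW hw).2.1 b)

theorem kernelApply_smul (K : ι → ι → ℝ) (c : 𝕜) (v : ι → 𝕜) :
    kernelApply K (c • v) = c • kernelApply K v := by
  funext b
  simp only [kernelApply, Pi.smul_apply, smul_eq_mul, mul_assoc, tsum_mul_left]

theorem kernelApply_comp {K₁ K₂ K₃ : ι → ι → ℝ} {c₁ c₂ : ℝ} (hW : ∀ b, 0 < W b)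
    (h₁ : IsBoundedKernel W K₁ c₁) (h₂ : IsBoundedKernel W K₂ c₂)
    (h : ∀ c a, HasSum (fun b => K₁ c b * K₂ b a) (K₃ c a)) {v : ι → 𝕜}
    (hv : Summable fun a => ‖v a‖ * W a) :
    kernelApply K₁ (kernelApply K₂ v) = kernelApply K₃ v := by
  funext c
  have hs : Summable (fun x : ι × ι => v x.1 * ((K₂ x.2 x.1 : ℝ) : 𝕜) * ((K₁ c x.2 : ℝ) : 𝕜)) := by
    refine Summable.of_norm_bounded ((h₂.apply hW hv).1.mul_left (c₁ / W c)) fun x => ?_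
    rw [norm_mul, RCLike.norm_ofReal]
    have := mul_le_mul_of_nonneg_left (h₁.abs_le hW c x.2)
      (norm_nonneg (v x.1 * ((K₂ x.2 x.1 : ℝ) : 𝕜)))
    refine this.trans (le_of_eq ?_)
    ring
  have hs' : Summable (Function.uncurry fun a b => v a * ((K₂ b a : ℝ) : 𝕜) * ((K₁ c b : ℝ) : 𝕜)) :=
    hs
  simp only [kernelApply]
  calc ∑' b, (∑' a, v a * ((K₂ b a : ℝ) : 𝕜)) * ((K₁ c b : ℝ) : 𝕜)
      = ∑' b, ∑' a, v a * ((K₂ b a : ℝ) : 𝕜) * ((K₁ c b : ℝ) : 𝕜) := by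
        simp only [tsum_mul_right]
    _ = ∑' a, ∑' b, v a * ((K₂ b a : ℝ) : 𝕜) * ((K₁ c b : ℝ) : 𝕜) := hs'.tsum_comm
    _ = ∑' a, v a * ((K₃ c a : ℝ) : 𝕜) := by
        refine tsum_congr fun a => ?_
        have h1 : HasSum (fun b => ((K₁ c b * K₂ b a : ℝ) : 𝕜)) ((K₃ c a : ℝ) : 𝕜) :=
          RCLike.hasSum_ofReal 𝕜 |>.2 (h c a)
        rw [← (h1.mul_left (v a)).tsum_eq]
        refine tsum_congr fun b => ?_
        rw [RCLike.ofReal_mul]; ring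

theorem IsBoundedKernel.tsum {D : ℕ → ι → ι → ℝ} {c : ℕ → ℝ} (hW : ∀ b, 0 < W b)
    (hD : ∀ n, IsBoundedKernel W (D n) (c n)) (hc : Summable c) :
    (∀ b a, Summable fun n => D n b a) ∧
      IsBoundedKernel W (fun b a => ∑' n, D n b a) (∑' n, c n) := by
  have key := fun a => summable_weighted_tsum hW (f := fun n b => D n b a)
    (hc.mul_right (W a)) (fun n => (hD n a).1) (fun n => (hD n a).2)
  refine ⟨fun b a => (key a).2.1 b, fun a => ⟨(key a).2.2.1, ?_⟩⟩
  rw [← tsum_mul_right]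
  exact (key a).2.2.2

theorem IsBoundedKernel.add {K K' : ι → ι → ℝ} {c c' : ℝ} (hW : ∀ b, 0 < W b)
    (hK : IsBoundedKernel W K c) (hK' : IsBoundedKernel W K' c') :
    IsBoundedKernel W (fun b a => K b a + K' b a) (c + c') := by
  intro a
  have hle : ∀ b, |K b a + K' b a| * W b ≤ |K b a| * W b + |K' b a| * W b := fun b => by
    rw [← add_mul]; exact mul_le_mul_of_nonneg_right (abs_add_le _ _) (hW b).le
  have hs := (hK a).1.add (hK' a).1
  have hs' := Summable.of_nonneg_of_le (fun b => mul_nonneg (abs_nonneg _) (hW b).le) hle hs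
  refine ⟨hs', (hs'.tsum_le_tsum hle hs).trans ?_⟩
  rw [(hK a).1.tsum_add (hK' a).1, add_mul]
  exact add_le_add (hK a).2 (hK' a).2

theorem isBoundedKernel_rankOne [DecidableEq ι] (o : ι) {e : ι → ℝ} {C : ℝ}
    (hW : ∀ b, 0 < W b) (he : ∀ a, |e a| ≤ C * W a) :
    IsBoundedKernel W (fun b a => if b = o then e a else 0) (C * W o) := by
  intro a
  have h : HasSum (fun b => |if b = o then e a else 0| * W b) (|e a| * W o) := by
    refine (hasSum_ite_eq o (|e a| * W o)).of_eq (fun b => ?_) rfl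
    split_ifs with hb
    · rw [hb]
    · simp
  refine ⟨h.summable, ?_⟩
  rw [h.tsum_eq]
  have := mul_le_mul_of_nonneg_right (he a) (hW o).le
  linarith

/-- The norm of the `ℓ¹` space with weight `W`. -/
noncomputable def wnorm (W : ι → ℝ) (v : ι → 𝕜) : ℝ := ∑' a, ‖v a‖ * W a

theorem wnorm_nonneg (hW : ∀ b, 0 < W b) (v : ι → 𝕜) : 0 ≤ wnorm W v :=
  tsum_nonneg fun a => mul_nonneg (norm_nonneg _) (hW a).le

theorem summable_weighted_add (hW : ∀ b, 0 < W b) {v w : ι → 𝕜}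
    (hv : Summable fun a => ‖v a‖ * W a) (hw : Summable fun a => ‖w a‖ * W a) :
    Summable (fun a => ‖(v + w) a‖ * W a) ∧ wnorm W (v + w) ≤ wnorm W v + wnorm W w := by
  have hle : ∀ a, ‖(v + w) a‖ * W a ≤ ‖v a‖ * W a + ‖w a‖ * W a := fun a => by
    rw [← add_mul]; exact mul_le_mul_of_nonneg_right (norm_add_le _ _) (hW a).le
  have hs := Summable.of_nonneg_of_le (fun a => mul_nonneg (norm_nonneg _) (hW a).le) hle
    (hv.add hw)
  refine ⟨hs, (hs.tsum_le_tsum hle (hv.add hw)).trans ?_⟩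
  rw [hv.tsum_add hw]
  exact le_rfl

theorem summable_weighted_smul {v : ι → 𝕜} (c : 𝕜) (hv : Summable fun a => ‖v a‖ * W a) :
    Summable fun a => ‖(c • v) a‖ * W a := by
  simpa [norm_mul, mul_assoc] using hv.mul_left ‖c‖

theorem summable_weighted_neg {v : ι → 𝕜} (hv : Summable fun a => ‖v a‖ * W a) :
    Summable (fun a => ‖(-v) a‖ * W a) := by
  simpa using hv

theorem wnorm_neg (v : ι → 𝕜) : wnorm W (-v) = wnorm W v := by
  simp [wnorm]

theorem eq_zero_of_wnorm_eq_zero (hW : ∀ b, 0 < W b) {v : ι → 𝕜}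
    (hv : Summable fun a => ‖v a‖ * W a) (h : wnorm W v ≤ 0) : v = 0 := by
  funext a
  have h1 := (hv.le_tsum a fun b _ => mul_nonneg (norm_nonneg _) (hW b).le).trans h
  have h2 : ‖v a‖ ≤ 0 := by
    by_contra h3
    have := mul_pos (not_le.1 h3) (hW a)
    linarith
  simpa using h2

/-! ### The cohomological equation on a weighted `ℓ¹` space -/

/-- Data for solving `φ = A ψ - ψ` on a weighted `ℓ¹` space, where the powers of `A` have matrices
`K n`: there is an invariant vector (the basis vector of index `o`), an invariant functional `e`,
and the powers of `A` converge to the corresponding rank-one projection, with summable speed. -/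
structure IsMixing [DecidableEq ι] (W : ι → ℝ) (K : ℕ → ι → ι → ℝ) (o : ι) (e : ι → ℝ)
    (c : ℕ → ℝ) (C : ℝ) : Prop where
  pos : ∀ b, 0 < W b
  zero : ∀ b a, K 0 b a = if b = a then 1 else 0
  succ : ∀ k c a, HasSum (fun b => K 1 c b * K k b a) (K (k + 1) c a)
  one : ∀ b, K 1 b o = if b = o then 1 else 0
  pairing : ∀ a, |e a| ≤ C * W a
  decay : ∀ n, IsBoundedKernel W (fun b a => K n b a - if b = o then e a else 0) (c n)
  summable : Summable c

namespace IsMixing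

variable [DecidableEq ι] {K : ℕ → ι → ι → ℝ} {o : ι} {e : ι → ℝ} {c : ℕ → ℝ} {C : ℝ}

theorem hasSum_pairing (h : IsMixing W K o e c C) {v : ι → 𝕜}
    (hv : Summable fun a => ‖v a‖ * W a) :
    Summable (fun a => v a * ((e a : ℝ) : 𝕜)) ∧ ‖∑' a, v a * ((e a : ℝ) : 𝕜)‖ ≤ C * wnorm W v := by
  have hle : ∀ a, ‖v a * ((e a : ℝ) : 𝕜)‖ ≤ C * (‖v a‖ * W a) := by
    intro a
    rw [norm_mul, RCLike.norm_ofReal]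
    have := mul_le_mul_of_nonneg_left (h.pairing a) (norm_nonneg (v a))
    linarith
  have hs := hv.mul_left C
  have hn := Summable.of_nonneg_of_le (fun a => norm_nonneg _) hle hs
  refine ⟨hn.of_norm, (norm_tsum_le_tsum_norm hn).trans ((hn.tsum_le_tsum hle hs).trans ?_)⟩
  rw [tsum_mul_left]
  exact le_rfl

theorem isBoundedKernel (h : IsMixing W K o e c C) (n : ℕ) :
    IsBoundedKernel W (K n) (c n + C * W o) := by
  simpa using (h.decay n).add h.pos (isBoundedKernel_rankOne o h.pos h.pairing)

/-- The decomposition of the `n`-th power of the operator into its decaying part and the projection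
onto the invariant vector along the kernel of the invariant functional. -/
theorem kernelApply_decay (h : IsMixing W K o e c C) {v : ι → 𝕜}
    (hv : Summable fun a => ‖v a‖ * W a) (n : ℕ) :
    kernelApply (K n) v = kernelApply (fun b a => K n b a - if b = o then e a else 0) v +
      (∑' a, v a * ((e a : ℝ) : 𝕜)) • Pi.single o 1 := by
  funext b
  have h1 := ((h.decay n).apply h.pos hv).2.1 b
  have h2 := ((isBoundedKernel_rankOne o h.pos h.pairing).apply h.pos hv).2.1 b
  have h3 : kernelApply (K n) v b = ∑' a, (v a * (((K n b a - if b = o then e a else 0) : ℝ) : 𝕜) +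
      v a * (((if b = o then e a else 0) : ℝ) : 𝕜)) := by
    simp only [kernelApply]
    refine tsum_congr fun a => ?_
    rw [← mul_add, ← RCLike.ofReal_add, sub_add_cancel]
  rw [h3, h1.tsum_add h2]
  simp only [Pi.add_apply, Pi.smul_apply, smul_eq_mul, kernelApply]
  congr 1
  by_cases hb : b = o
  · subst hb; simp
  · simp [hb]

/-- The solution `- ∑ₙ Aⁿ φ` of `φ = A ψ - ψ`, where the projection onto the invariant vector has
been removed from each term. -/
noncomputable def solve (K : ℕ → ι → ι → ℝ) (o : ι) (e : ι → ℝ) (v : ι → 𝕜) : ι → 𝕜 :=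
  -kernelApply (fun b a => ∑' n, (K n b a - if b = o then e a else 0)) v

theorem summable_solve (h : IsMixing W K o e c C) {v : ι → 𝕜}
    (hv : Summable fun a => ‖v a‖ * W a) :
    Summable (fun a => ‖solve K o e v a‖ * W a) ∧
      wnorm W (solve K o e v) ≤ (∑' n, c n) * wnorm W v := by
  have h1 := (IsBoundedKernel.tsum h.pos h.decay h.summable).2.apply h.pos hv
  refine ⟨summable_weighted_neg h1.2.2.1, ?_⟩
  rw [solve, wnorm_neg]
  exact h1.2.2.2

theorem solve_add (h : IsMixing W K o e c C) {v w : ι → 𝕜}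
    (hv : Summable fun a => ‖v a‖ * W a) (hw : Summable fun a => ‖w a‖ * W a) :
    solve K o e (v + w) = solve K o e v + solve K o e w := by
  have h1 := (IsBoundedKernel.tsum h.pos h.decay h.summable).2.kernelApply_add h.pos hv hw
  rw [solve, h1, solve, solve, neg_add]

theorem solve_smul (r : 𝕜) (v : ι → 𝕜) : solve K o e (r • v) = r • solve K o e v := by
  rw [solve, kernelApply_smul, solve, smul_neg]

theorem summable_sum (h : IsMixing W K o e c C) {v : ι → 𝕜}
    (hv : Summable fun a => ‖v a‖ * W a) (n : ℕ) :
    Summable fun a => ‖(∑ k ∈ Finset.range n, kernelApply (K k) v) a‖ * W a := by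
  induction n with
  | zero => simp
  | succ n ih =>
    rw [Finset.sum_range_succ]
    exact (summable_weighted_add h.pos ih ((h.isBoundedKernel n).apply h.pos hv).2.2.1).1

/-- The remainder of the series defining `solve`. -/
theorem solve_remainder (h : IsMixing W K o e c C) {v : ι → 𝕜}
    (hv : Summable fun a => ‖v a‖ * W a) (h0 : ∑' a, v a * ((e a : ℝ) : 𝕜) = 0) (n : ℕ) :
    Summable (fun a => ‖(solve K o e v + ∑ k ∈ Finset.range n, kernelApply (K k) v) a‖ * W a) ∧
      wnorm W (solve K o e v + ∑ k ∈ Finset.range n, kernelApply (K k) v) ≤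
        (∑' k, c (k + n)) * wnorm W v := by
  have hS := IsBoundedKernel.tsum h.pos h.decay h.summable
  have hT := IsBoundedKernel.tsum h.pos (fun k => h.decay (k + n))
    ((summable_nat_add_iff n).2 h.summable)
  have key : solve K o e v + ∑ k ∈ Finset.range n, kernelApply (K k) v =
      solve (fun k => K (k + n)) o e v := by
    funext b
    have e1 : ∀ k, kernelApply (K k) v b =
        ∑' a, v a * (((K k b a - if b = o then e a else 0) : ℝ) : 𝕜) := by
      intro k
      rw [h.kernelApply_decay hv k, h0, zero_smul, add_zero]
      rfl
    have e2 : ∀ k, Summable fun a => v a * (((K k b a - if b = o then e a else 0) : ℝ) : 𝕜) :=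
      fun k => ((h.decay k).apply h.pos hv).2.1 b
    have e3 := (hS.2.apply h.pos hv).2.1 b
    have e4 := (hT.2.apply h.pos hv).2.1 b
    simp only [Pi.add_apply, Finset.sum_apply, e1, solve, Pi.neg_apply]
    simp only [kernelApply]
    rw [← Summable.tsum_finsetSum fun k _ => e2 k, neg_add_eq_iff_eq_add, ← sub_eq_add_neg,
      eq_sub_iff_add_eq, ← (_root_.summable_sum fun k _ => e2 k).tsum_add e4]
    refine tsum_congr fun a => ?_
    rw [← Finset.mul_sum, ← mul_add, ← RCLike.ofReal_sum, ← RCLike.ofReal_add,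
      (hS.1 b a).sum_add_tsum_nat_add n]
  have h1 := hT.2.apply h.pos hv
  rw [key]
  refine ⟨summable_weighted_neg h1.2.2.1, ?_⟩
  rw [solve, wnorm_neg]
  exact h1.2.2.2

theorem tendsto_solve_remainder (h : IsMixing W K o e c C) {v : ι → 𝕜}
    (hv : Summable fun a => ‖v a‖ * W a) (h0 : ∑' a, v a * ((e a : ℝ) : 𝕜) = 0) :
    Tendsto (fun n => wnorm W (solve K o e v + ∑ k ∈ Finset.range n, kernelApply (K k) v)) atTop
      (𝓝 0) := by
  refine squeeze_zero (fun n => wnorm_nonneg h.pos _) (fun n => (h.solve_remainder hv h0 n).2) ?_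
  simpa using (tendsto_sum_nat_add c).mul_const (wnorm W v)

theorem kernelApply_succ (h : IsMixing W K o e c C) {v : ι → 𝕜}
    (hv : Summable fun a => ‖v a‖ * W a) (k : ℕ) :
    kernelApply (K 1) (kernelApply (K k) v) = kernelApply (K (k + 1)) v :=
  kernelApply_comp h.pos (h.isBoundedKernel 1) (h.isBoundedKernel k) (h.succ k) hv

theorem kernelApply_zero (h : IsMixing W K o e c C) (v : ι → 𝕜) : kernelApply (K 0) v = v := by
  funext b
  rw [kernelApply, tsum_eq_single b]
  · simp [h.zero]
  · intro a ha
    simp [h.zero, ha.symm]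

theorem kernelApply_single (h : IsMixing W K o e c C) :
    kernelApply (K 1) (Pi.single o (1 : 𝕜)) = Pi.single o 1 := by
  funext b
  rw [kernelApply, tsum_eq_single o]
  · by_cases hb : b = o
    · subst hb; simp [h.one]
    · simp [h.one, hb]
  · intro a ha
    simp [ha]

theorem tendsto_wnorm_decay (h : IsMixing W K o e c C) {v : ι → 𝕜}
    (hv : Summable fun a => ‖v a‖ * W a) :
    Tendsto (fun n => wnorm W (kernelApply (fun b a => K n b a - if b = o then e a else 0) v))
      atTop (𝓝 0) := by
  refine squeeze_zero (fun n => wnorm_nonneg h.pos _)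
    (fun n => ((h.decay n).apply h.pos hv).2.2.2) ?_
  rw [← zero_mul (wnorm W v)]
  exact h.summable.tendsto_atTop_zero.mul_const (wnorm W v)

/-- `solve` solves the equation on the kernel of the invariant functional. -/
theorem kernelApply_solve_sub (h : IsMixing W K o e c C) {v : ι → 𝕜}
    (hv : Summable fun a => ‖v a‖ * W a) (h0 : ∑' a, v a * ((e a : ℝ) : 𝕜) = 0) :
    kernelApply (K 1) (solve K o e v) - solve K o e v = v := by
  set T := solve K o e v with hT
  set S : ℕ → ι → 𝕜 := fun n => ∑ k ∈ Finset.range n, kernelApply (K k) v with hS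
  have hTs : Summable fun a => ‖T a‖ * W a := (h.summable_solve hv).1
  have h1 := h.isBoundedKernel 1
  have hK1S : ∀ n, kernelApply (K 1) (S n) = ∑ k ∈ Finset.range n, kernelApply (K (k + 1)) v := by
    intro n
    induction n with
    | zero => funext b; simp [hS, kernelApply]
    | succ n ih =>
      have : S (n + 1) = S n + kernelApply (K n) v := Finset.sum_range_succ _ _
      rw [this, h1.kernelApply_add h.pos (h.summable_sum hv n)
        ((h.isBoundedKernel n).apply h.pos hv).2.2.1, ih, h.kernelApply_succ hv,
        Finset.sum_range_succ]
  -- the defect of the partial sums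
  have hdef : ∀ n, kernelApply (K 1) T - T - v =
      kernelApply (K 1) (T + S n) + (-(T + S n) + -kernelApply (K n) v) := by
    intro n
    rw [h1.kernelApply_add h.pos hTs (h.summable_sum hv n), hK1S]
    have e1 : ∑ k ∈ Finset.range n, kernelApply (K (k + 1)) v + v =
        S n + kernelApply (K n) v := by
      have := (Finset.sum_range_succ' (fun k => kernelApply (K k) v) n).symm.trans
        (Finset.sum_range_succ (fun k => kernelApply (K k) v) n)
      rwa [h.kernelApply_zero v] at this
    rw [eq_sub_of_add_eq e1]
    abel
  have hR := h.tendsto_solve_remainder hv h0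
  have hKn : ∀ n, kernelApply (K n) v =
      kernelApply (fun b a => K n b a - if b = o then e a else 0) v := by
    intro n
    rw [h.kernelApply_decay hv, h0, zero_smul, add_zero]
  have hlim : Tendsto (fun n => (c 1 + C * W o) * wnorm W (T + S n) +
      (wnorm W (T + S n) + wnorm W (kernelApply (K n) v))) atTop (𝓝 0) := by
    have h2 := h.tendsto_wnorm_decay hv
    simp only [← hKn] at h2
    simpa using (hR.const_mul (c 1 + C * W o)).add (hR.add h2)
  have hbound : ∀ n, Summable (fun a => ‖(kernelApply (K 1) T - T - v) a‖ * W a) ∧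
      wnorm W (kernelApply (K 1) T - T - v) ≤ (c 1 + C * W o) * wnorm W (T + S n) +
        (wnorm W (T + S n) + wnorm W (kernelApply (K n) v)) := by
    intro n
    rw [hdef n]
    have hr := (h.solve_remainder hv h0 n).1
    have hk := h1.apply h.pos hr
    have hn := ((h.isBoundedKernel n).apply h.pos hv).2.2.1
    have a1 := summable_weighted_add h.pos (summable_weighted_neg hr) (summable_weighted_neg hn)
    have a2 := summable_weighted_add h.pos hk.2.2.1 a1.1
    rw [wnorm_neg, wnorm_neg] at a1
    exact ⟨a2.1, a2.2.trans (add_le_add hk.2.2.2 a1.2)⟩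
  exact sub_eq_zero.1 (eq_zero_of_wnorm_eq_zero h.pos (hbound 0).1
    (ge_of_tendsto' hlim fun n => (hbound n).2))

/-- The only fixed vectors are the multiples of the invariant vector. -/
theorem eq_smul_of_kernelApply_eq (h : IsMixing W K o e c C) {v : ι → 𝕜}
    (hv : Summable fun a => ‖v a‖ * W a) (hfix : kernelApply (K 1) v = v) :
    v = (∑' a, v a * ((e a : ℝ) : 𝕜)) • Pi.single o 1 := by
  have hn : ∀ n, kernelApply (K n) v = v := by
    intro n
    induction n with
    | zero => exact h.kernelApply_zero v
    | succ n ih => rw [← h.kernelApply_succ hv, ih, hfix]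
  have hd : ∀ n, kernelApply (fun b a => K n b a - if b = o then e a else 0) v =
      v - (∑' a, v a * ((e a : ℝ) : 𝕜)) • Pi.single o 1 := by
    intro n
    rw [eq_sub_iff_add_eq, ← h.kernelApply_decay hv, hn]
  have h1 := h.tendsto_wnorm_decay hv
  simp only [hd] at h1
  have h2 := ((h.decay 0).apply h.pos hv).2.2.1
  rw [hd] at h2
  exact sub_eq_zero.1 (eq_zero_of_wnorm_eq_zero h.pos h2
    (le_of_eq (tendsto_nhds_unique tendsto_const_nhds h1)))

/-- The functional `e` is invariant. -/
theorem tsum_pairing_kernelApply (h : IsMixing W K o e c C) {v : ι → 𝕜}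
    (hv : Summable fun a => ‖v a‖ * W a)
    (he : ∀ k a, HasSum (fun b => K k b a * e b) (e a)) (k : ℕ) :
    ∑' a, kernelApply (K k) v a * ((e a : ℝ) : 𝕜) = ∑' a, v a * ((e a : ℝ) : 𝕜) := by
  have h1 := kernelApply_comp (K₁ := fun b a => if b = o then e a else 0) (K₂ := K k)
    (K₃ := fun b a => if b = o then e a else 0) h.pos
    (isBoundedKernel_rankOne o h.pos h.pairing) (h.isBoundedKernel k) (fun b a => ?_) hv
  · have := congrFun h1 o
    simpa [kernelApply] using this
  · by_cases hb : b = o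
    · simpa [hb, mul_comm] using he k a
    · simp [hb]

/-- `solve` preserves the kernel of the invariant functional. -/
theorem tsum_pairing_solve (h : IsMixing W K o e c C) {v : ι → 𝕜}
    (hv : Summable fun a => ‖v a‖ * W a)
    (he : ∀ k a, HasSum (fun b => K k b a * e b) (e a))
    (h0 : ∑' a, v a * ((e a : ℝ) : 𝕜) = 0) :
    ∑' a, solve K o e v a * ((e a : ℝ) : 𝕜) = 0 := by
  have hsum : ∀ n, ∑' a, (∑ k ∈ Finset.range n, kernelApply (K k) v) a * ((e a : ℝ) : 𝕜) = 0 := by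
    intro n
    have e1 : ∀ a, (∑ k ∈ Finset.range n, kernelApply (K k) v) a * ((e a : ℝ) : 𝕜) =
        ∑ k ∈ Finset.range n, kernelApply (K k) v a * ((e a : ℝ) : 𝕜) := by
      intro a; rw [Finset.sum_apply, Finset.sum_mul]
    simp only [e1]
    rw [Summable.tsum_finsetSum fun k _ =>
      (h.hasSum_pairing ((h.isBoundedKernel k).apply h.pos hv).2.2.1).1]
    exact Finset.sum_eq_zero fun k _ => by rw [h.tsum_pairing_kernelApply hv he, h0]
  have hle : ∀ n, ‖∑' a, solve K o e v a * ((e a : ℝ) : 𝕜)‖ ≤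
      C * wnorm W (solve K o e v + ∑ k ∈ Finset.range n, kernelApply (K k) v) := by
    intro n
    have h1 := h.hasSum_pairing (h.solve_remainder hv h0 n).1
    have h2 : ∑' a, (solve K o e v + ∑ k ∈ Finset.range n, kernelApply (K k) v) a *
        ((e a : ℝ) : 𝕜) = ∑' a, solve K o e v a * ((e a : ℝ) : 𝕜) := by
      simp only [Pi.add_apply, add_mul]
      rw [Summable.tsum_add (h.hasSum_pairing (h.summable_solve hv).1).1
        (h.hasSum_pairing (h.summable_sum hv n)).1, hsum, add_zero]
    rw [← h2]
    exact h1.2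
  have hlim := (h.tendsto_solve_remainder hv h0).const_mul C
  rw [mul_zero] at hlim
  exact norm_le_zero_iff.1 (ge_of_tendsto' hlim hle)

end IsMixing

end

/-! ### Cylinders of the Markov map -/

/-- The measures of the cylinders. -/
noncomputable def cylMass {X : Type*} [MeasurableSpace X] (m : Measure X) (J : Fin 2 → Set X)
    (F : X → X) (w : List (Fin 2)) : ℝ := m.real (cyl J F w)

/-- The masses of the cylinders for the signed measure `f m`. -/
noncomputable def cylInt {X : Type*} [MeasurableSpace X] (m : Measure X) (J : Fin 2 → Set X)
    (F : X → X) (f : X → ℝ) (w : List (Fin 2)) : ℝ := ∫ x in cyl J F w, f x ∂m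

theorem cyl_append {X : Type*} (J : Fin 2 → Set X) (F : X → X) (v w : List (Fin 2)) :
    cyl J F (v ++ w) = cyl J F v ∩ F^[v.length] ⁻¹' cyl J F w := by
  induction v with
  | nil => simp [cyl]
  | cons i v ih =>
    rw [List.cons_append, cyl, ih, cyl, List.length_cons, Function.iterate_succ, Set.preimage_inter,
      Set.inter_assoc, Set.preimage_comp]

theorem cyl_subset_of_prefix {X : Type*} {J : Fin 2 → Set X} {F : X → X} {v w : List (Fin 2)}
    (h : v <+: w) : cyl J F w ⊆ cyl J F v := by
  obtain ⟨u, rfl⟩ := h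
  rw [cyl_append]
  exact Set.inter_subset_left

theorem exists_mem_cyl {X : Type*} {J : Fin 2 → Set X} {F : X → X} {x : X}
    (hx : ∀ k, F^[k] x ∈ J 0 ∪ J 1) (n : ℕ) :
    ∃ v : List (Fin 2), v.length = n ∧ x ∈ cyl J F v := by
  induction n generalizing x with
  | zero => exact ⟨[], rfl, Set.mem_univ x⟩
  | succ n ih =>
    obtain ⟨v, hv, hxv⟩ := ih (x := F x) fun k => by
      simpa only [Function.iterate_succ, Function.comp] using hx (k + 1)
    rcases hx 0 with h | h
    · exact ⟨0 :: v, by simp [hv], h, hxv⟩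
    · exact ⟨1 :: v, by simp [hv], h, hxv⟩

theorem exists_mem_cyl_append {X : Type*} {J : Fin 2 → Set X} {F : X → X} {x : X}
    (hx : ∀ k, F^[k] x ∈ J 0 ∪ J 1) {w : List (Fin 2)} (hw : x ∈ cyl J F w) (n : ℕ) :
    ∃ v : List (Fin 2), v.length = n ∧ x ∈ cyl J F (w ++ v) := by
  obtain ⟨v, hv, hxv⟩ := exists_mem_cyl (x := F^[w.length] x) (J := J) (F := F)
    (fun k => by rw [← Function.iterate_add_apply]; exact hx _) n
  exact ⟨v, hv, by rw [cyl_append]; exact ⟨hw, hxv⟩⟩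

theorem cylInt_one {X : Type*} [MeasurableSpace X] (m : Measure X) (J : Fin 2 → Set X)
    (F : X → X) : cylInt m J F (fun _ => 1) = cylMass m J F := by
  funext w; simp [cylInt, cylMass]

theorem abs_log_sub_log_le {a b : ℝ} (ha : 1 < a) (hb : 1 < b) :
    |Real.log a - Real.log b| ≤ |a - b| := by
  have key : ∀ a b : ℝ, 1 < a → 1 < b → Real.log a - Real.log b ≤ |a - b| := by
    intro a b ha hb
    have ha0 : 0 < a := one_pos.trans ha
    have hb0 : 0 < b := one_pos.trans hb
    rw [← Real.log_div ha0.ne' hb0.ne']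
    refine (Real.log_le_sub_one_of_pos (div_pos ha0 hb0)).trans ?_
    rw [div_sub_one hb0.ne', div_le_iff₀ hb0]
    nlinarith [le_abs_self (a - b), abs_nonneg (a - b)]
  rw [abs_le]
  have h1 := key a b ha hb
  have h2 := key b a hb ha
  rw [abs_sub_comm] at h2
  exact ⟨by linarith, h1⟩

section

variable {X : Type*} [MetricSpace X] [MeasurableSpace X] {m : Measure X} {J : Fin 2 → Set X}
  {F : X → X} {g : X → ℝ}

theorem IsMarkovExpanding.disjoint_cyl (hF : IsMarkovExpanding m J F g) {v w : List (Fin 2)}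
    (h : ¬ v <+: w) (h' : ¬ w <+: v) : Disjoint (cyl J F v) (cyl J F w) := by
  induction v generalizing w with
  | nil => exact absurd List.nil_prefix h
  | cons i v ih =>
    cases w with
    | nil => exact absurd List.nil_prefix h'
    | cons j w =>
      by_cases hij : i = j
      · subst hij
        simp only [List.cons_prefix_cons, true_and] at h h'
        exact ((ih h h').preimage F).mono Set.inter_subset_right Set.inter_subset_right
      · have : Disjoint (J i) (J j) := by
          have hi : i = 0 ∨ i = 1 := by omega
          have hj : j = 0 ∨ j = 1 := by omega
          rcases hi with rfl | rfl <;> rcases hj with rfl | rfl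
          · exact absurd rfl hij
          · exact hF.disjoint
          · exact hF.disjoint.symm
          · exact absurd rfl hij
        exact this.mono Set.inter_subset_left Set.inter_subset_left

theorem IsMarkovExpanding.continuous (hF : IsMarkovExpanding m J F g) : Continuous g := by
  obtain ⟨C, α, hα, h⟩ := hF.holder
  exact h.continuous hα

theorem IsMarkovExpanding.ae_mem_cover (hF : IsMarkovExpanding m J F g) : ∀ᵐ x ∂m, x ∈ J 0 ∪ J 1 :=
  hF.ae_cover

theorem IsMarkovExpanding.disjoint_cons (hF : IsMarkovExpanding m J F g) (w : List (Fin 2)) :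
    Disjoint (cyl J F (0 :: w)) (cyl J F (1 :: w)) :=
  hF.disjoint.mono Set.inter_subset_left Set.inter_subset_left

theorem IsMarkovExpanding.disjoint_append (hF : IsMarkovExpanding m J F g) (w : List (Fin 2)) :
    Disjoint (cyl J F (w ++ [0])) (cyl J F (w ++ [1])) := by
  refine hF.disjoint_cyl ?_ ?_ <;> rw [List.prefix_append_right_inj] <;> decide

/-- Cylinders shrink exponentially. -/
theorem IsMarkovExpanding.exists_dist_le [CompactSpace X] (hF : IsMarkovExpanding m J F g) :
    ∃ c D : ℝ, 0 < c ∧ c < 1 ∧ 0 ≤ D ∧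
      ∀ w, ∀ x ∈ cyl J F w, ∀ y ∈ cyl J F w, dist x y ≤ D * c ^ w.length := by
  obtain ⟨c, hc, h⟩ := hF.expanding
  have hc0 : 0 < c := one_pos.trans hc
  refine ⟨c⁻¹, Metric.diam (Set.univ : Set X), inv_pos.2 hc0, inv_lt_one_of_one_lt₀ hc,
    Metric.diam_nonneg, fun w => ?_⟩
  induction w with
  | nil =>
    intro x _ y _
    simpa using Metric.dist_le_diam_of_mem isCompact_univ.isBounded (Set.mem_univ x)
      (Set.mem_univ y)
  | cons i w ih =>
    intro x hx y hy
    have h1 := h i x hx.1 y hy.1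
    have h2 := ih _ hx.2 _ hy.2
    rw [List.length_cons, pow_succ, ← mul_assoc, ← div_eq_mul_inv, le_div_iff₀ hc0]
    linarith

/-- `log g` oscillates exponentially little on deep cylinders. -/
theorem IsMarkovExpanding.exists_abs_log_sub_le [CompactSpace X] (hF : IsMarkovExpanding m J F g) :
    ∃ r C : ℝ, 0 < r ∧ r < 1 ∧ 0 ≤ C ∧ ∀ w, ∀ x ∈ cyl J F w, ∀ y ∈ cyl J F w,
      |Real.log (g x) - Real.log (g y)| ≤ C * r ^ w.length := by
  obtain ⟨c, D, hc, hc1, hD, h⟩ := hF.exists_dist_le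
  obtain ⟨C, α, hα, hC⟩ := hF.holder
  have hα' : (0 : ℝ) < α := hα
  refine ⟨c ^ (α : ℝ), C * D ^ (α : ℝ), Real.rpow_pos_of_pos hc _,
    Real.rpow_lt_one hc.le hc1 hα', by positivity, fun w x hx y hy => ?_⟩
  refine (abs_log_sub_log_le (hF.one_lt x) (hF.one_lt y)).trans ?_
  have h1 := hC.dist_le x y
  rw [Real.dist_eq] at h1
  refine h1.trans ?_
  have h2 := Real.rpow_le_rpow dist_nonneg (h w x hx y hy) hα'.le
  rw [Real.mul_rpow hD (pow_nonneg hc.le _), ← Real.rpow_natCast, ← Real.rpow_mul hc.le,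
    mul_comm (w.length : ℝ), Real.rpow_mul hc.le, Real.rpow_natCast] at h2
  have := mul_le_mul_of_nonneg_left h2 C.coe_nonneg
  linarith

theorem IsMarkovExpanding.preimage_cyl_ae_eq (hF : IsMarkovExpanding m J F g) (w : List (Fin 2)) :
    F ⁻¹' cyl J F w =ᵐ[m] (cyl J F (0 :: w) ∪ cyl J F (1 :: w) : Set X) := by
  refine eventuallyEq_set.2 ?_
  filter_upwards [hF.ae_mem_cover] with x hx
  simp only [cyl, Set.mem_union, Set.mem_inter_iff] at hx ⊢
  tauto

theorem IsMarkovExpanding.setIntegral_jacobian [IsFiniteMeasure m]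
    (hF : IsMarkovExpanding m J F g) (i : Fin 2) {A : Set X} (hA : MeasurableSet A) :
    ∫ x in J i ∩ F ⁻¹' A, g x ∂m = m.real A := by
  have h := hF.jacobian i (A.indicator 1)
    ((integrable_indicator_iff hA).2 (integrableOn_const (by simp)))
  rw [integral_indicator_one hA] at h
  rw [← h, ← setIntegral_indicator (hF.measurable hA)]
  congr 1
  funext x
  by_cases hx : F x ∈ A <;> simp [Set.indicator, hx]

variable [BorelSpace X]

theorem IsMarkovExpanding.measurableSet_cyl (hF : IsMarkovExpanding m J F g) (w : List (Fin 2)) :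
    MeasurableSet (cyl J F w) := by
  induction w with
  | nil => exact MeasurableSet.univ
  | cons i w ih => exact (hF.isOpen i).measurableSet.inter (hF.measurable ih)

theorem IsMarkovExpanding.cylMass_eq [IsFiniteMeasure m] (hF : IsMarkovExpanding m J F g)
    (i : Fin 2) (w : List (Fin 2)) :
    ∫ x in cyl J F (i :: w), g x ∂m = cylMass m J F w :=
  hF.setIntegral_jacobian i (hF.measurableSet_cyl w)

theorem IsMarkovExpanding.cylMass_pos [IsFiniteMeasure m] (hF : IsMarkovExpanding m J F g)
    (hm : m ≠ 0) (w : List (Fin 2)) :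
    0 < cylMass m J F w := by
  induction w with
  | nil =>
    rw [cylMass, cyl, Measure.real, ENNReal.toReal_pos_iff]
    exact ⟨Measure.measure_univ_pos.2 hm, measure_lt_top _ _⟩
  | cons i w ih =>
    rw [← hF.cylMass_eq i w] at ih
    refine lt_of_le_of_ne measureReal_nonneg fun h0 => ?_
    have : m (cyl J F (i :: w)) = 0 :=
      ((ENNReal.toReal_eq_zero_iff _).1 h0.symm).resolve_right (measure_ne_top _ _)
    rw [Measure.restrict_eq_zero.2 this, integral_zero_measure] at ih
    exact lt_irrefl _ ih

theorem IsMarkovExpanding.nonempty_cyl [IsFiniteMeasure m] (hF : IsMarkovExpanding m J F g)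
    (hm : m ≠ 0) (w : List (Fin 2)) :
    (cyl J F w).Nonempty := by
  by_contra h
  have := hF.cylMass_pos hm w
  rw [cylMass, Set.not_nonempty_iff_eq_empty.1 h, measureReal_empty] at this
  exact lt_irrefl _ this

/-! ### Masses of the Haar functions -/

theorem IsMarkovExpanding.integrable_haar [IsFiniteMeasure m] (hF : IsMarkovExpanding m J F g)
    (b : Option (List (Fin 2))) :
    Integrable (haar m J F b) m := by
  cases b with
  | none => exact integrable_const _
  | some w =>
    have key : ∀ w, Integrable
        (fun x => (cyl J F w).indicator (1 : X → ℝ) x / m.real (cyl J F w)) m :=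
      fun w => ((integrable_indicator_iff (hF.measurableSet_cyl w)).2
        (integrableOn_const (by simp))).div_const _
    exact (key _).sub (key _)

theorem IsMarkovExpanding.cylInt_haar [IsFiniteMeasure m] (hF : IsMarkovExpanding m J F g)
    (hm : m ≠ 0) (b : Option (List (Fin 2))) :
    cylInt m J F (haar m J F b) = haarMass (cylMass m J F) b := by
  cases b with
  | none => exact cylInt_one m J F
  | some u =>
    funext w
    have hint : ∀ v, Integrable
        (fun x => (cyl J F v).indicator (1 : X → ℝ) x / m.real (cyl J F v))
        (m.restrict (cyl J F w)) :=
      fun v => (((integrable_indicator_iff (hF.measurableSet_cyl v)).2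
        (integrableOn_const (by simp))).div_const _).integrableOn
    have hI : ∀ v, ∫ x in cyl J F w, (cyl J F v).indicator (1 : X → ℝ) x / m.real (cyl J F v) ∂m =
        (cylMass m J F v)⁻¹ * m.real (cyl J F v ∩ cyl J F w) := by
      intro v
      rw [integral_div, integral_indicator_one (hF.measurableSet_cyl v), div_eq_inv_mul,
        measureReal_restrict_apply (hF.measurableSet_cyl v), cylMass]
    have h1 : cylInt m J F (haar m J F (some u)) w =
        (cylMass m J F (u ++ [0]))⁻¹ * m.real (cyl J F (u ++ [0]) ∩ cyl J F w) -
          (cylMass m J F (u ++ [1]))⁻¹ * m.real (cyl J F (u ++ [1]) ∩ cyl J F w) := by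
      rw [← hI, ← hI, ← integral_sub (hint _) (hint _)]
      rfl
    rw [h1, haarMass_some]
    by_cases hwu : w <+: u
    · -- both halves of the Haar function are contained in `cyl w` and their integrals cancel
      have e1 : ∀ j : Fin 2, cyl J F (u ++ [j]) ∩ cyl J F w = cyl J F (u ++ [j]) := fun j =>
        Set.inter_eq_left.2 (cyl_subset_of_prefix (hwu.trans (List.prefix_append _ _)))
      have e2 : ∀ j : Fin 2, ¬ u ++ [j] <+: w := fun j h =>
        not_append_singleton_prefix u j (h.trans hwu)
      have e3 : ∀ v, (cylMass m J F v)⁻¹ * m.real (cyl J F v) = 1 := fun v =>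
        inv_mul_cancel₀ (hF.cylMass_pos hm v).ne'
      rw [e1, e1, e3, e3, if_neg (e2 0), if_neg (e2 1)]
      simp
    · have e1 : ∀ j : Fin 2, m.real (cyl J F (u ++ [j]) ∩ cyl J F w) =
          if u ++ [j] <+: w then cylMass m J F w else 0 := by
        intro j
        split_ifs with h
        · rw [Set.inter_eq_right.2 (cyl_subset_of_prefix h), cylMass]
        · have h' : ¬ w <+: u ++ [j] := by
            rw [List.prefix_concat_iff]
            rintro (rfl | h')
            · exact h List.prefix_rfl
            · exact hwu h'
          rw [Set.disjoint_iff_inter_eq_empty.1 (hF.disjoint_cyl h h'), measureReal_empty]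
      rw [e1, e1]

/-! ### Preimages of cylinders -/

variable [CompactSpace X] [IsFiniteMeasure m]

theorem integrable_of_continuous {f : X → ℝ} (hf : Continuous f) : Integrable f m :=
  hf.integrable_of_hasCompactSupport (HasCompactSupport.of_compactSpace f)

namespace IsMarkovExpanding

theorem real_inter_preimage_le (hF : IsMarkovExpanding m J F g) (i : Fin 2) {A : Set X}
    (hA : MeasurableSet A) : m.real (J i ∩ F ⁻¹' A) ≤ m.real A := by
  rw [← hF.setIntegral_jacobian i hA]
  calc m.real (J i ∩ F ⁻¹' A) = ∫ x in J i ∩ F ⁻¹' A, (1 : ℝ) ∂m := by simp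
    _ ≤ _ := setIntegral_mono (integrable_const _).integrableOn
      (integrable_of_continuous hF.continuous).integrableOn fun x => (hF.one_lt x).le

/-- Preimages of null sets are null, since the Jacobian is positive. -/
theorem quasiMeasurePreserving (hF : IsMarkovExpanding m J F g) :
    Measure.QuasiMeasurePreserving F m m := by
  refine ⟨hF.measurable, Measure.AbsolutelyContinuous.mk fun A hA h0 => ?_⟩
  rw [Measure.map_apply hF.measurable hA]
  have key : ∀ i, m (J i ∩ F ⁻¹' A) = 0 := by
    intro i
    have h1 := hF.real_inter_preimage_le i hA
    rw [Measure.real, Measure.real, h0, ENNReal.toReal_zero] at h1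
    exact ((ENNReal.toReal_eq_zero_iff _).1 (le_antisymm h1 ENNReal.toReal_nonneg)).resolve_right
      (measure_ne_top _ _)
  refine measure_mono_null (t := J 0 ∩ F ⁻¹' A ∪ J 1 ∩ F ⁻¹' A ∪ (J 0 ∪ J 1)ᶜ) (fun x hx => ?_)
    (measure_union_null (measure_union_null (key 0) (key 1)) hF.ae_cover)
  by_cases h0 : x ∈ J 0
  · exact Or.inl (Or.inl ⟨h0, hx⟩)
  · by_cases h1 : x ∈ J 1
    · exact Or.inl (Or.inr ⟨h1, hx⟩)
    · exact Or.inr (by simp [h0, h1])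

/-- Almost every point has a complete itinerary. -/
theorem ae_itinerary (hF : IsMarkovExpanding m J F g) : ∀ᵐ x ∂m, ∀ k, F^[k] x ∈ J 0 ∪ J 1 :=
  ae_all_iff.2 fun k => (hF.quasiMeasurePreserving.iterate k).ae hF.ae_mem_cover

theorem cyl_ae_eq (hF : IsMarkovExpanding m J F g) (w : List (Fin 2)) :
    cyl J F w =ᵐ[m] (cyl J F (w ++ [0]) ∪ cyl J F (w ++ [1]) : Set X) := by
  refine eventuallyEq_set.2 ?_
  filter_upwards [hF.ae_itinerary] with x hx
  have := hx w.length
  simp only [cyl_append, cyl, Set.mem_union, Set.mem_inter_iff, Set.preimage_univ,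
    Set.mem_preimage, Set.mem_univ] at this ⊢
  tauto

theorem isAdditive_cylInt (hF : IsMarkovExpanding m J F g) {f : X → ℝ} (hf : Integrable f m) :
    IsAdditive (cylInt m J F f) := by
  intro w
  rw [cylInt, cylInt, cylInt, setIntegral_congr_set (hF.cyl_ae_eq w),
    setIntegral_union (hF.disjoint_append w) (hF.measurableSet_cyl _) hf.integrableOn
      hf.integrableOn]

/-- `push` computes integrals over preimages of cylinders. -/
theorem setIntegral_preimage_cyl (hF : IsMarkovExpanding m J F g) {f : X → ℝ} (hf : Integrable f m)
    (k : ℕ) (w : List (Fin 2)) :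
    ∫ x in F^[k] ⁻¹' cyl J F w, f x ∂m = (push ^ k) (cylInt m J F f) w := by
  induction k generalizing w with
  | zero => simp [cylInt]
  | succ k ih =>
    have hq := hF.quasiMeasurePreserving.iterate k
    have hmeas := hF.measurable.iterate k
    rw [push_pow_succ', push_apply, ← ih, ← ih, ← setIntegral_union
      ((hF.disjoint_cons w).preimage _) (hmeas (hF.measurableSet_cyl _)) hf.integrableOn
      hf.integrableOn, Function.iterate_succ', Set.preimage_comp, ← Set.preimage_union]
    exact setIntegral_congr_set (hq.preimage_ae_eq (hF.preimage_cyl_ae_eq w))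

theorem isAdditive_cylMass (hF : IsMarkovExpanding m J F g) : IsAdditive (cylMass m J F) := by
  rw [← cylInt_one]
  exact hF.isAdditive_cylInt (integrable_const _)

/-! ### Haar coefficients of compositions -/

theorem integral_haar_iterate_mul (hF : IsMarkovExpanding m J F g) {f : X → ℝ}
    (hf : Integrable f m) (k : ℕ) (a : Option (List (Fin 2))) :
    ∫ x, haar m J F a (F^[k] x) * f x ∂m =
      haarPair (cylMass m J F) a ((push ^ k) (cylInt m J F f)) := by
  have hmeas := hF.measurable.iterate k
  cases a with
  | none =>
    rw [haarPair_none, ← hF.setIntegral_preimage_cyl hf]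
    simp [haar, cyl]
  | some w =>
    rw [haarPair_some, ← hF.setIntegral_preimage_cyl hf, ← hF.setIntegral_preimage_cyl hf,
      ← integral_indicator (hmeas (hF.measurableSet_cyl _)),
      ← integral_indicator (hmeas (hF.measurableSet_cyl _)), ← integral_const_mul,
      ← integral_const_mul, ← integral_sub]
    · congr 1
      funext x
      have key : ∀ w, (cyl J F w).indicator (1 : X → ℝ) (F^[k] x) / m.real (cyl J F w) * f x =
          (cylMass m J F w)⁻¹ * (F^[k] ⁻¹' cyl J F w).indicator f x := by
        intro w
        by_cases hx : F^[k] x ∈ cyl J F w <;> simp [Set.indicator, hx, cylMass]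
      rw [haar, sub_mul, key, key]
    · exact (hf.indicator (hmeas (hF.measurableSet_cyl _))).const_mul _
    · exact (hf.indicator (hmeas (hF.measurableSet_cyl _))).const_mul _

theorem integral_haar_mul (hF : IsMarkovExpanding m J F g) {f : X → ℝ}
    (hf : Integrable f m) (a : Option (List (Fin 2))) :
    ∫ x, haar m J F a x * f x ∂m = haarPair (cylMass m J F) a (cylInt m J F f) :=
  hF.integral_haar_iterate_mul hf 0 a

theorem integral_haar_sq (hF : IsMarkovExpanding m J F g) (hm : m ≠ 0)
    (b : Option (List (Fin 2))) : ∫ x, haar m J F b x ^ 2 ∂m = haarSq (cylMass m J F) b := by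
  have h1 := hF.integral_haar_mul (hF.integrable_haar b) b
  simp only [← pow_two] at h1
  rw [h1, hF.cylInt_haar hm]
  cases b with
  | none => rfl
  | some w =>
    rw [haarPair_some, haarMass_self_zero (hF.cylMass_pos hm),
      haarMass_self_one (hF.cylMass_pos hm), haarSq]
    ring

theorem haarCoeff_eq (hF : IsMarkovExpanding m J F g) (hm : m ≠ 0) {f : X → ℝ}
    (hf : Integrable f m) (b : Option (List (Fin 2))) :
    haarCoeff m J F f b =
      haarPair (cylMass m J F) b (cylInt m J F f) / haarSq (cylMass m J F) b := by
  rw [haarCoeff, hF.integral_haar_sq hm, ← hF.integral_haar_mul hf]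
  simp only [mul_comm]

theorem haarCoeff_haar_iterate (hF : IsMarkovExpanding m J F g) (hm : m ≠ 0) (k : ℕ)
    (b a : Option (List (Fin 2))) :
    haarCoeff m J F (fun x => haar m J F a (F^[k] x)) b = kernel (cylMass m J F) k b a := by
  rw [haarCoeff, hF.integral_haar_sq hm, hF.integral_haar_iterate_mul (hF.integrable_haar b),
    hF.cylInt_haar hm, kernel]

/-! ### Distortion -/

/-- The oscillation of `log g` controls the distortion. -/
theorem distortion_of_ae (hF : IsMarkovExpanding m J F g) {i : Fin 2} {w : List (Fin 2)} {δ L : ℝ}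
    (h : ∀ᵐ x ∂m, x ∈ cyl J F (i :: w) → |Real.log (g x) - L| ≤ δ) (u v : List (Fin 2)) :
    cylMass m J F (i :: (w ++ u)) * cylMass m J F (w ++ v) ≤
      Real.exp (2 * δ) * (cylMass m J F (i :: (w ++ v)) * cylMass m J F (w ++ u)) := by
  have hg := integrable_of_continuous (m := m) hF.continuous
  have hbd : ∀ u, ∀ᵐ x ∂m.restrict (cyl J F (i :: (w ++ u))),
      Real.exp (L - δ) ≤ g x ∧ g x ≤ Real.exp (L + δ) := by
    intro u
    rw [ae_restrict_iff' (hF.measurableSet_cyl _)]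
    filter_upwards [h] with x hx hxu
    have h1 := abs_le.1 (hx (cyl_subset_of_prefix (List.prefix_append (i :: w) u) hxu))
    have hgx : 0 < g x := one_pos.trans (hF.one_lt x)
    rw [← Real.le_log_iff_exp_le hgx, ← Real.log_le_iff_le_exp hgx]
    exact ⟨by linarith, by linarith⟩
  have hconst : ∀ (c : ℝ) (s : Set X), ∫ _ in s, c ∂m = c * m.real s := by
    intro c s; simp [mul_comm]
  have hlow : ∀ u, Real.exp (L - δ) * cylMass m J F (i :: (w ++ u)) ≤ cylMass m J F (w ++ u) := by
    intro u
    rw [← hF.cylMass_eq i (w ++ u), cylMass, ← hconst]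
    exact integral_mono_ae (integrable_const _) hg.integrableOn ((hbd u).mono fun x hx => hx.1)
  have hup : ∀ u, cylMass m J F (w ++ u) ≤ Real.exp (L + δ) * cylMass m J F (i :: (w ++ u)) := by
    intro u
    rw [← hF.cylMass_eq i (w ++ u), cylMass, ← hconst]
    exact integral_mono_ae hg.integrableOn (integrable_const _) ((hbd u).mono fun x hx => hx.2)
  have e1 : Real.exp (L + δ) = Real.exp (2 * δ) * Real.exp (L - δ) := by
    rw [← Real.exp_add]; ring_nf
  have n1 : 0 ≤ cylMass m J F (i :: (w ++ u)) := measureReal_nonneg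
  have n2 : 0 ≤ cylMass m J F (i :: (w ++ v)) := measureReal_nonneg
  calc _ ≤ cylMass m J F (i :: (w ++ u)) *
        (Real.exp (L + δ) * cylMass m J F (i :: (w ++ v))) := mul_le_mul_of_nonneg_left (hup v) n1
    _ = Real.exp (2 * δ) * (cylMass m J F (i :: (w ++ v)) *
        (Real.exp (L - δ) * cylMass m J F (i :: (w ++ u)))) := by rw [e1]; ring
    _ ≤ _ := by
        refine mul_le_mul_of_nonneg_left ?_ (Real.exp_pos _).le
        exact mul_le_mul_of_nonneg_left (hlow u) n2

theorem exists_cylMass_child_ge (hF : IsMarkovExpanding m J F g) (hm : m ≠ 0) :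
    ∃ κ : ℝ, 0 < κ ∧ ∀ w j, κ * cylMass m J F w ≤ cylMass m J F (w ++ [j]) := by
  obtain ⟨r, C, hr, hr1, hC, h⟩ := hF.exists_abs_log_sub_le
  have h1 := distortion_iterate (hF.cylMass_pos hm) (t := fun w => 2 * (C * r ^ (w.length + 1)))
    hr.le hr1 (fun w => by positivity)
    (fun i w => by
      rw [List.length_cons, pow_succ r (w.length + 1)]
      exact le_of_eq (by ring))
    (fun i w u v => by
      obtain ⟨y, hy⟩ := hF.nonempty_cyl hm (i :: w)
      exact hF.distortion_of_ae (L := Real.log (g y))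
        (Eventually.of_forall fun x hx => h (i :: w) x hx y hy) u v)
  exact exists_child_ge (hF.cylMass_pos hm) fun x u v => by simpa using h1 x [] u v

theorem exists_contraction (hF : IsMarkovExpanding m J F g) (hm : m ≠ 0) :
    ∃ θ : ℝ, 0 < θ ∧ θ < 1 ∧ ∀ i w, cylMass m J F (i :: w) ≤ θ * cylMass m J F w := by
  have hne : (Set.univ : Set X).Nonempty := hF.nonempty_cyl hm []
  obtain ⟨x₀, -, hx₀⟩ := isCompact_univ.exists_isMinOn hne hF.continuous.continuousOn
  have h0 : 0 < g x₀ := one_pos.trans (hF.one_lt x₀)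
  refine ⟨(g x₀)⁻¹, inv_pos.2 h0, inv_lt_one_of_one_lt₀ (hF.one_lt x₀), fun i w => ?_⟩
  rw [le_inv_mul_iff₀ h0, ← hF.cylMass_eq i w]
  have e1 : g x₀ * cylMass m J F (i :: w) = ∫ _ in cyl J F (i :: w), g x₀ ∂m := by
    simp [cylMass, mul_comm]
  rw [e1]
  exact setIntegral_mono (integrable_const _).integrableOn
    (integrable_of_continuous hF.continuous).integrableOn fun x => hx₀ (Set.mem_univ x)

/-- If `log g ∈ B^γ_{∞,∞}`, the oscillation of `log g` on a cylinder is controlled by the power `γ`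
of its measure: sum the Haar coefficients over the descendants of the cylinder. -/
theorem exists_abs_log_sub_average_le (hF : IsMarkovExpanding m J F g) (hm : m ≠ 0) {γ : ℝ}
    (hγ : 0 < γ) (hg : MemBesovInf m J F γ (haarCoeff m J F (fun x => Real.log (g x)))) :
    ∃ C : ℝ, 0 ≤ C ∧ ∀ w, ∃ L : ℝ, ∀ᵐ x ∂m, x ∈ cyl J F w →
      |Real.log (g x) - L| ≤ C * cylMass m J F w ^ γ := by
  obtain ⟨C₀, hC₀⟩ := hg
  obtain ⟨r, C₁, hr, hr1, hC₁, hosc⟩ := hF.exists_abs_log_sub_le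
  obtain ⟨κ, hκ, hchild⟩ := hF.exists_cylMass_child_ge hm
  set p := cylMass m J F with hp
  have hpos : ∀ w, 0 < p w := hF.cylMass_pos hm
  have hadd : IsAdditive p := hF.isAdditive_cylMass
  set ℓ : X → ℝ := fun x => Real.log (g x) with hℓ
  have hℓc : Continuous ℓ :=
    hF.continuous.log fun x => (one_pos.trans (hF.one_lt x)).ne'
  have hℓi : Integrable ℓ m := integrable_of_continuous hℓc
  set G : List (Fin 2) → ℝ := fun w => (p w)⁻¹ * cylInt m J F ℓ w with hG
  have hκ1 : κ < 1 := by
    have h1 := hchild [] 0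
    have h2 := hadd []
    have h3 := hpos ([] ++ [1])
    have h4 := hpos []
    by_contra hge
    nlinarith
  have hp_child : ∀ w j, p (w ++ [j]) ≤ (1 - κ) * p w := by
    intro w j
    have h1 := hadd w
    have hj : j = 0 ∨ j = 1 := by omega
    rcases hj with rfl | rfl
    · linarith [hchild w 1]
    · linarith [hchild w 0]
  set ρ := (1 - κ) ^ γ with hρ
  have hρ0 : 0 ≤ ρ := Real.rpow_nonneg (by linarith) _
  have hρ1 : ρ < 1 := Real.rpow_lt_one (by linarith) (by linarith) hγ
  have hp_desc : ∀ w u, p (w ++ u) ^ γ ≤ ρ ^ u.length * p w ^ γ := by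
    intro w u
    induction u using List.reverseRecOn with
    | nil => simp
    | append_singleton u j ih =>
      have h1 := Real.rpow_le_rpow (hpos _).le (hp_child (w ++ u) j) hγ.le
      rw [Real.mul_rpow (by linarith) (hpos _).le, List.append_assoc] at h1
      refine h1.trans ?_
      rw [List.length_append, List.length_singleton, pow_succ', mul_assoc]
      exact mul_le_mul_of_nonneg_left ih hρ0
  have hC₀0 : 0 ≤ C₀ := le_trans (by positivity) (hC₀ [])
  set C₂ := C₀ * (2 / κ) with hC₂
  have hC₂0 : 0 ≤ C₂ := by positivity
  -- the averages over the two children differ by a Haar coefficient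
  have hdiff : ∀ w, |G (w ++ [0]) - G (w ++ [1])| ≤ C₂ * p w ^ γ := by
    intro w
    have h1 := hC₀ w
    have hw := hpos w
    have hsq := haarSq_pos hpos (some w)
    have e0 : haarPair p (some w) (cylInt m J F ℓ) = G (w ++ [0]) - G (w ++ [1]) := rfl
    rw [hF.haarCoeff_eq hm hℓi, e0, Real.norm_eq_abs, abs_div, abs_of_pos hsq,
      Real.rpow_neg measureReal_nonneg, ← div_eq_mul_inv,
      div_le_iff₀ (Real.rpow_pos_of_pos (show 0 < m.real (cyl J F w) from hw) _),
      div_le_iff₀ hsq] at h1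
    refine h1.trans ?_
    have e2 : haarSq p (some w) ≤ 2 / κ / p w := by
      have a0 := inv_anti₀ (mul_pos hκ hw) (hchild w 0)
      have a1 := inv_anti₀ (mul_pos hκ hw) (hchild w 1)
      rw [haarSq]
      refine (add_le_add a0 a1).trans (le_of_eq ?_)
      field_simp
      ring
    have e3 : m.real (cyl J F w) ^ (γ + 1) = p w ^ γ * p w := Real.rpow_add_one hw.ne' γ
    have hwγ := Real.rpow_nonneg hw.le γ
    rw [e3]
    calc C₀ * (p w ^ γ * p w) * haarSq p (some w) ≤ C₀ * (p w ^ γ * p w) * (2 / κ / p w) :=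
          mul_le_mul_of_nonneg_left e2 (by positivity)
      _ = _ := by rw [hC₂]; field_simp
  have hstep : ∀ w j, |G (w ++ [j]) - G w| ≤ C₂ * p w ^ γ := by
    intro w j
    refine le_trans ?_ (hdiff w)
    have hw := hpos w
    have h0 := hpos (w ++ [0])
    have h1 := hpos (w ++ [1])
    have ha := hadd w
    have hc := hF.isAdditive_cylInt hℓi w
    have e0 : cylInt m J F ℓ (w ++ [0]) = p (w ++ [0]) * G (w ++ [0]) := by
      rw [hG]; field_simp
    have e1 : cylInt m J F ℓ (w ++ [1]) = p (w ++ [1]) * G (w ++ [1]) := by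
      rw [hG]; field_simp
    have e2 : cylInt m J F ℓ w = p w * G w := by
      rw [hG]; field_simp
    rw [e0, e1, e2] at hc
    have hj : j = 0 ∨ j = 1 := by omega
    rcases hj with rfl | rfl
    · have : G (w ++ [0]) - G w = p (w ++ [1]) / p w * (G (w ++ [0]) - G (w ++ [1])) := by
        field_simp
        rw [← ha] at hc ⊢
        linarith
      rw [this, abs_mul, abs_of_pos (div_pos h1 hw)]
      exact mul_le_of_le_one_left (abs_nonneg _) ((div_le_one hw).2 (by linarith))
    · have : G (w ++ [1]) - G w = -(p (w ++ [0]) / p w * (G (w ++ [0]) - G (w ++ [1]))) := by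
        field_simp
        rw [← ha] at hc ⊢
        linarith
      rw [this, abs_neg, abs_mul, abs_of_pos (div_pos h0 hw)]
      exact mul_le_of_le_one_left (abs_nonneg _) ((div_le_one hw).2 (by linarith))
  have hdesc : ∀ w u, |G (w ++ u) - G w| ≤
      C₂ * p w ^ γ * ∑ k ∈ Finset.range u.length, ρ ^ k := by
    intro w u
    induction u using List.reverseRecOn with
    | nil => simp
    | append_singleton u j ih =>
      have h1 := hstep (w ++ u) j
      have h2 := mul_le_mul_of_nonneg_left (hp_desc w u) hC₂0
      rw [← List.append_assoc, List.length_append, List.length_singleton, Finset.sum_range_succ]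
      have h3 := abs_sub_le (G (w ++ u ++ [j])) (G (w ++ u)) (G w)
      linarith
  have havg : ∀ w, ∀ x ∈ cyl J F w, |ℓ x - G w| ≤ C₁ * r ^ w.length := by
    intro w x hx
    have hw := hpos w
    have e1 : ℓ x - G w = (p w)⁻¹ * ∫ y in cyl J F w, (ℓ x - ℓ y) ∂m := by
      rw [integral_sub (integrable_const _) hℓi.integrableOn, setIntegral_const, smul_eq_mul,
        mul_sub, ← mul_assoc]
      have : (p w)⁻¹ * m.real (cyl J F w) = 1 := inv_mul_cancel₀ hw.ne'
      rw [this, one_mul]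
      rfl
    have e2 : ‖∫ y in cyl J F w, (ℓ x - ℓ y) ∂m‖ ≤ C₁ * r ^ w.length * m.real (cyl J F w) :=
      norm_setIntegral_le_of_norm_le_const (measure_lt_top _ _) fun y hy => hosc w x hx y hy
    rw [e1, abs_mul, abs_of_pos (inv_pos.2 hw), inv_mul_le_iff₀ hw, mul_comm]
    exact e2
  refine ⟨C₂ * (1 - ρ)⁻¹, mul_nonneg hC₂0 (inv_nonneg.2 (by linarith)), fun w => ⟨G w, ?_⟩⟩
  filter_upwards [hF.ae_itinerary] with x hx hxw
  have hlim : Tendsto (fun n : ℕ => C₁ * r ^ (w.length + n) + C₂ * (1 - ρ)⁻¹ * p w ^ γ) atTop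
      (𝓝 (C₂ * (1 - ρ)⁻¹ * p w ^ γ)) := by
    have h1 := ((tendsto_pow_atTop_nhds_zero_of_lt_one hr.le hr1).const_mul
      (C₁ * r ^ w.length)).add_const (C₂ * (1 - ρ)⁻¹ * p w ^ γ)
    rw [mul_zero, zero_add] at h1
    refine h1.congr fun n => ?_
    rw [pow_add]; ring
  refine ge_of_tendsto' hlim fun n => ?_
  obtain ⟨v, hv, hxv⟩ := exists_mem_cyl_append hx hxw n
  have h1 := havg (w ++ v) x hxv
  have h2 := hdesc w v
  have h3 : ∑ k ∈ Finset.range v.length, ρ ^ k ≤ (1 - ρ)⁻¹ := by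
    rw [← tsum_geometric_of_lt_one hρ0 hρ1]
    exact (summable_geometric_of_lt_one hρ0 hρ1).sum_le_tsum _ fun j _ => pow_nonneg hρ0 j
  have h4 := mul_le_mul_of_nonneg_left h3
    (mul_nonneg hC₂0 (Real.rpow_nonneg (hpos w).le γ))
  have h5 := abs_sub_le (ℓ x) (G (w ++ v)) (G w)
  rw [List.length_append, hv] at h1
  linarith

/-- The measures of the cylinders are Gibbs weights. -/
theorem exists_isGibbs (hF : IsMarkovExpanding m J F g) (hm : m ≠ 0) {γ : ℝ}
    (hγ : 0 < γ) (hg : MemBesovInf m J F γ (haarCoeff m J F (fun x => Real.log (g x)))) :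
    ∃ θ B, IsGibbs (cylMass m J F) θ B γ := by
  obtain ⟨C, hC, h⟩ := hF.exists_abs_log_sub_average_le hm hγ hg
  obtain ⟨θ, hθ, hθ1, hcontr⟩ := hF.exists_contraction hm
  refine ⟨θ, 2 * C, hF.cylMass_pos hm, hF.isAdditive_cylMass, hθ, hθ1, by positivity, hγ, hcontr,
    fun i w u v => ?_⟩
  obtain ⟨L, hL⟩ := h (i :: w)
  refine (hF.distortion_of_ae hL u v).trans (mul_le_mul_of_nonneg_right (Real.exp_le_exp.2 ?_)
    (mul_nonneg measureReal_nonneg measureReal_nonneg))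
  have hw := hF.cylMass_pos hm w
  have h1 : cylMass m J F (i :: w) ≤ cylMass m J F w :=
    (hcontr i w).trans (mul_le_of_le_one_left hw.le hθ1.le)
  have h2 := Real.rpow_le_rpow (hF.cylMass_pos hm (i :: w)).le h1 hγ.le
  have := mul_le_mul_of_nonneg_left h2 (by positivity : 0 ≤ 2 * C)
  linarith

end IsMarkovExpanding

end

/-! ### The absolutely continuous invariant probability -/

section

variable {p μ : List (Fin 2) → ℝ} {θ B γ : ℝ}

theorem push_pow_tendsto (h : IsGibbs p θ B γ) (hμ : IsNormal p γ (coneConst θ B γ) μ)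
    (hinv : push μ = μ) {ν : List (Fin 2) → ℝ} (hν : IsNormal p γ (coneConst θ B γ) ν)
    (w : List (Fin 2)) : Tendsto (fun n => (push ^ n) ν w) atTop (𝓝 (μ w)) := by
  set M := Real.exp (coneConst θ B γ * p [] ^ γ) / p [] * p w with hM
  have hq0 : 0 ≤ 1 - gap p θ B γ := sub_nonneg.2 (gap_lt_one h).le
  rw [tendsto_iff_dist_tendsto_zero]
  refine squeeze_zero (fun _ => dist_nonneg) (g := fun n => (1 - gap p θ B γ) ^ n * M)
    (fun n => ?_) ?_
  · obtain ⟨η, η', hη, hη', he⟩ := exists_push_pow_sub_eq h n hν hμ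
    have he' := congrFun he w
    rw [push_pow_eq_self hinv] at he'
    simp only [Pi.sub_apply, Pi.smul_apply, smul_eq_mul] at he'
    rw [Real.dist_eq, he', abs_mul, abs_of_nonneg (pow_nonneg hq0 n)]
    refine mul_le_mul_of_nonneg_left ?_ (pow_nonneg hq0 n)
    have := hη.le h w
    have := hη'.le h w
    have := hη.nonneg w
    have := hη'.nonneg w
    exact abs_le.2 ⟨by linarith, by linarith⟩
  · simpa using (tendsto_pow_atTop_nhds_zero_of_lt_one hq0
      (by linarith [gap_pos h])).mul_const M

/-- The densities on successive cylinders of an itinerary form a Cauchy sequence. -/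
theorem IsNormal.exists_abs_density_sub_le (h : IsGibbs p θ B γ)
    (hμ : IsNormal p γ (coneConst θ B γ) μ) :
    ∃ C : ℝ, ∀ w j, |μ (w ++ [j]) / p (w ++ [j]) - μ w / p w| ≤ C * (θ ^ γ) ^ w.length := by
  obtain ⟨C, hC, hbound⟩ := exists_abs_haarPair_le h _ (coneConst_pos h).le
  set M := Real.exp (coneConst θ B γ * p [] ^ γ) / p [] with hM
  refine ⟨C * M * p [] ^ γ, fun w j => ?_⟩
  have hw := h.pos w
  have h0 := h.pos (w ++ [0])
  have h1 := h.pos (w ++ [1])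
  have ha := h.add w
  have hb := hμ.add w
  have hpair : |haarPair p (some w) μ| ≤ C * M * p [] ^ γ * (θ ^ γ) ^ w.length := by
    refine (hbound μ hμ.nonneg hμ.regular w).trans ?_
    have e1 : p w ^ γ ≤ (θ ^ γ) ^ w.length * p [] ^ γ := by
      simpa using h.rpow_append_le h.gamma_pos w []
    have e2 : μ w / p w ≤ M := (div_le_iff₀ hw).2 (hμ.le h w)
    have e3 : 0 ≤ μ w / p w := div_nonneg (hμ.nonneg w) hw.le
    calc C * (μ w / p w) * p w ^ γ ≤ C * M * ((θ ^ γ) ^ w.length * p [] ^ γ) :=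
          mul_le_mul (mul_le_mul_of_nonneg_left e2 hC) e1 (Real.rpow_nonneg hw.le _)
            (mul_nonneg hC (e3.trans e2))
      _ = _ := by ring
  refine le_trans ?_ hpair
  have hj : j = 0 ∨ j = 1 := by omega
  rcases hj with rfl | rfl
  · have : μ (w ++ [0]) / p (w ++ [0]) - μ w / p w =
        p (w ++ [1]) / p w * haarPair p (some w) μ := by
      rw [haarPair_some]
      field_simp
      rw [← ha, ← hb]; ring
    rw [this, abs_mul, abs_of_pos (div_pos h1 hw)]
    exact mul_le_of_le_one_left (abs_nonneg _) ((div_le_one hw).2 (by linarith))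
  · have : μ (w ++ [1]) / p (w ++ [1]) - μ w / p w =
        -(p (w ++ [0]) / p w * haarPair p (some w) μ) := by
      rw [haarPair_some]
      field_simp
      rw [← ha, ← hb]; ring
    rw [this, abs_neg, abs_mul, abs_of_pos (div_pos h0 hw)]
    exact mul_le_of_le_one_left (abs_nonneg _) ((div_le_one hw).2 (by linarith))

theorem IsAdditive.eq_of_words {ν ν' : List (Fin 2) → ℝ} (hν : IsAdditive ν) (hν' : IsAdditive ν')
    (k : ℕ) (h : ∀ v : List (Fin 2), v.length = k → ν v = ν' v) {w : List (Fin 2)}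
    (hw : w.length ≤ k) : ν w = ν' w := by
  obtain ⟨n, rfl⟩ := Nat.exists_eq_add_of_le hw
  induction n generalizing w with
  | zero => exact h w rfl
  | succ n ih =>
    have key : ∀ j : Fin 2, ν (w ++ [j]) = ν' (w ++ [j]) := by
      intro j
      have hl : (w ++ [j]).length = w.length + 1 := by simp
      exact ih (fun v hv => h v (by omega)) (by omega)
    rw [← hν w, ← hν' w, key, key]

end

section

variable {X : Type*} [MetricSpace X] [MeasurableSpace X] [BorelSpace X] [CompactSpace X]
  {m : Measure X} [IsFiniteMeasure m] {J : Fin 2 → Set X} {F : X → X} {g : X → ℝ}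

namespace IsMarkovExpanding

/-- Finite measures which are absolutely continuous with respect to `m` are determined by their
values on cylinders, since every open set is, up to a null set, a union of cylinders. -/
theorem ext_of_cyl (hF : IsMarkovExpanding m J F g) {ν ν' : Measure X} [IsFiniteMeasure ν]
    (hν : ν ≪ m) (hν' : ν' ≪ m) (h : ∀ w, ν (cyl J F w) = ν' (cyl J F w)) : ν = ν' := by
  -- the points with a complete itinerary
  set Ω : Set X := {x | ∀ k, F^[k] x ∈ J 0 ∪ J 1} with hΩ
  have hΩm : MeasurableSet Ω := by
    have : Ω = ⋂ k, F^[k] ⁻¹' (J 0 ∪ J 1) := by ext x; simp [hΩ]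
    rw [this]
    exact MeasurableSet.iInter fun k => (hF.measurable.iterate k)
      ((hF.isOpen 0).union (hF.isOpen 1)).measurableSet
  have hΩae : ∀ᵐ x ∂m, x ∈ Ω := hF.ae_itinerary
  set 𝒞 : Set (Set X) :=
    {A | MeasurableSet A ∧ (A ∩ Ω = ∅ ∨ ∃ w, A ∩ Ω = cyl J F w ∩ Ω)} with h𝒞
  have hmeas : ∀ {κ : Measure X}, κ ≪ m → ∀ A : Set X, κ A = κ (A ∩ Ω) := by
    intro κ hκ A
    refine measure_congr (eventuallyEq_set.2 ?_)
    filter_upwards [hκ.ae_le hΩae] with x hx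
    simp [hx]
  refine ext_of_generate_finite 𝒞 ?_ ?_ ?_ (h [])
  · refine le_antisymm ?_ (MeasurableSpace.generateFrom_le fun A hA => hA.1)
    rw [BorelSpace.measurable_eq (α := X)]
    refine MeasurableSpace.generateFrom_le fun U hU => ?_
    have hU' : U = (U ∩ Ωᶜ) ∪ ⋃ w : {w // cyl J F w ⊆ U}, cyl J F w.1 ∩ Ω := by
      ext x
      constructor
      · intro hx
        by_cases hxΩ : x ∈ Ω
        · right
          obtain ⟨c, D, hc, hc1, hD, hdist⟩ := hF.exists_dist_le
          obtain ⟨ε, hε, hball⟩ := Metric.isOpen_iff.1 hU x hx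
          have hlim : Tendsto (fun n : ℕ => D * c ^ n) atTop (𝓝 0) := by
            simpa using (tendsto_pow_atTop_nhds_zero_of_lt_one hc.le hc1).const_mul D
          obtain ⟨n, hn⟩ := (hlim.eventually (gt_mem_nhds hε)).exists
          obtain ⟨v, hv, hxv⟩ := exists_mem_cyl hxΩ n
          refine Set.mem_iUnion.2 ⟨⟨v, fun y hy => hball ?_⟩, hxv, hxΩ⟩
          have := hdist v y hy x hxv
          rw [hv] at this
          exact this.trans_lt hn
        · exact Or.inl ⟨hx, hxΩ⟩
      · rintro (hx | hx)
        · exact hx.1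
        · obtain ⟨w, hw⟩ := Set.mem_iUnion.1 hx
          exact w.2 hw.1
    rw [hU']
    refine MeasurableSet.union (MeasurableSpace.measurableSet_generateFrom ⟨?_, Or.inl ?_⟩)
      (MeasurableSet.iUnion fun w => MeasurableSpace.measurableSet_generateFrom
        ⟨(hF.measurableSet_cyl _).inter hΩm, Or.inr ⟨w.1, ?_⟩⟩)
    · exact hU.measurableSet.inter hΩm.compl
    · rw [Set.inter_assoc, Set.compl_inter_self, Set.inter_empty]
    · rw [Set.inter_assoc, Set.inter_self]
  · rintro A ⟨hA, hA'⟩ A₂ ⟨hA₂, hA₂'⟩ -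
    refine ⟨hA.inter hA₂, ?_⟩
    rw [Set.inter_inter_distrib_right]
    rcases hA' with hA' | ⟨v, hv⟩
    · exact Or.inl (by rw [hA', Set.empty_inter])
    rcases hA₂' with hA₂' | ⟨w, hw⟩
    · exact Or.inl (by rw [hA₂', Set.inter_empty])
    rw [hv, hw, ← Set.inter_inter_distrib_right]
    by_cases h1 : v <+: w
    · exact Or.inr ⟨w, by rw [Set.inter_eq_right.2 (cyl_subset_of_prefix h1)]⟩
    by_cases h2 : w <+: v
    · exact Or.inr ⟨v, by rw [Set.inter_eq_left.2 (cyl_subset_of_prefix h2)]⟩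
    · exact Or.inl (by
        rw [Set.disjoint_iff_inter_eq_empty.1 (hF.disjoint_cyl h1 h2), Set.empty_inter])
  · rintro A ⟨hA, hA' | ⟨w, hw⟩⟩
    · rw [hmeas hν, hmeas hν', hA', measure_empty, measure_empty]
    · rw [hmeas hν, hmeas hν', hw, ← hmeas hν, ← hmeas hν', h]

/-- The push-forwards of the restriction of `m` to a cylinder equidistribute. -/
theorem tendsto_real_inter (hF : IsMarkovExpanding m J F g) {θ B γ : ℝ}
    (h : IsGibbs (cylMass m J F) θ B γ) {μ : List (Fin 2) → ℝ}
    (hμ : IsNormal (cylMass m J F) γ (coneConst θ B γ) μ) (hinv : push μ = μ)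
    (v w : List (Fin 2)) :
    Tendsto (fun n => m.real (cyl J F v ∩ F^[n] ⁻¹' cyl J F w)) atTop
      (𝓝 (cylMass m J F v * μ w)) := by
  set p := cylMass m J F with hp
  set f : X → ℝ := (cyl J F v).indicator 1 with hf
  have hfi : Integrable f m :=
    (integrable_indicator_iff (hF.measurableSet_cyl v)).2 (integrableOn_const (by simp))
  have hreal : ∀ (n : ℕ) (w : List (Fin 2)),
      (push ^ n) (cylInt m J F f) w = m.real (cyl J F v ∩ F^[n] ⁻¹' cyl J F w) := by
    intro n w
    rw [← hF.setIntegral_preimage_cyl hfi, hf, integral_indicator_one (hF.measurableSet_cyl v),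
      measureReal_restrict_apply (hF.measurableSet_cyl v)]
  have hbr : (push ^ v.length) (cylInt m J F f) = p v • fun u => p (v ++ u) / p v := by
    funext u
    rw [hreal, ← cyl_append, Pi.smul_apply, smul_eq_mul, mul_div_cancel₀ _ (h.pos v).ne']
    rfl
  refine (tendsto_add_atTop_iff_nat v.length).1 ?_
  refine ((push_pow_tendsto h hμ hinv (isNormal_branch h v) w).const_mul (p v)).congr
    fun n => ?_
  rw [← hreal, pow_add, Module.End.mul_apply, hbr, map_smul]
  rfl

/-- The masses given to cylinders by an absolutely continuous invariant probability: its density is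
approximated in `L¹` by combinations of indicators of cylinders, for which the push-forwards
converge. -/
theorem cylInt_density (hF : IsMarkovExpanding m J F g) (hm : m ≠ 0) {θ B γ : ℝ}
    (h : IsGibbs (cylMass m J F) θ B γ) {μ : List (Fin 2) → ℝ}
    (hμ : IsNormal (cylMass m J F) γ (coneConst θ B γ) μ) (hinv : push μ = μ) {ν : Measure X}
    (hν : IsACIP m F ν) : cylInt m J F (density m ν) = μ := by
  have := hν.prob
  set p := cylMass m J F with hp
  have hdi : Integrable (density m ν) m := Measure.integrable_toReal_rnDeriv
  have hset : ∀ s, ∫ x in s, density m ν x ∂m = ν.real s := fun s =>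
    Measure.setIntegral_toReal_rnDeriv hν.ac s
  funext w
  have hinvn : ∀ n, ∫ x in F^[n] ⁻¹' cyl J F w, density m ν x ∂m =
      cylInt m J F (density m ν) w := by
    intro n
    rw [cylInt, hset, hset, Measure.real, Measure.real,
      (hν.invariant.iterate n).measure_preimage (hF.measurableSet_cyl w).nullMeasurableSet]
  -- it suffices to bound the difference by a multiple of `ε`
  have key : ∀ ε > 0, |cylInt m J F (density m ν) w - μ w| ≤ (1 + μ w) * (1 + p []) * ε := by
    intro ε hε
    obtain ⟨f, -, hfd, hfc, hfi⟩ := hdi.exists_hasCompactSupport_integral_sub_le hε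
    -- the oscillation of `f` on cylinders of length `k` is at most `ε`
    obtain ⟨k, hk⟩ : ∃ k, ∀ v : List (Fin 2), v.length = k → ∀ x ∈ cyl J F v, ∀ y ∈ cyl J F v,
        |f x - f y| ≤ ε := by
      obtain ⟨c, D, hc, hc1, hD, hdist⟩ := hF.exists_dist_le
      obtain ⟨δ, hδ, hfδ⟩ := Metric.uniformContinuous_iff.1
        (CompactSpace.uniformContinuous_of_continuous hfc) ε hε
      have hlim : Tendsto (fun n : ℕ => D * c ^ n) atTop (𝓝 0) := by
        simpa using (tendsto_pow_atTop_nhds_zero_of_lt_one hc.le hc1).const_mul D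
      obtain ⟨n, hn⟩ := (hlim.eventually (gt_mem_nhds hδ)).exists
      refine ⟨n, fun v hv x hx y hy => (hfδ ?_).le⟩
      have := hdist v x hx y hy
      rw [hv] at this
      exact this.trans_lt hn
    choose z hz using fun v => hF.nonempty_cyl hm v
    have happrox : ∀ A, MeasurableSet A → |∫ x in A, density m ν x ∂m -
        ∑ v ∈ words k, f (z v) * m.real (cyl J F v ∩ A)| ≤ (1 + p []) * ε := by
      intro A hA
      have e1 : |∫ x in A, density m ν x ∂m - ∫ x in A, f x ∂m| ≤ ε := by
        rw [← integral_sub hdi.integrableOn hfi.integrableOn, ← Real.norm_eq_abs]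
        refine (norm_integral_le_integral_norm _).trans (le_trans ?_ hfd)
        exact setIntegral_le_integral (hdi.sub hfi).norm
          (Eventually.of_forall fun _ => norm_nonneg _)
      have e2 : ∫ x in A, f x ∂m = ∑ v ∈ words k, ∫ x in cyl J F v ∩ A, f x ∂m := by
        have hAi := hfi.indicator hA
        have h1 := (hF.isAdditive_cylInt hAi).push_pow_nil k
        rw [← sum_words] at h1
        have h2 : ∀ v, cylInt m J F (A.indicator f) v = ∫ x in cyl J F v ∩ A, f x ∂m := fun v =>
          setIntegral_indicator hA
        simp only [h2] at h1
        rw [h1]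
        simp [cyl]
      have e3 : |∫ x in A, f x ∂m - ∑ v ∈ words k, f (z v) * m.real (cyl J F v ∩ A)| ≤
          p [] * ε := by
        rw [e2, ← Finset.sum_sub_distrib]
        refine (Finset.abs_sum_le_sum_abs _ _).trans ?_
        have h1 : ∀ v ∈ words k, |∫ x in cyl J F v ∩ A, f x ∂m -
            f (z v) * m.real (cyl J F v ∩ A)| ≤ p v * ε := by
          intro v hv
          have h2 : ∫ x in cyl J F v ∩ A, f x ∂m - f (z v) * m.real (cyl J F v ∩ A) =
              ∫ x in cyl J F v ∩ A, (f x - f (z v)) ∂m := by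
            rw [integral_sub hfi.integrableOn (integrable_const _), setIntegral_const, smul_eq_mul,
              mul_comm (m.real _)]
          rw [h2, ← Real.norm_eq_abs]
          refine (norm_setIntegral_le_of_norm_le_const (measure_lt_top _ _) fun x hx =>
            hk v (mem_words.1 hv) x hx.1 (z v) (hz v)).trans ?_
          rw [mul_comm]
          exact mul_le_mul_of_nonneg_right (measureReal_mono Set.inter_subset_left) hε.le
        refine (Finset.sum_le_sum h1).trans (le_of_eq ?_)
        rw [← Finset.sum_mul, sum_words, h.add.push_pow_nil]
      have := abs_sub_le (∫ x in A, density m ν x ∂m) (∫ x in A, f x ∂m)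
        (∑ v ∈ words k, f (z v) * m.real (cyl J F v ∩ A))
      linarith
    set a := ∑ v ∈ words k, f (z v) * p v with ha
    have h1 : |1 - a| ≤ (1 + p []) * ε := by
      have := happrox Set.univ MeasurableSet.univ
      rw [hset] at this
      simpa [ha, hp, cylMass] using this
    have h2 : |cylInt m J F (density m ν) w - a * μ w| ≤ (1 + p []) * ε := by
      have hlim : Tendsto (fun n => ∑ v ∈ words k,
          f (z v) * m.real (cyl J F v ∩ F^[n] ⁻¹' cyl J F w)) atTop (𝓝 (a * μ w)) := by
        rw [ha, Finset.sum_mul]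
        refine tendsto_finsetSum _ fun v _ => ?_
        rw [mul_assoc]
        exact (hF.tendsto_real_inter h hμ hinv v w).const_mul _
      refine le_of_tendsto' ((tendsto_const_nhds.sub hlim).abs) fun n => ?_
      have := happrox (F^[n] ⁻¹' cyl J F w) ((hF.measurable.iterate n) (hF.measurableSet_cyl w))
      rwa [hinvn n] at this
    have h3 : |a * μ w - μ w| ≤ μ w * ((1 + p []) * ε) := by
      have : a * μ w - μ w = -(μ w * (1 - a)) := by ring
      rw [this, abs_neg, abs_mul, abs_of_nonneg (hμ.nonneg w)]
      exact mul_le_mul_of_nonneg_left h1 (hμ.nonneg w)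
    have := abs_sub_le (cylInt m J F (density m ν) w) (a * μ w) (μ w)
    linarith
  have hlim : Tendsto (fun ε : ℝ => (1 + μ w) * (1 + p []) * ε) (𝓝[>] 0) (𝓝 0) := by
    have : Tendsto (fun ε : ℝ => (1 + μ w) * (1 + p []) * ε) (𝓝 0)
        (𝓝 ((1 + μ w) * (1 + p []) * 0)) := tendsto_id.const_mul _
    rw [mul_zero] at this
    exact this.mono_left nhdsWithin_le_nhds
  have h0 := ge_of_tendsto hlim (eventually_nhdsWithin_of_forall fun ε hε => key ε hε)
  exact sub_eq_zero.1 (abs_nonpos_iff.1 h0)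

/-- A regular mass function is realized by a density: the densities on the cylinders of length `k`
converge uniformly as `k` grows. -/
theorem exists_density (hF : IsMarkovExpanding m J F g) {θ B γ : ℝ}
    (h : IsGibbs (cylMass m J F) θ B γ) {μ : List (Fin 2) → ℝ}
    (hμ : IsNormal (cylMass m J F) γ (coneConst θ B γ) μ) :
    ∃ ρ : X → ℝ, Integrable ρ m ∧ 0 ≤ᵐ[m] ρ ∧ cylInt m J F ρ = μ := by
  set p := cylMass m J F with hp
  set ρ : ℕ → X → ℝ := fun k x => ∑ v ∈ words k, (cyl J F v).indicator (fun _ => μ v / p v) x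
    with hρ
  have hρi : ∀ k, Integrable (ρ k) m := fun k => integrable_finsetSum _ fun v _ =>
    (integrable_const _).indicator (hF.measurableSet_cyl v)
  have hρv : ∀ v x, x ∈ cyl J F v → ρ v.length x = μ v / p v := by
    intro v x hx
    rw [hρ]
    refine (Finset.sum_eq_single v (fun u hu huv => ?_) fun hv => ?_).trans
      (Set.indicator_of_mem hx _)
    · refine Set.indicator_of_notMem (fun hxu => ?_) _
      have hl := mem_words.1 hu
      refine Set.disjoint_left.1
        (hF.disjoint_cyl (v := u) (w := v) (fun h' => ?_) fun h' => ?_) hxu hx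
      · exact huv (h'.eq_of_length hl)
      · exact huv (h'.eq_of_length hl.symm).symm
    · exact absurd (mem_words.2 rfl) hv
  obtain ⟨C, hC⟩ := IsNormal.exists_abs_density_sub_le h hμ
  set M := Real.exp (coneConst θ B γ * p [] ^ γ) / p [] with hM
  have hbd : ∀ k, ∀ᵐ x ∂m, 0 ≤ ρ k x ∧ ρ k x ≤ M := by
    intro k
    filter_upwards [hF.ae_itinerary] with x hx
    obtain ⟨v, rfl, hxv⟩ := exists_mem_cyl hx k
    rw [hρv v x hxv]
    exact ⟨div_nonneg (hμ.nonneg v) (h.pos v).le, (div_le_iff₀ (h.pos v)).2 (hμ.le h v)⟩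
  have hcau : ∀ᵐ x ∂m, ∃ l, Tendsto (fun k => ρ k x) atTop (𝓝 l) := by
    filter_upwards [hF.ae_itinerary] with x hx
    refine cauchySeq_tendsto_of_complete (cauchySeq_of_le_geometric (θ ^ γ) C
      (h.rpow_theta_lt h.gamma_pos) fun k => ?_)
    obtain ⟨v, rfl, hxv⟩ := exists_mem_cyl hx k
    obtain ⟨u, hu, hxu⟩ := exists_mem_cyl_append hx hxv 1
    obtain ⟨j, rfl⟩ := List.length_eq_one_iff.1 hu
    have h1 := hρv _ x hxu
    rw [List.length_append, List.length_singleton] at h1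
    rw [hρv v x hxv, h1, dist_comm, Real.dist_eq]
    exact hC v j
  obtain ⟨r, hrm, hr⟩ := measurable_limit_of_tendsto_metrizable_ae
    (fun k => (hρi k).aestronglyMeasurable.aemeasurable) hcau
  have hrbd : ∀ᵐ x ∂m, 0 ≤ r x ∧ r x ≤ M := by
    filter_upwards [ae_all_iff.2 hbd, hr] with x hx hxr
    exact ⟨ge_of_tendsto' hxr fun k => (hx k).1, le_of_tendsto' hxr fun k => (hx k).2⟩
  refine ⟨r, ?_, hrbd.mono fun x hx => hx.1, ?_⟩
  · refine Integrable.of_bound hrm.aestronglyMeasurable M (hrbd.mono fun x hx => ?_)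
    rw [Real.norm_eq_abs, abs_of_nonneg hx.1]
    exact hx.2
  · funext w
    have hlim : Tendsto (fun k => cylInt m J F (ρ k) w) atTop (𝓝 (cylInt m J F r w)) := by
      refine tendsto_integral_of_dominated_convergence (fun _ => M)
        (fun k => (hρi k).aestronglyMeasurable.restrict) (integrable_const _) (fun k => ?_)
        (ae_restrict_of_ae hr)
      refine ae_restrict_of_ae ((hbd k).mono fun x hx => ?_)
      rw [Real.norm_eq_abs, abs_of_nonneg hx.1]
      exact hx.2
    refine tendsto_nhds_unique hlim (tendsto_const_nhds.congr' ?_)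
    filter_upwards [eventually_ge_atTop w.length] with k hk
    refine (IsAdditive.eq_of_words (hF.isAdditive_cylInt (hρi k)) hμ.add k (fun v hv => ?_) hk).symm
    subst hv
    rw [cylInt, setIntegral_congr_fun (hF.measurableSet_cyl v) fun x hx => hρv v x hx,
      setIntegral_const, smul_eq_mul]
    exact mul_div_cancel₀ _ (h.pos v).ne'

theorem exists_isACIP (hF : IsMarkovExpanding m J F g) {θ B γ : ℝ}
    (h : IsGibbs (cylMass m J F) θ B γ) {μ : List (Fin 2) → ℝ}
    (hμ : IsNormal (cylMass m J F) γ (coneConst θ B γ) μ) (hinv : push μ = μ) :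
    ∃ ν : Measure X, IsACIP m F ν := by
  obtain ⟨ρ, hρi, hρ0, hρ⟩ := hF.exists_density h hμ
  set ν : Measure X := m.withDensity fun x => ENNReal.ofReal (ρ x) with hν
  have hac : ν ≪ m := withDensity_absolutelyContinuous _ _
  have hcyl : ∀ w, ν (cyl J F w) = ENNReal.ofReal (μ w) := by
    intro w
    rw [hν, withDensity_apply _ (hF.measurableSet_cyl w), ← hρ, cylInt,
      ofReal_integral_eq_lintegral_ofReal hρi.integrableOn (ae_restrict_of_ae hρ0)]
  have hprob : IsProbabilityMeasure ν := ⟨by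
    have := hcyl []
    rwa [hμ.total, ENNReal.ofReal_one] at this⟩
  have hmap : ν.map F ≪ m := (hac.map hF.measurable).trans
    hF.quasiMeasurePreserving.absolutelyContinuous
  have : IsFiniteMeasure (ν.map F) := Measure.isFiniteMeasure_map ν F
  refine ⟨ν, hprob, hac, hF.measurable, hF.ext_of_cyl hmap hac fun w => ?_⟩
  rw [Measure.map_apply hF.measurable (hF.measurableSet_cyl w),
    measure_congr (hac.ae_le (hF.preimage_cyl_ae_eq w)),
    measure_union (hF.disjoint_cons w) (hF.measurableSet_cyl _), hcyl, hcyl, hcyl,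
    ← ENNReal.ofReal_add (hμ.nonneg _) (hμ.nonneg _)]
  exact congrArg ENNReal.ofReal (congrFun hinv w)

theorem isACIP_unique (hF : IsMarkovExpanding m J F g) (hm : m ≠ 0) {θ B γ : ℝ}
    (h : IsGibbs (cylMass m J F) θ B γ) {μ : List (Fin 2) → ℝ}
    (hμ : IsNormal (cylMass m J F) γ (coneConst θ B γ) μ) (hinv : push μ = μ) {ν ν' : Measure X}
    (hν : IsACIP m F ν) (hν' : IsACIP m F ν') : ν = ν' := by
  have := hν.prob
  have := hν'.prob
  refine hF.ext_of_cyl hν.ac hν'.ac fun w => ?_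
  have key : ∀ {κ : Measure X}, IsACIP m F κ → κ.real (cyl J F w) = μ w := fun {κ} hκ => by
    have := hκ.prob
    exact (Measure.setIntegral_toReal_rnDeriv hκ.ac _).symm.trans
      (congrFun (hF.cylInt_density hm h hμ hinv hκ) w)
  exact (ENNReal.toReal_eq_toReal_iff' (measure_ne_top _ _) (measure_ne_top _ _)).1
    ((key hν).trans (key hν').symm)

end IsMarkovExpanding

end

/-! ### The Livšic equation -/

section

variable {p μ : List (Fin 2) → ℝ} {θ B γ s : ℝ}

theorem exists_abs_haarPair_le_wt (h : IsGibbs p θ B γ) (hsγ : s < γ)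
    (hμ : IsNormal p γ (coneConst θ B γ) μ) :
    ∃ C : ℝ, ∀ a, |haarPair p a μ| ≤ C * wt p s a := by
  obtain ⟨C, hC, hbound⟩ := exists_abs_haarPair_le h _ (coneConst_pos h).le
  set M := Real.exp (coneConst θ B γ * p [] ^ γ) / p [] with hM
  refine ⟨max 1 (C * M * p [] ^ (γ - s)), fun a => ?_⟩
  cases a with
  | none =>
    rw [haarPair_none, hμ.total, abs_one, wt, mul_one]
    exact le_max_left _ _
  | some w =>
    have hw := h.pos w
    have e2 : μ w / p w ≤ M := (div_le_iff₀ hw).2 (hμ.le h w)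
    have e3 : 0 ≤ μ w / p w := div_nonneg (hμ.nonneg w) hw.le
    calc |haarPair p (some w) μ| ≤ C * (μ w / p w) * p w ^ γ := hbound μ hμ.nonneg hμ.regular w
      _ ≤ C * M * (p [] ^ (γ - s) * p w ^ s) :=
          mul_le_mul (mul_le_mul_of_nonneg_left e2 hC) (h.rpow_gamma_le hsγ w)
            (Real.rpow_nonneg hw.le _) (mul_nonneg hC (e3.trans e2))
      _ = C * M * p [] ^ (γ - s) * p w ^ s := by ring
      _ ≤ _ := mul_le_mul_of_nonneg_right (le_max_right _ _) (wt_pos h.pos (some w)).le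

theorem exists_isMixing (h : IsGibbs p θ B γ) (hs : 0 < s) (hsγ : s < γ)
    (hμ : IsNormal p γ (coneConst θ B γ) μ) (hinv : push μ = μ) :
    ∃ c C, IsMixing (wt p s) (kernel p) none (fun a => haarPair p a μ) c C := by
  obtain ⟨C, hC⟩ := exists_abs_haarPair_le_wt h hsγ hμ
  obtain ⟨D, q, hD, hq, hq1, hdecay⟩ := exists_centered_le h hs hsγ hμ hinv
  refine ⟨fun n => D * (n + 1) * q ^ n, C, wt_pos h.pos, kernel_zero h.pos,
    hasSum_kernel_mul h.pos h.add, kernel_none_right h.pos h.add 1, hC, hdecay, ?_⟩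
  have h1 := summable_pow_mul_geometric_of_norm_lt_one 1
    (by rwa [Real.norm_eq_abs, abs_of_pos hq] : ‖q‖ < 1)
  have h2 := summable_geometric_of_lt_one hq.le hq1
  refine ((h1.add h2).mul_left D).congr fun n => ?_
  rw [pow_one]; ring

end

section

variable {𝕜 : Type*} [RCLike 𝕜] {X : Type*} [MeasurableSpace X] {m : Measure X}
  {J : Fin 2 → Set X} {F : X → X}

theorem weight_rpow (s : ℝ) (a : Option (List (Fin 2))) :
    weight m J F a ^ (-(-s)) = wt (cylMass m J F) s a := by
  cases a with
  | none => simp [weight, wt]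
  | some w => rw [neg_neg]; rfl

theorem mem_besov_iff {s : ℝ} {v : Distribution 𝕜} :
    v ∈ besov 𝕜 m J F (-s) ↔ Summable fun a => ‖v a‖ * wt (cylMass m J F) s a := by
  simp only [← weight_rpow]
  rfl

theorem besovNorm_eq (s : ℝ) (v : Distribution 𝕜) :
    besovNorm m J F (-s) v = wnorm (wt (cylMass m J F) s) v := by
  simp only [besovNorm, weight_rpow, wnorm]

end

end Livsic

open Livsic

theorem mainTheorem12 {𝕜 : Type*} [RCLike 𝕜]
    {X : Type*} [MetricSpace X] [CompactSpace X] [MeasurableSpace X] [BorelSpace X]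
    (m : Measure X) [IsFiniteMeasure m] (hm : m ≠ 0)
    (J : Fin 2 → Set X) (F : X → X) (g : X → ℝ) (hF : Livsic.IsMarkovExpanding m J F g)
    (s γ : ℝ) (hs : 0 < s) (hsγ : s < γ)
    (hg : Livsic.MemBesovInf m J F γ (Livsic.haarCoeff m J F (fun x => Real.log (g x)))) :
    -- there is a unique absolutely continuous invariant probability
    (∃! μ : Measure X, Livsic.IsACIP m F μ) ∧
    ∀ μ : Measure X, Livsic.IsACIP m F μ →
      -- the pairing with its density is well defined and bounded on `B^{-s}_{1,1}`
      (∃ C : ℝ, ∀ v ∈ Livsic.besov 𝕜 m J F (-s),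
        Summable (Livsic.pairingTerm m J F v (Livsic.density m μ)) ∧
        ‖∑' a, Livsic.pairingTerm m J F v (Livsic.density m μ) a‖ ≤
          C * Livsic.besovNorm m J F (-s) v) ∧
      -- the compositions with the iterates of `F` are well defined on `B^{-s}_{1,1}`
      (∀ v ∈ Livsic.besov 𝕜 m J F (-s), ∀ k : ℕ,
        (∀ b, Summable (Livsic.compTerm m J F F^[k] v b)) ∧
        Livsic.comp m J F F^[k] v ∈ Livsic.besov 𝕜 m J F (-s)) ∧
      -- the solution operator `φ ↦ ψ_φ` on `V₀`
      ∃ T : Livsic.annihilator 𝕜 m J F (-s) (Livsic.density m μ) →ₗ[𝕜]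
          Livsic.annihilator 𝕜 m J F (-s) (Livsic.density m μ),
        (∃ C : ℝ, ∀ φ : Livsic.annihilator 𝕜 m J F (-s) (Livsic.density m μ),
          Livsic.besovNorm m J F (-s) (T φ : Livsic.Distribution 𝕜) ≤
            C * Livsic.besovNorm m J F (-s) (φ : Livsic.Distribution 𝕜)) ∧
        ∀ φ : Livsic.annihilator 𝕜 m J F (-s) (Livsic.density m μ),
          -- the solutions of `φ = ψ ∘ F - ψ` in `B^{-s}_{1,1}` are exactly the `ψ_φ + c 1`
          (∀ ψ ∈ Livsic.besov 𝕜 m J F (-s),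
            (φ : Livsic.Distribution 𝕜) = Livsic.comp m J F F ψ - ψ ↔
              ∃ c : 𝕜, ψ = (T φ : Livsic.Distribution 𝕜) + c • Livsic.one 𝕜) ∧
          -- `ψ_φ = - ∑ₖ φ ∘ F^k`, with convergence in `B^{-s}_{1,1}`
          Tendsto (fun n : ℕ => Livsic.besovNorm m J F (-s)
              ((T φ : Livsic.Distribution 𝕜) +
                ∑ k ∈ Finset.range n, Livsic.comp m J F F^[k] (φ : Livsic.Distribution 𝕜)))
            atTop (𝓝 0) := by
  obtain ⟨θ, B, h⟩ := hF.exists_isGibbs hm (hs.trans hsγ) hg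
  obtain ⟨ν, hν, hinv⟩ := exists_isNormal_push_eq h
  refine ⟨?_, fun μ hμ => ?_⟩
  · obtain ⟨μ, hμ⟩ := hF.exists_isACIP h hν hinv
    exact ⟨μ, hμ, fun μ' hμ' => hF.isACIP_unique hm h hν hinv hμ' hμ⟩
  obtain ⟨c, C, hmix⟩ := exists_isMixing h hs hsγ hν hinv
  have := hμ.prob
  set p := cylMass m J F with hp
  set e : Option (List (Fin 2)) → ℝ := fun a => haarPair p a ν with he
  have hpair : ∀ v : Distribution 𝕜, pairingTerm m J F v (density m μ) =
      fun a => v a * ((e a : ℝ) : 𝕜) := by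
    intro v
    funext a
    rw [pairingTerm, hF.integral_haar_mul (f := density m μ) Measure.integrable_toReal_rnDeriv,
      hF.cylInt_density hm h hν hinv hμ]
  have hcompTerm : ∀ (k : ℕ) (v : Distribution 𝕜) b, compTerm m J F F^[k] v b =
      fun a => v a * ((kernel p k b a : ℝ) : 𝕜) := by
    intro k v b
    funext a
    rw [compTerm, hF.haarCoeff_haar_iterate hm]
  have hcomp : ∀ (k : ℕ) (v : Distribution 𝕜), comp m J F F^[k] v = kernelApply (kernel p k) v := by
    intro k v
    funext b
    rw [comp, hcompTerm]
    rfl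
  have hcomp1 : ∀ v : Distribution 𝕜, comp m J F F v = kernelApply (kernel p 1) v := hcomp 1
  have hinvE : ∀ k a, HasSum (fun b => kernel p k b a * e b) (e a) :=
    hasSum_kernel_mul_haarPair h.pos h.add hν.add hinv
  have hmem : ∀ {v : Distribution 𝕜}, v ∈ annihilator 𝕜 m J F (-s) (density m μ) ↔
      (Summable fun a => ‖v a‖ * wt p s a) ∧ ∑' a, v a * ((e a : ℝ) : 𝕜) = 0 := by
    intro v
    change v ∈ besov 𝕜 m J F (-s) ∧ HasSum (pairingTerm m J F v (density m μ)) 0 ↔ _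
    rw [mem_besov_iff, hpair]
    refine and_congr_right fun hv => ⟨fun h0 => h0.tsum_eq, fun h0 => ?_⟩
    rw [← h0]
    exact (hmix.hasSum_pairing hv).1.hasSum
  refine ⟨⟨C, fun v hv => ?_⟩, fun v hv k => ?_, ?_⟩
  · rw [hpair, besovNorm_eq]
    exact hmix.hasSum_pairing (mem_besov_iff.1 hv)
  · have h1 := (hmix.isBoundedKernel k).apply hmix.pos (mem_besov_iff.1 hv)
    refine ⟨fun b => ?_, ?_⟩
    · rw [hcompTerm]
      exact h1.2.1 b
    · rw [hcomp, mem_besov_iff]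
      exact h1.2.2.1
  let T : annihilator 𝕜 m J F (-s) (density m μ) →ₗ[𝕜]
      annihilator 𝕜 m J F (-s) (density m μ) :=
    { toFun := fun φ => ⟨IsMixing.solve (kernel p) none e φ.1, hmem.2
        ⟨(hmix.summable_solve (hmem.1 φ.2).1).1,
          hmix.tsum_pairing_solve (hmem.1 φ.2).1 hinvE (hmem.1 φ.2).2⟩⟩
      map_add' := fun φ φ' => Subtype.ext (hmix.solve_add (hmem.1 φ.2).1 (hmem.1 φ'.2).1)
      map_smul' := fun r φ => Subtype.ext (IsMixing.solve_smul r φ.1) }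
  refine ⟨T, ⟨∑' n, c n, fun φ => ?_⟩, fun φ => ⟨fun ψ hψ => ?_, ?_⟩⟩
  · rw [besovNorm_eq, besovNorm_eq]
    exact (hmix.summable_solve (hmem.1 φ.2).1).2
  · obtain ⟨hφ, hφ0⟩ := hmem.1 φ.2
    have hψ' := mem_besov_iff.1 hψ
    have hT := (hmix.summable_solve hφ).1
    have hone : Summable fun a => ‖one 𝕜 a‖ * wt p s a :=
      (hasSum_single none fun a ha => by
        simp [one, Pi.single_eq_of_ne ha]).summable
    have hsol := hmix.kernelApply_solve_sub hφ hφ0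
    have hK := hmix.isBoundedKernel 1
    rw [hcomp1]
    constructor
    · intro heq
      have hneg := summable_weighted_neg hT
      have hδ := (summable_weighted_add hmix.pos hψ' hneg).1
      -- the difference of two solutions is invariant under composition with `F`
      have hfix : kernelApply (kernel p 1) (ψ + -IsMixing.solve (kernel p) none e φ.1) =
          ψ + -IsMixing.solve (kernel p) none e φ.1 := by
        rw [hK.kernelApply_add hmix.pos hψ' hneg, ← neg_one_smul 𝕜, kernelApply_smul,
          eq_add_of_sub_eq heq.symm, eq_add_of_sub_eq hsol]
        simp only [neg_smul, one_smul]
        abel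
      have := hmix.eq_smul_of_kernelApply_eq hδ hfix
      rw [← sub_eq_add_neg, sub_eq_iff_eq_add'] at this
      exact ⟨_, this⟩
    · rintro ⟨r, rfl⟩
      change φ.1 = kernelApply (kernel p 1) (IsMixing.solve (kernel p) none e φ.1 + r • one 𝕜) -
        (IsMixing.solve (kernel p) none e φ.1 + r • one 𝕜)
      have h1 : kernelApply (kernel p 1) (one 𝕜) = one 𝕜 := hmix.kernelApply_single
      rw [hK.kernelApply_add hmix.pos hT (summable_weighted_smul r hone), kernelApply_smul, h1,
        add_sub_add_right_eq_sub, hsol]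
  · simp only [hcomp, besovNorm_eq]
    exact hmix.tendsto_solve_remainder (hmem.1 φ.2).1 (hmem.1 φ.2).2
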